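/- Let $N\ge 3$. There is a constant $C>0$, depending only on $N$, such that the following holds. Let $p_1,\dots,p_N$ be distinct points of the unit circle in counterclockwise order and $\mathbb D_{[N]}=\overline{\mathbb D}\setminus\{p_1,\dots,p_N\}$, where $\overline{\mathbb D}$ is the closed unit disk. Then there is a conformal model $(\Theta,g_\Theta)$ of $\mathbb D_{[N]}$: a homeomorphism $h:\mathbb D_{[N]}\to\Theta$, biholomorphic in the interior, onto $\Theta=\{z\in\mathbb C:\operatorname{Im} z\ge 0\}\setminus P$ with $P\subset\mathbb R$ finite, together with a smooth metric $g_\Theta=\rho^2|dz|^2$ on the double $\breve\Theta=\mathbb C\setminus P$ of $\Theta$ that is invariant under complex conjugation. There is also a complete metric ribbon tree $\Gamma$ with external vertices $p_1,\dots,p_N$: a finite tree whose 1-valent vertices are exactly $p_1,\dots,p_N$, whose other (internal) vertices all have valence $\ge 3$, which embeds in the disk with $p_1,\dots,p_N$ on the boundary circle in this cyclic order, and whose legs (edges) $\nu$ have lengths $\gamma_\nu\in(0,\infty]$ with $\gamma_\nu=\infty$ exactly for the legs $\nu_i$ ending at the $p_i$. Write $C^0_{\rm int}(\Gamma)$ and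 $C^1(\Gamma)$ for its internal vertices and its legs. Finally there is a decomposition $$\Theta=\bigcup_{\nu\in C^0_{\rm int}(\Gamma)\cup C^1(\Gamma)}\Theta(\nu)$$ with the following properties. 1. For $\nu\in C^0_{\rm int}(\Gamma)$ the piece $(\Theta(\nu),g_\Theta)$ has bounded geometry: its diameter, for the distance given by paths inside $\Theta(\nu)$, is at most $C$; its Gauss curvature is at most $C$ in absolute value; and at each of its points the injectivity radius of $(\breve\Theta,g_\Theta)$ is at least $1/C$. Moreover, for any two different legs $\nu',\nu''$, the arcs $\Theta(\nu)\cap\overline{\Theta(\nu')}$ and $\Theta(\nu)\cap\overline{\Theta(\nu'')}$ along which their pieces are attached to $\Theta(\nu)$ (empty if the leg does not end at $\nu$) have distance at least $1/C$ inside $\Theta(\nu)$. 2. For $\nu\in C^1(\Gamma)$ there is an isometry $F_\nu$ from the flat strip $(0,\gamma_\nu)\times[0,1]$ onto $(\Theta(\nu),g_\Theta)$; it maps exactly the sides $(0,\gamma_\nu)\times\{0,1\}$ into $\partial\Theta$. For the external leg $\nu_i$, $h^{-1}(F_{\nu_i}(x,y))\to p_i$ as $x\to\infty$, uniformly in $y$.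 3. There is a continuous map $\phi:\Theta\to\Gamma\setminus\{p_1,\dots,p_N\}$ with $\phi(\Theta(\nu))=\nu$ for every internal vertex and every (open) leg $\nu$; on the piece of a leg, $\phi(F_\nu(x,y))$ is the point with length coordinate $x$ on $\nu$, where internal legs are directed arbitrarily and $\nu_i$ is directed towards $p_i$. -/

import Mathlib

open Set Filter Topology Metric
open scoped ContDiff ENNReal

noncomputable section

/-- The closed unit disk with `N` distinct marked points on its boundary circle, listed in
counterclockwise cyclic order. -/
structure MarkedDisk (N : ℕ) where
  pt : Fin N → ℂ
  counterclockwise : ∃ θ : Fin N → ℝ, StrictMono θ ∧ (∀ i j, θ i < θ j + 2 * Real.pi) ∧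
    ∀ i, pt i = Complex.exp (θ i * Complex.I)

/-- The closed unit disk with the marked points removed. -/
def MarkedDisk.carrier {N : ℕ} (D : MarkedDisk N) : Set ℂ := closedBall 0 1 \ range D.pt

/-! ### Complete metric ribbon trees -/

/-- A complete metric ribbon tree with `N` external vertices.

`V` is the set of internal vertices and `Fin N` the set of external (1-valent) ones.
The legs are `E ⊕ Fin N`: the internal legs `e : E`, directed (arbitrarily) from `src e` to `tgt e`,
and the external legs `i : Fin N`, leading from the internal vertex `att i` to the external
vertex `i`. Loops and multiple legs are excluded, and the resulting graph is a tree.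
Internal vertices have valence at least three.

`noncrossing` says that the tree is compatible with the cyclic order of its external vertices,
that is, it embeds in the disk with its external vertices on the boundary circle in this order:
if `i, k` separate `j, l` in the cyclic order, then the path from `i` to `k` meets the
path from `j` to `l`. -/
structure MetricRibbonTree (N : ℕ) where
  V : Type
  E : Type
  finite_V : Finite V
  finite_E : Finite E
  src : E → V
  tgt : E → V
  att : Fin N → V
  ends : E ⊕ Fin N → Sym2 (V ⊕ Fin N)
  ends_internal : ∀ e, ends (.inl e) = s(.inl (src e), .inl (tgt e))
  ends_external : ∀ i, ends (.inr i) = s(.inl (att i), .inr i)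
  no_loop : ∀ ℓ, ¬ (ends ℓ).IsDiag
  no_multiple : Function.Injective ends
  isTree : (SimpleGraph.fromEdgeSet (range ends)).IsTree
  three_le_valence : ∀ v : V, 3 ≤ {ℓ | Sum.inl v ∈ ends ℓ}.ncard
  noncrossing : ∀ i j k l : Fin N, i < j → j < k → k < l →
    ∀ (p : (SimpleGraph.fromEdgeSet (range ends)).Walk (.inr i) (.inr k))
      (q : (SimpleGraph.fromEdgeSet (range ends)).Walk (.inr j) (.inr l)),
      ∃ x, x ∈ p.support ∧ x ∈ q.support
  /-- The length of a leg; it is infinite exactly for the external legs. -/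
  length : E ⊕ Fin N → EReal
  length_pos : ∀ ℓ, 0 < length ℓ
  length_eq_top_iff : ∀ ℓ, length ℓ = ⊤ ↔ ∃ i, ℓ = .inr i

namespace MetricRibbonTree

variable {N : ℕ} (Γ : MetricRibbonTree N)

/-- The legs (internal and external). -/
abbrev Leg : Type := Γ.E ⊕ Fin N

/-- The strata: internal vertices and legs. -/
abbrev Stratum : Type := Γ.V ⊕ Γ.Leg

/-- The vertex at which the coordinate of a leg vanishes. -/
def start : Γ.Leg → Γ.V := Sum.elim Γ.src Γ.att

/-- A leg with its finite end points: `[0, γ]`, or `[0, ∞)` for an external leg. -/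
abbrev ClosedLeg (ℓ : Γ.Leg) : Type := {x : ℝ // 0 ≤ x ∧ (x : EReal) ≤ Γ.length ℓ}

/-- The internal vertices as a discrete space. -/
instance : TopologicalSpace Γ.V := ⊥

/-- End points of legs are glued to the vertices where the legs end. -/
inductive Glue : (Γ.V ⊕ (Σ ℓ : Γ.Leg, Γ.ClosedLeg ℓ)) →
    (Γ.V ⊕ (Σ ℓ : Γ.Leg, Γ.ClosedLeg ℓ)) → Prop
  | atStart (ℓ : Γ.Leg) (x : Γ.ClosedLeg ℓ) (hx : x.1 = 0) :
      Glue (.inr ⟨ℓ, x⟩) (.inl (Γ.start ℓ))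
  | atEnd (e : Γ.E) (x : Γ.ClosedLeg (.inl e)) (hx : (x.1 : EReal) = Γ.length (.inl e)) :
      Glue (.inr ⟨.inl e, x⟩) (.inl (Γ.tgt e))

/-- The tree as a topological space. The external vertices, which lie at infinite
distance, are not points of it. -/
def Space : Type := Quot Γ.Glue

instance : TopologicalSpace Γ.Space := inferInstanceAs (TopologicalSpace (Quot Γ.Glue))

/-- An internal vertex, as a point of the tree. -/
def vertexPoint (v : Γ.V) : Γ.Space := Quot.mk _ (.inl v)

/-- The point with coordinate `x` on a leg. -/
def legPoint (ℓ : Γ.Leg) (x : Γ.ClosedLeg ℓ) : Γ.Space := Quot.mk _ (.inr ⟨ℓ, x⟩)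

/-- The points of a stratum: a vertex, or a leg without its end points. -/
def stratumSet : Γ.Stratum → Set Γ.Space
  | .inl v => {Γ.vertexPoint v}
  | .inr ℓ => {q | ∃ x : Γ.ClosedLeg ℓ, 0 < x.1 ∧ (x.1 : EReal) < Γ.length ℓ ∧ q = Γ.legPoint ℓ x}

end MetricRibbonTree

/-! ### Conformal metrics `ρ² |dz|²` on plane domains -/

/-- Length of the path `c : [0, 1] → ℂ` in the metric `ρ² |dz|²`. -/
def pathLength (ρ : ℂ → ℝ) (c : ℝ → ℂ) : ℝ≥0∞ :=
  ∫⁻ s in Icc (0 : ℝ) 1, ENNReal.ofReal (ρ (c s) * ‖derivWithin c (Icc 0 1) s‖)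

/-- The distance in `Y` with respect to `ρ² |dz|²`: the infimum of the lengths of the
continuously differentiable paths inside `Y` (whose velocity may vanish). -/
def innerDist (ρ : ℂ → ℝ) (Y : Set ℂ) (x y : ℂ) : ℝ≥0∞ :=
  ⨅ c ∈ {c : ℝ → ℂ | ContDiffOn ℝ 1 c (Icc 0 1) ∧ MapsTo c (Icc 0 1) Y ∧ c 0 = x ∧ c 1 = y},
    pathLength ρ c

/-- Gauss curvature of `ρ² |dz|²`. -/
def gaussCurvature (ρ : ℂ → ℝ) (z : ℂ) : ℝ :=
  -(Laplacian.laplacian (fun w => Real.log (ρ w)) z) / ρ z ^ 2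

/-- The geodesic equation of the metric `e^{2u} |dz|²`, `u = log ρ`:
`c'' = |c'|² ∇u(c) - 2 du(c') c'`. -/
def IsGeodesicOn (ρ : ℂ → ℝ) (c : ℝ → ℂ) (s : Set ℝ) : Prop :=
  ∀ t ∈ s, DifferentiableAt ℝ c t ∧
    HasDerivAt (deriv c)
      (‖deriv c t‖ ^ 2 • gradient (fun w => Real.log (ρ w)) (c t)
        - (2 * fderiv ℝ (fun w => Real.log (ρ w)) (c t) (deriv c t)) • deriv c t) t

/-- The injectivity radius at `z` of the domain `U` with the metric `ρ² |dz|²` is at least `r`: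
the exponential map at `z` is defined on the ball of radius `r` of the tangent space and is a
diffeomorphism onto its image there. Here `X` is the exponential map, the tangent space being
identified with the Euclidean plane by a linear isometry. -/
def InjRadiusGE (ρ : ℂ → ℝ) (U : Set ℂ) (z : ℂ) (r : ℝ) : Prop :=
  ∃ X : ℂ → ℂ, X 0 = z ∧ (∀ v, ρ z * ‖fderiv ℝ X 0 v‖ = ‖v‖) ∧
    (∀ v, ‖v‖ = 1 → IsGeodesicOn ρ (fun t : ℝ => X (t • v)) (Ioo (-r) r)) ∧
    MapsTo X (ball 0 r) U ∧ InjOn X (ball 0 r) ∧ ContDiffOn ℝ 1 X (ball 0 r) ∧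
    ∀ w ∈ ball (0 : ℂ) r, Function.Bijective (fderiv ℝ X w)

/-- The strip `(0, γ) × [0, 1]` in `ℂ = ℝ²`. -/
def flatStrip (γ : EReal) : Set ℂ :=
  {w | 0 < w.re ∧ (w.re : EReal) < γ ∧ 0 ≤ w.im ∧ w.im ≤ 1}

/-! ### Conformal models -/

/-- A conformal model `(Θ, g_Θ)` of the punctured disk `D`, realised as the upper half of its
double: `Θ` is the closed upper half plane minus finitely many real points, one of the punctures
being at infinity; the double is `ℂ` minus these points. The metric `g_Θ = ρ² |dz|²` is smooth
on the double and invariant under complex conjugation. `chart` is the homeomorphism from `D`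
to `Θ`, biholomorphic in the interior. -/
structure ConformalModel {N : ℕ} (D : MarkedDisk N) where
  punctures : Set ℝ
  finite_punctures : punctures.Finite
  chart : PartialEquiv ℂ ℂ
  chart_source : chart.source = D.carrier
  chart_target : chart.target = {z : ℂ | 0 ≤ z.im} \ (Complex.ofReal '' punctures)
  continuousOn_chart : ContinuousOn chart chart.source
  continuousOn_chart_symm : ContinuousOn chart.symm chart.target
  image_interior : chart '' ball 0 1 = {z : ℂ | 0 < z.im}
  holomorphic_chart : DifferentiableOn ℂ chart (ball 0 1)
  holomorphic_chart_symm : DifferentiableOn ℂ chart.symm {z : ℂ | 0 < z.im}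
  ρ : ℂ → ℝ
  ρ_smooth : ContDiffOn ℝ ∞ ρ (Complex.ofReal '' punctures)ᶜ
  ρ_pos : ∀ z ∈ (Complex.ofReal '' punctures)ᶜ, 0 < ρ z
  ρ_conj : ∀ z, ρ (starRingEnd ℂ z) = ρ z

namespace ConformalModel

variable {N : ℕ} {D : MarkedDisk N} (M : ConformalModel D)

/-- The surface with boundary `Θ`. Its boundary consists of its real points. -/
def Θ : Set ℂ := {z : ℂ | 0 ≤ z.im} \ (Complex.ofReal '' M.punctures)

/-- The double of `Θ`. -/
def double : Set ℂ := (Complex.ofReal '' M.punctures)ᶜ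

/-- The part `Y` of `Θ` has bounded geometry with constant `C`: its diameter (for the inner
distance) and its curvature are bounded by `C`, and the injectivity radius at its points is
bounded from below by `1 / C`. As `Θ` has a boundary, the injectivity radius is taken
in the double. -/
def BoundedGeometry (C : ℝ) (Y : Set ℂ) : Prop :=
  (∀ x ∈ Y, ∀ y ∈ Y, innerDist M.ρ Y x y ≤ ENNReal.ofReal C) ∧
  (∀ z ∈ Y, |gaussCurvature M.ρ z| ≤ C) ∧
  (∀ z ∈ Y, InjRadiusGE M.ρ M.double z (1 / C))

/-- `F` is an isometry of surfaces with boundary from the flat strip `(0, γ) × [0, 1]` onto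
the part `Y` of `Θ`; the two long sides of the strip go to the boundary of `Θ`. -/
structure IsStripIsometry (γ : EReal) (Y : Set ℂ) (F : ℂ → ℂ) : Prop where
  bijOn : BijOn F (flatStrip γ) Y
  smooth : ContDiffOn ℝ ∞ F (flatStrip γ)
  isometric : ∀ w ∈ flatStrip γ, ∀ v : ℂ,
    M.ρ (F w) * ‖fderivWithin ℝ F (flatStrip γ) w v‖ = ‖v‖
  boundary : ∀ w ∈ flatStrip γ, (F w).im = 0 ↔ w.im = 0 ∨ w.im = 1

end ConformalModel

end

/-! A Cayley transform sends the last marked point to infinity and the other `n = N - 1` points to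
reals `a 0 < ... < a (n - 1)`, so everything is done in the closed upper half plane without these
points. What is needed is a multiscale description of finitely many reals whose constants depend on
`n` only.

Call a nonempty set `I` of points a cluster if its distance to the remaining points is at least 64
times its diameter. Two clusters are nested or disjoint (`IsCluster.trichotomy`). Around each
cluster lies an annulus with inner radius `4 * diam` and outer radius `gap / 8`. The annulus of a
single point reaches down to the point, and that of the cluster of all points reaches infinity.
Closed annuli of different clusters are disjoint. With the metric `|dz| / (π |z - c|)`, the upper
half of an annulus becomes a flat strip of height 1 under the logarithm; these are the legs. What
remains of the inner disk of a cluster `S` with at least two points, once the outer disks of the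
smaller clusters are removed, is the vertex piece of `S`. Inclusion of clusters gives the tree: the
leg of `I` joins the vertex `I` to the vertex of its parent, the smallest cluster strictly
containing `I`. For a single point or for the cluster of all points, one end is instead an external
vertex. Clusters are intervals of indices, hence the tree is planar in the right order.

The decisive estimate is `invOuterRadius_mul_innerRadius_parent_le`: the outer radius of `T` and the
inner radius of its parent are comparable, because a pigeonhole argument
(`exists_isCluster_pointsNear`) always finds a cluster at a scale comparable to the gap of `T`.
Hence a vertex piece sees one scale `R`, its inner radius.

The logarithm of the conformal factor is a sum of the potentials `-log |z - c_I|`, smoothed inside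
the inner disks and glued by cutoffs. Near a vertex piece it equals, up to a constant, the globally
smooth `localPotential` (`logFactor_eq_localPotential`), whose derivatives up to order two are
bounded at scale `R` by a constant depending on `n` (`exists_scaledBound_localPotential`). So the
factor is comparable to `1 / R`, and `R` cancels from the diameter, the curvature, the injectivity
radius and the distance between attaching arcs (`exists_geometry_constant`).

The injectivity radius requires an exponential map. After rescaling, the geodesic equation is a
small perturbation of the equation of straight lines. It is solved as a fixed point problem for the
velocity curve in the Banach space of curves on `[-1, 1]`, where the inverse function theorem gives
dependence of class `C¹` on the initial velocity (`exists_geodesicVelocity`,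
`exists_expMap_normalized`, `injRadiusGE_of_bounds`). -/

noncomputable section

/-! ### Superposition and integration operators on spaces of continuous functions -/

section Superposition

variable {T E F : Type*} [TopologicalSpace T] [CompactSpace T] [NormedAddCommGroup E]
  [NormedSpace ℝ E] [NormedAddCommGroup F] [NormedSpace ℝ F]

/-- Pointwise application of a continuous family of operators. -/
def pointwiseApply : C(T, E →L[ℝ] F) →L[ℝ] C(T, E) →L[ℝ] C(T, F) :=
  LinearMap.mkContinuous₂
    (LinearMap.mk₂ ℝ (fun (A : C(T, E →L[ℝ] F)) (h : C(T, E)) =>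
      (⟨fun t => A t (h t), by fun_prop⟩ : C(T, F)))
      (fun _ _ _ => by ext; simp) (fun _ _ _ => by ext; simp)
      (fun _ _ _ => by ext; simp) (fun _ _ _ => by ext; simp)) 1 (fun A h => by
        rw [ContinuousMap.norm_le _ (by positivity)]
        intro t
        simp only [LinearMap.mk₂_apply, ContinuousMap.coe_mk, one_mul]
        exact ((A t).le_opNorm _).trans
          (by gcongr; exacts [A.norm_coe_le_norm t, h.norm_coe_le_norm t]))

/-- The mean value inequality applies at each `t` separately, and the error is uniform in `t`
because postcomposition with `fderiv ℝ f` is continuous for the sup norm. This makes the right hand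
side of an autonomous differential equation a `C¹` map between spaces of curves. -/
theorem hasFDerivAt_postcomp {f : E → F} (hf : ContDiff ℝ 1 f) (y : C(T, E)) :
    HasFDerivAt (fun y : C(T, E) => (⟨f, hf.continuous⟩ : C(E, F)).comp y)
      (pointwiseApply ((⟨fderiv ℝ f, hf.continuous_fderiv one_ne_zero⟩ : C(E, E →L[ℝ] F)).comp y))
      y := by
  set f' : C(E, E →L[ℝ] F) := ⟨fderiv ℝ f, hf.continuous_fderiv one_ne_zero⟩ with hf'
  apply HasFDerivAt.of_isLittleO
  rw [Asymptotics.isLittleO_iff]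
  intro c hc
  have hcont : Continuous (fun y : C(T, E) => f'.comp y) := ContinuousMap.continuous_postcomp f'
  obtain ⟨δ, hδ, hball⟩ := (Metric.continuousAt_iff (α := C(T, E)) (β := C(T, E →L[ℝ] F))).1
    (hcont.continuousAt (x := y)) c hc
  filter_upwards [Metric.ball_mem_nhds y hδ] with y' hy'
  rw [ContinuousMap.norm_le _ (by positivity)]
  intro t
  -- A point of the segment is the value at `t` of the curve `y + s • (y' - y)`, which is still in
  -- the `δ`-ball around `y`.
  have key : ∀ x ∈ segment ℝ (y t) (y' t), ‖fderiv ℝ f x - fderiv ℝ f (y t)‖ ≤ c := by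
    rintro x hx
    obtain ⟨s, ⟨hs0, hs1⟩, rfl⟩ := (segment_eq_image' ℝ (y t) (y' t)) ▸ hx
    have hmem : dist (y + s • (y' - y)) y < δ := by
      rw [dist_eq_norm, add_sub_cancel_left, norm_smul, Real.norm_of_nonneg hs0]
      rw [Metric.mem_ball, dist_eq_norm] at hy'
      exact lt_of_le_of_lt (mul_le_of_le_one_left (norm_nonneg _) hs1) hy'
    have h1 := (ContinuousMap.dist_apply_le_dist (f := f'.comp (y + s • (y' - y)))
      (g := f'.comp y) t).trans (hball hmem).le
    rw [dist_eq_norm] at h1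
    exact h1
  have := (convex_segment (y t) (y' t)).norm_image_sub_le_of_norm_hasFDerivWithin_le'
    (f := f) (f' := fderiv ℝ f) (φ := fderiv ℝ f (y t))
    (fun x _ => (hf.differentiable one_ne_zero x).hasFDerivAt.hasFDerivWithinAt) key
    (left_mem_segment ℝ _ _) (right_mem_segment ℝ _ _)
  refine this.trans ?_
  gcongr
  exact (y' - y).norm_coe_le_norm t

theorem contDiff_one_postcomp {f : E → F} (hf : ContDiff ℝ 1 f) :
    ContDiff ℝ 1 (fun y : C(T, E) => (⟨f, hf.continuous⟩ : C(E, F)).comp y) :=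
  contDiff_one_iff_hasFDerivAt.2 ⟨_, pointwiseApply.continuous.comp
    (ContinuousMap.continuous_postcomp _), fun y => hasFDerivAt_postcomp hf y⟩

end Superposition

/-! ### Primitives of curves on `[-1, 1]`. -/

section Integration

variable {E : Type*} [NormedAddCommGroup E]

/-- Continuous curves on `[-1, 1]`. -/
abbrev UnitCurve (E : Type*) [TopologicalSpace E] : Type _ := C(Icc (-1 : ℝ) 1, E)

/-- The extension of a curve on `[-1, 1]` to the line. -/
def UnitCurve.ext (p : UnitCurve E) : ℝ → E := IccExtend (by norm_num : (-1 : ℝ) ≤ 1) p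

theorem UnitCurve.continuous_ext (p : UnitCurve E) : Continuous p.ext :=
  p.continuous.Icc_extend'

theorem UnitCurve.ext_of_mem (p : UnitCurve E) {t : ℝ} (ht : t ∈ Icc (-1 : ℝ) 1) :
    p.ext t = p ⟨t, ht⟩ := IccExtend_of_mem _ _ ht

theorem UnitCurve.norm_ext_le (p : UnitCurve E) (t : ℝ) : ‖p.ext t‖ ≤ ‖p‖ :=
  p.norm_coe_le_norm _

variable [NormedSpace ℝ E]

/-- The primitive vanishing at `0`. -/
def curvePrimitive : UnitCurve E →L[ℝ] UnitCurve E :=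
  LinearMap.mkContinuous
    { toFun := fun p => ⟨fun t => ∫ s in (0 : ℝ)..t, p.ext s,
        (intervalIntegral.continuous_primitive
          (fun _ _ => p.continuous_ext.intervalIntegrable _ _) 0).comp continuous_subtype_val⟩
      map_add' := fun p q => by
        ext t
        exact intervalIntegral.integral_add (p.continuous_ext.intervalIntegrable _ _)
          (q.continuous_ext.intervalIntegrable _ _)
      map_smul' := fun r p => by
        ext t
        exact intervalIntegral.integral_smul r p.ext } 1 (fun p => by
          rw [ContinuousMap.norm_le _ (by positivity)]
          rintro ⟨t, ht⟩
          refine (intervalIntegral.norm_integral_le_of_norm_le_const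
            (fun s _ => p.norm_ext_le s)).trans ?_
          rw [one_mul, sub_zero]
          exact mul_le_of_le_one_right (norm_nonneg _) (abs_le.2 ht))

theorem curvePrimitive_apply (p : UnitCurve E) (t : Icc (-1 : ℝ) 1) :
    curvePrimitive p t = ∫ s in (0 : ℝ)..t, p.ext s := rfl

theorem norm_curvePrimitive_le (p : UnitCurve E) : ‖curvePrimitive p‖ ≤ ‖p‖ := by
  have := (curvePrimitive (E := E)).le_of_opNorm_le (LinearMap.mkContinuous_norm_le _ zero_le_one _) p
  rwa [one_mul] at this

theorem hasDerivAt_curvePrimitive [CompleteSpace E] (p : UnitCurve E) {t : ℝ}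
    (ht : t ∈ Ioo (-1 : ℝ) 1) :
    HasDerivAt (curvePrimitive p).ext (p.ext t) t := by
  have h1 : HasDerivAt (fun t => ∫ s in (0 : ℝ)..t, p.ext s) (p.ext t) t :=
    intervalIntegral.integral_hasDerivAt_right (p.continuous_ext.intervalIntegrable _ _)
      (p.continuous_ext.stronglyMeasurableAtFilter _ _) p.continuous_ext.continuousAt
  refine h1.congr_of_eventuallyEq ?_
  filter_upwards [Ioo_mem_nhds ht.1 ht.2] with s hs
  rw [UnitCurve.ext_of_mem _ (Ioo_subset_Icc_self hs), curvePrimitive_apply]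

end Integration

/-! ### Geodesics of conformal metrics and the exponential map -/

theorem gradient_eq_complex (f : ℂ → ℝ) (z : ℂ) :
    gradient f z = (fderiv ℝ f z 1 : ℂ) + (fderiv ℝ f z Complex.I : ℂ) * Complex.I := by
  apply ext_inner_right ℝ
  intro v
  rw [gradient, InnerProductSpace.toDual_symm_apply, Complex.inner]
  have : v = v.re • (1 : ℂ) + v.im • Complex.I := by
    apply Complex.ext <;> simp
  conv_lhs => rw [this]
  simp only [map_add, map_smul, smul_eq_mul, Complex.mul_re, Complex.conj_re, Complex.add_re,
    Complex.ofReal_re, Complex.conj_im, Complex.add_im, Complex.mul_im, Complex.ofReal_im,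
    Complex.I_re, Complex.I_im]
  ring

/-- The acceleration of a geodesic of `e^{2u} |dz|²` with velocity `p` at a point where `du = l`. -/
def geodesicForce (l : ℂ →L[ℝ] ℝ) (p : ℂ) : ℂ :=
  ‖p‖ ^ 2 • ((l 1 : ℂ) + (l Complex.I : ℂ) * Complex.I) - (2 * l p) • p

/-- Quadratic homogeneity in the velocity is what makes a geodesic run at another constant rate a
geodesic again. -/
theorem geodesicForce_smul (l : ℂ →L[ℝ] ℝ) (s : ℝ) (p : ℂ) :
    geodesicForce l (s • p) = s ^ 2 • geodesicForce l p := by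
  simp only [geodesicForce, norm_smul, map_smul, smul_sub, smul_smul, smul_eq_mul, mul_pow,
    Real.norm_eq_abs, sq_abs]
  congr 2
  ring

theorem norm_gradientVector_le (l : ℂ →L[ℝ] ℝ) :
    ‖(l 1 : ℂ) + (l Complex.I : ℂ) * Complex.I‖ ≤ 2 * ‖l‖ := by
  have h1 : ‖l 1‖ ≤ ‖l‖ := by simpa using l.le_opNorm 1
  have h2 : ‖l Complex.I‖ ≤ ‖l‖ := by simpa using l.le_opNorm Complex.I
  calc _ ≤ ‖(l 1 : ℂ)‖ + ‖(l Complex.I : ℂ) * Complex.I‖ := norm_add_le _ _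
    _ = ‖l 1‖ + ‖l Complex.I‖ := by simp
    _ ≤ _ := by linarith

theorem norm_geodesicForce_le (l : ℂ →L[ℝ] ℝ) (p : ℂ) :
    ‖geodesicForce l p‖ ≤ 4 * ‖l‖ * ‖p‖ ^ 2 := by
  have h1 := norm_gradientVector_le l
  have h2 := l.le_opNorm p
  calc _ ≤ ‖‖p‖ ^ 2 • ((l 1 : ℂ) + (l Complex.I : ℂ) * Complex.I)‖ + ‖(2 * l p) • p‖ :=
        norm_sub_le _ _
    _ = ‖p‖ ^ 2 * ‖(l 1 : ℂ) + (l Complex.I : ℂ) * Complex.I‖ + 2 * ‖l p‖ * ‖p‖ := by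
        rw [norm_smul, norm_smul, norm_mul, Real.norm_of_nonneg (by positivity : 0 ≤ ‖p‖ ^ 2),
          Real.norm_two]
    _ ≤ ‖p‖ ^ 2 * (2 * ‖l‖) + 2 * (‖l‖ * ‖p‖) * ‖p‖ := by gcongr
    _ = _ := by ring

/-- The difference is split into a change of `l` at fixed velocity and a change of velocity at fixed
`l'`; the second part is a difference of quadratic terms, controlled since the velocities have norm
at most 2. -/
theorem norm_geodesicForce_sub_le (l l' : ℂ →L[ℝ] ℝ) {p p' : ℂ} (hp : ‖p‖ ≤ 2) (hp' : ‖p'‖ ≤ 2) :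
    ‖geodesicForce l p - geodesicForce l' p'‖ ≤ 16 * ‖l - l'‖ + 16 * ‖l'‖ * ‖p - p'‖ := by
  have e : geodesicForce l p - geodesicForce l' p' = geodesicForce (l - l') p +
      ((‖p‖ ^ 2 - ‖p'‖ ^ 2) • ((l' 1 : ℂ) + (l' Complex.I : ℂ) * Complex.I)
        - ((2 * l' (p - p')) • p + (2 * l' p') • (p - p'))) := by
    simp only [geodesicForce, sub_apply, map_sub, Complex.real_smul]
    push_cast
    ring
  have h0 := norm_geodesicForce_le (l - l') p
  have h1 : ‖p‖ ^ 2 ≤ 4 := by nlinarith [norm_nonneg p]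
  have h2 : |‖p‖ ^ 2 - ‖p'‖ ^ 2| ≤ 4 * ‖p - p'‖ := by
    rw [sq_sub_sq, abs_mul, abs_of_nonneg (by positivity)]
    gcongr
    · linarith
    · exact abs_norm_sub_norm_le _ _
  have h3 := norm_gradientVector_le l'
  have h4 := l'.le_opNorm (p - p')
  have h5 := l'.le_opNorm p'
  rw [e]
  calc _ ≤ ‖geodesicForce (l - l') p‖
        + (‖(‖p‖ ^ 2 - ‖p'‖ ^ 2) • ((l' 1 : ℂ) + (l' Complex.I : ℂ) * Complex.I)‖
        + (‖(2 * l' (p - p')) • p‖ + ‖(2 * l' p') • (p - p')‖)) :=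
        (norm_add_le _ _).trans (add_le_add le_rfl ((norm_sub_le _ _).trans
          (add_le_add le_rfl (norm_add_le _ _))))
    _ = ‖geodesicForce (l - l') p‖
        + (|‖p‖ ^ 2 - ‖p'‖ ^ 2| * ‖(l' 1 : ℂ) + (l' Complex.I : ℂ) * Complex.I‖
        + (2 * ‖l' (p - p')‖ * ‖p‖ + 2 * ‖l' p'‖ * ‖p - p'‖)) := by
        simp only [norm_smul, norm_mul, abs_two, Real.norm_eq_abs]
    _ ≤ 4 * ‖l - l'‖ * 4 + (4 * ‖p - p'‖ * (2 * ‖l'‖) + (2 * (‖l'‖ * ‖p - p'‖) * 2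
        + 2 * (‖l'‖ * 2) * ‖p - p'‖)) := by
        gcongr
        · exact h0.trans (by gcongr)
        · exact h5.trans (by gcongr)
    _ = _ := by ring

/-- The right hand side of the geodesic equation of `e^{2u} |dz|²`. -/
def geodesicField (u : ℂ → ℝ) (x : ℂ × ℂ) : ℂ := geodesicForce (fderiv ℝ u x.1) x.2

theorem contDiff_geodesicField {u : ℂ → ℝ} (hu : ContDiff ℝ 2 u) :
    ContDiff ℝ 1 (geodesicField u) := by
  have h1 : ContDiff ℝ 1 (fun x : ℂ × ℂ => fderiv ℝ u x.1) :=
    (hu.fderiv_right (m := 1) (by norm_num)).comp contDiff_fst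
  have h2 : ∀ g : ℂ × ℂ → ℂ, ContDiff ℝ 1 g →
      ContDiff ℝ 1 (fun x : ℂ × ℂ => fderiv ℝ u x.1 (g x)) := fun g hg => h1.clm_apply hg
  have h3 : ∀ g : ℂ × ℂ → ℂ, ContDiff ℝ 1 g →
      ContDiff ℝ 1 (fun x : ℂ × ℂ => ((fderiv ℝ u x.1 (g x) : ℝ) : ℂ)) := fun g hg =>
    Complex.ofRealCLM.contDiff.comp (h2 g hg)
  have hc := h3 (fun _ => 1) contDiff_const
  have hI := h3 (fun _ => Complex.I) contDiff_const
  have hp := h2 _ (contDiff_snd (𝕜 := ℝ) (E := ℂ) (F := ℂ))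
  have hn : ContDiff ℝ 1 (fun x : ℂ × ℂ => ‖x.2‖ ^ 2) := contDiff_snd.norm_sq ℝ
  exact (hn.smul (hc.add (hI.mul contDiff_const))).sub ((contDiff_const.mul hp).smul contDiff_snd)

/-- The curve with constant value. -/
def constCurve : ℂ →L[ℝ] UnitCurve ℂ :=
  LinearMap.mkContinuous
    { toFun := fun v => ContinuousMap.const _ v
      map_add' := fun _ _ => rfl
      map_smul' := fun _ _ => rfl } 1 (fun v => by
        rw [one_mul]
        exact (ContinuousMap.norm_le _ (norm_nonneg _)).2 fun _ => le_rfl)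

theorem constCurve_apply (v : ℂ) (t : Icc (-1 : ℝ) 1) : constCurve v t = v := rfl

theorem norm_constCurve_le (v : ℂ) : ‖constCurve v‖ ≤ ‖v‖ :=
  (ContinuousMap.norm_le _ (norm_nonneg _)).2 fun _ => le_rfl

/-- Position and velocity of the curve starting at `0` with given velocity. -/
def phaseCurve : UnitCurve ℂ →L[ℝ] UnitCurve (ℂ × ℂ) :=
  (ContinuousLinearMap.compLeftContinuous ℝ _ (ContinuousLinearMap.inl ℝ ℂ ℂ)).comp curvePrimitive
    + ContinuousLinearMap.compLeftContinuous ℝ _ (ContinuousLinearMap.inr ℝ ℂ ℂ)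

theorem phaseCurve_apply (p : UnitCurve ℂ) (t : Icc (-1 : ℝ) 1) :
    phaseCurve p t = (curvePrimitive p t, p t) := by
  simp [phaseCurve]

section Geodesic

variable {u : ℂ → ℝ} (hu : ContDiff ℝ 2 u)

/-- The primitive of the acceleration prescribed by the geodesic equation. -/
def geodesicImpulse (p : UnitCurve ℂ) : UnitCurve ℂ :=
  curvePrimitive ((⟨geodesicField u, (contDiff_geodesicField hu).continuous⟩ : C(ℂ × ℂ, ℂ)).comp
    (phaseCurve p))

/-- The only unknown is the velocity `p`: the position is its primitive, and the geodesic equation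
with initial velocity `v` reads `p = constCurve v + geodesicImpulse hu p`. The impulse is a
superposition operator between two bounded linear maps. -/
theorem contDiff_geodesicImpulse : ContDiff ℝ 1 (geodesicImpulse hu) :=
  (curvePrimitive (E := ℂ)).contDiff.comp
    ((contDiff_one_postcomp (contDiff_geodesicField hu)).comp phaseCurve.contDiff)

theorem geodesicImpulse_apply (p : UnitCurve ℂ) {t : ℝ} (ht : t ∈ Icc (-1 : ℝ) 1) :
    geodesicImpulse hu p ⟨t, ht⟩ =
      ∫ s in (0 : ℝ)..t, geodesicField u ((curvePrimitive p).ext s, p.ext s) := by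
  rw [geodesicImpulse, curvePrimitive_apply]
  refine intervalIntegral.integral_congr fun s _ => ?_
  simp only [UnitCurve.ext, IccExtend_apply, ContinuousMap.comp_apply, phaseCurve_apply,
    ContinuousMap.coe_mk]

theorem norm_fderiv_sub_fderiv_le {η : ℝ} 
    (h2 : ∀ w ∈ ball (0 : ℂ) 3, ‖fderiv ℝ (fderiv ℝ u) w‖ ≤ η) {e e' : ℂ} (he : ‖e‖ ≤ 2)
    (he' : ‖e'‖ ≤ 2) (hu : ContDiff ℝ 2 u) : ‖fderiv ℝ u e - fderiv ℝ u e'‖ ≤ η * ‖e - e'‖ := by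
  have hd : Differentiable ℝ (fderiv ℝ u) :=
    (hu.fderiv_right (m := 1) (by norm_num)).differentiable one_ne_zero
  exact (convex_ball (0 : ℂ) 3).norm_image_sub_le_of_norm_fderiv_le (fun x _ => hd x) h2
    (by simpa using he'.trans_lt (by norm_num)) (by simpa using he.trans_lt (by norm_num))

theorem norm_geodesicImpulse_le {η : ℝ} (h1 : ∀ w ∈ ball (0 : ℂ) 3, ‖fderiv ℝ u w‖ ≤ η)
    {p : UnitCurve ℂ} (hp : ‖p‖ ≤ 2) : ‖geodesicImpulse hu p‖ ≤ 4 * η * ‖p‖ ^ 2 := by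
  have hη : 0 ≤ η := (norm_nonneg _).trans (h1 0 (by simp))
  refine (norm_curvePrimitive_le _).trans ?_
  rw [ContinuousMap.norm_le _ (by positivity)]
  intro t
  have hK : ‖curvePrimitive p t‖ ≤ 2 :=
    (ContinuousMap.norm_coe_le_norm _ t).trans ((norm_curvePrimitive_le p).trans hp)
  simp only [ContinuousMap.comp_apply, phaseCurve_apply, ContinuousMap.coe_mk, geodesicField]
  refine (norm_geodesicForce_le _ _).trans ?_
  gcongr
  · exact h1 _ (by simpa using hK.trans_lt (by norm_num))
  · exact p.norm_coe_le_norm t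

/-- Times are at most 1 in absolute value, so the positions stay in the ball of radius 2, where the
bounds on `u` apply. For `η = 1 / 128` the Lipschitz constant is `1 / 4`. -/
theorem norm_geodesicImpulse_sub_le {η : ℝ} (h1 : ∀ w ∈ ball (0 : ℂ) 3, ‖fderiv ℝ u w‖ ≤ η)
    (h2 : ∀ w ∈ ball (0 : ℂ) 3, ‖fderiv ℝ (fderiv ℝ u) w‖ ≤ η)
    {p q : UnitCurve ℂ} (hp : ‖p‖ ≤ 2) (hq : ‖q‖ ≤ 2) :
    ‖geodesicImpulse hu p - geodesicImpulse hu q‖ ≤ 32 * η * ‖p - q‖ := by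
  have hη : 0 ≤ η := (norm_nonneg _).trans (h1 0 (by simp))
  rw [geodesicImpulse, geodesicImpulse, ← map_sub]
  refine (norm_curvePrimitive_le _).trans ?_
  rw [ContinuousMap.norm_le _ (by positivity)]
  intro t
  have hK : ∀ p : UnitCurve ℂ, ‖p‖ ≤ 2 → ‖curvePrimitive p t‖ ≤ 2 := fun p hp =>
    (ContinuousMap.norm_coe_le_norm _ t).trans ((norm_curvePrimitive_le p).trans hp)
  have hKd : ‖curvePrimitive p t - curvePrimitive q t‖ ≤ ‖p - q‖ := by
    have := (ContinuousMap.norm_coe_le_norm (curvePrimitive (p - q)) t).trans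
      (norm_curvePrimitive_le (p - q))
    rwa [map_sub] at this
  have hd : ‖p t - q t‖ ≤ ‖p - q‖ := (p - q).norm_coe_le_norm t
  simp only [ContinuousMap.comp_apply, phaseCurve_apply, ContinuousMap.coe_mk, geodesicField,
    ContinuousMap.sub_apply]
  refine (norm_geodesicForce_sub_le _ _ ((p.norm_coe_le_norm t).trans hp)
    ((q.norm_coe_le_norm t).trans hq)).trans ?_
  have h3 := norm_fderiv_sub_fderiv_le h2 (hK p hp) (hK q hq) hu
  have h4 := h1 (curvePrimitive q t) (by simpa using (hK q hq).trans_lt (by norm_num))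
  calc _ ≤ 16 * (η * ‖p - q‖) + 16 * η * ‖p - q‖ := by
        gcongr
        exact h3.trans (by gcongr)
    _ = _ := by ring

end Geodesic

/-! ### Solving the geodesic equation with `C¹` dependence on the initial velocity. -/

section Geodesic

variable {u : ℂ → ℝ} (hu : ContDiff ℝ 2 u)

/-- The velocities of the geodesics starting at `0`, as functions of the initial velocity. -/
theorem exists_geodesicVelocity (h1 : ∀ w ∈ ball (0 : ℂ) 3, ‖fderiv ℝ u w‖ ≤ 1 / 128)
    (h2 : ∀ w ∈ ball (0 : ℂ) 3, ‖fderiv ℝ (fderiv ℝ u) w‖ ≤ 1 / 128) :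
    ∃ p : ℂ → UnitCurve ℂ, ContDiffOn ℝ 1 p (ball 0 1) ∧ ∀ v, ‖v‖ ≤ 1 →
      ‖p v‖ < 2 ∧ p v = constCurve v + geodesicImpulse hu (p v) ∧
      ∀ q : UnitCurve ℂ, ‖q‖ < 2 → q = constCurve v + geodesicImpulse hu q → q = p v := by
  -- Geodesic velocities are the preimages of constant curves under `G`, which differs from the
  -- identity by a `1 / 4`-Lipschitz map on the ball of radius 2. The quantitative inverse function
  -- theorem therefore applies to `G` on this ball.
  set G : UnitCurve ℂ → UnitCurve ℂ := fun p => p - geodesicImpulse hu p with hG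
  have hGc : ContDiff ℝ 1 G := contDiff_id.sub (contDiff_geodesicImpulse hu)
  have hlip : ∀ p q : UnitCurve ℂ, ‖p‖ < 2 → ‖q‖ < 2 →
      ‖geodesicImpulse hu p - geodesicImpulse hu q‖ ≤ 1 / 4 * ‖p - q‖ := fun p q hp hq =>
    (norm_geodesicImpulse_sub_le hu h1 h2 hp.le hq.le).trans_eq (by ring)
  have happ : ApproximatesLinearOn G
      ((ContinuousLinearEquiv.refl ℝ (UnitCurve ℂ) : UnitCurve ℂ ≃L[ℝ] UnitCurve ℂ) :
        UnitCurve ℂ →L[ℝ] UnitCurve ℂ) (ball 0 2) (1 / 4) := by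
    intro p hp q hq
    rw [mem_ball_zero_iff] at hp hq
    have e : G p - G q - (ContinuousLinearEquiv.refl ℝ (UnitCurve ℂ) :
        UnitCurve ℂ →L[ℝ] UnitCurve ℂ) (p - q) =
        -(geodesicImpulse hu p - geodesicImpulse hu q) := by
      simp only [hG, ContinuousLinearEquiv.coe_refl, ContinuousLinearMap.id_apply]
      abel
    rw [e, norm_neg]
    simpa using hlip p q hp hq
  have hnt : Nontrivial (UnitCurve ℂ) :=
    ⟨constCurve 0, constCurve 1, fun h => by
      have h0 : (0 : ℂ) = 1 := congrArg
        (fun q : UnitCurve ℂ => q (⟨0, by norm_num⟩ : Icc (-1 : ℝ) 1)) h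
      exact zero_ne_one h0⟩
  have hN : ‖((ContinuousLinearEquiv.refl ℝ (UnitCurve ℂ)).symm :
      UnitCurve ℂ →L[ℝ] UnitCurve ℂ)‖₊ = 1 := by
    apply NNReal.eq
    exact ContinuousLinearMap.norm_id
  have hc : Subsingleton (UnitCurve ℂ) ∨ (1 / 4 : NNReal) <
      ‖((ContinuousLinearEquiv.refl ℝ (UnitCurve ℂ)).symm :
      UnitCurve ℂ →L[ℝ] UnitCurve ℂ)‖₊⁻¹ := by
    right
    rw [hN, inv_one]
    exact (div_lt_one (by norm_num)).2 (by norm_num)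
  set e := happ.toOpenPartialHomeomorph G _ hc isOpen_ball with he
  have hsrc : e.source = ball 0 2 := rfl
  have hcoe : ∀ p, e p = G p := fun _ => rfl
  have hG0 : G 0 = 0 := by
    have := norm_geodesicImpulse_le hu h1 (p := 0) (by simp)
    simp only [norm_zero, ne_eq, OfNat.ofNat_ne_zero, not_false_eq_true, zero_pow,
      mul_zero, norm_le_zero_iff] at this
    simp [hG, this]
  have htgt : ∀ v : ℂ, ‖v‖ ≤ 1 → constCurve v ∈ e.target := by
    intro v hv
    -- The image contains the closed ball of radius `(1 - 1 / 4) * (3 / 2) = 9 / 8` around `G 0 =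
    -- 0`, hence all constant curves of norm at most 1.
    apply happ.closedBall_subset_target hc isOpen_ball (b := 0) (ε := 3 / 2) (by norm_num)
      (closedBall_subset_ball (by norm_num))
    rw [hN, hG0, mem_closedBall_zero_iff]
    refine ((norm_constCurve_le v).trans hv).trans ?_
    norm_num
  have hmem : ∀ v : ℂ, ‖v‖ ≤ 1 → e.symm (constCurve v) ∈ ball (0 : UnitCurve ℂ) 2 :=
    fun v hv => e.map_target (htgt v hv)
  refine ⟨fun v => e.symm (constCurve v), ?_, fun v hv => ⟨by simpa using hmem v hv, ?_, ?_⟩⟩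
  · intro v hv
    apply ContDiffAt.contDiffWithinAt
    have hv1 : ‖v‖ ≤ 1 := by simpa using (mem_ball_zero_iff.1 hv).le
    set p := e.symm (constCurve v) with hp
    have hpd : HasFDerivAt G (fderiv ℝ G p) p := (hGc.differentiable one_ne_zero p).hasFDerivAt
    have hFd : HasFDerivAt (geodesicImpulse hu) (fderiv ℝ (geodesicImpulse hu) p) p :=
      ((contDiff_geodesicImpulse hu).differentiable one_ne_zero p).hasFDerivAt
    have hFn : ‖fderiv ℝ (geodesicImpulse hu) p‖ ≤ 1 / 4 := by
      refine hFd.le_of_lip' (by norm_num) ?_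
      filter_upwards [isOpen_ball.mem_nhds (hmem v hv1)] with q hq
      exact hlip q p (by simpa using hq) (by simpa using hmem v hv1)
    -- The derivative is the identity minus an operator of norm at most `1 / 4`, invertible by the
    -- Neumann series.
    have hinv : HasFDerivAt G ((ContinuousLinearEquiv.unitsEquiv ℝ (UnitCurve ℂ)
        (Units.oneSub (fderiv ℝ (geodesicImpulse hu) p) (hFn.trans_lt (by norm_num))) :
        UnitCurve ℂ ≃L[ℝ] UnitCurve ℂ) : UnitCurve ℂ →L[ℝ] UnitCurve ℂ) p := by
      exact (hasFDerivAt_id p).sub hFd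
    exact (e.contDiffAt_symm (htgt v hv1) hinv hGc.contDiffAt).comp v
      constCurve.contDiff.contDiffAt
  · have := e.right_inv (htgt v hv)
    rw [hcoe] at this
    exact (sub_eq_iff_eq_add.1 this)
  · intro q hq hqe
    have h3 : e q = constCurve v := by
      rw [hcoe]
      exact sub_eq_iff_eq_add.2 hqe
    have := e.left_inv (x := q) (by rw [hsrc]; simpa using hq)
    rw [← this, h3]

end Geodesic

theorem integral_ext_smul {E : Type*} [NormedAddCommGroup E] [NormedSpace ℝ E] (g : ℝ → E)
    (s t : ℝ) : s • ∫ σ in (0 : ℝ)..t, g (s * σ) = ∫ σ in (0 : ℝ)..(s * t), g σ := by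
  rw [intervalIntegral.smul_integral_comp_mul_left, mul_zero]

/-- Existence of the exponential map at `0` on the unit ball of the tangent plane, for a metric
`e^{2u} |dz|²` close to a constant multiple of `|dz|²`. -/
theorem exists_expMap_normalized {u : ℂ → ℝ} (hu : ContDiff ℝ 2 u)
    (h1 : ∀ w ∈ ball (0 : ℂ) 3, ‖fderiv ℝ u w‖ ≤ 1 / 128)
    (h2 : ∀ w ∈ ball (0 : ℂ) 3, ‖fderiv ℝ (fderiv ℝ u) w‖ ≤ 1 / 128) :
    ∃ Y : ℂ → ℂ, Y 0 = 0 ∧ HasFDerivAt Y (ContinuousLinearMap.id ℝ ℂ) 0 ∧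
      ContDiffOn ℝ 1 Y (ball 0 1) ∧ (∀ v ∈ ball (0 : ℂ) 1, ‖Y v‖ < 2) ∧
      (∀ v ∈ ball (0 : ℂ) 1, ∀ w ∈ ball (0 : ℂ) 1, ‖Y v - Y w - (v - w)‖ ≤ 1 / 2 * ‖v - w‖) ∧
      ∀ v : ℂ, ‖v‖ = 1 → ∃ p : ℝ → ℂ, ∀ t ∈ Ioo (-1 : ℝ) 1,
        HasDerivAt (fun t : ℝ => Y (t • v)) (p t) t ∧
        HasDerivAt p (geodesicField u (Y (t • v), p t)) t := by
  obtain ⟨p, hp, hpv⟩ := exists_geodesicVelocity hu h1 h2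
  have hlip : ∀ v w : ℂ, ‖v‖ ≤ 1 → ‖w‖ ≤ 1 →
      ‖geodesicImpulse hu (p v) - geodesicImpulse hu (p w)‖ ≤ 1 / 4 * ‖p v - p w‖ :=
    fun v w hv hw => (norm_geodesicImpulse_sub_le hu h1 h2 (hpv v hv).1.le (hpv w hw).1.le).trans_eq
      (by ring)
  have hzero : geodesicImpulse hu 0 = 0 := by
    have := norm_geodesicImpulse_le hu h1 (p := 0) (by simp)
    simpa using this
  have hp0 : p 0 = 0 := ((hpv 0 (by simp)).2.2 0 (by simp) (by rw [hzero, map_zero, add_zero])).symm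
  have hplip : ∀ v w : ℂ, ‖v‖ ≤ 1 → ‖w‖ ≤ 1 → ‖p v - p w‖ ≤ 4 / 3 * ‖v - w‖ := by
    intro v w hv hw
    have e : p v - p w = constCurve (v - w) +
        (geodesicImpulse hu (p v) - geodesicImpulse hu (p w)) := by
      conv_lhs => rw [(hpv v hv).2.1, (hpv w hw).2.1]
      rw [map_sub]
      abel
    have h3 : ‖p v - p w‖ ≤ ‖v - w‖ + 1 / 4 * ‖p v - p w‖ := by
      conv_lhs => rw [e]
      exact (norm_add_le _ _).trans (add_le_add (norm_constCurve_le _) (hlip v w hv hw))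
    linarith
  have hone : (1 : ℝ) ∈ Icc (-1 : ℝ) 1 := by norm_num
  set one : Icc (-1 : ℝ) 1 := ⟨1, hone⟩ with hone'
  have hconst : ∀ v, curvePrimitive (constCurve v) one = v := by
    intro v
    rw [curvePrimitive_apply]
    have : (constCurve v).ext = fun _ => v := rfl
    simp [this, hone']
  -- The exponential map is the position at time 1.
  set Y : ℂ → ℂ := fun v => curvePrimitive (p v) one with hY
  have hYsub : ∀ v, ‖v‖ ≤ 1 → Y v = v + curvePrimitive (geodesicImpulse hu (p v)) one := by
    intro v hv
    simp only [hY]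
    conv_lhs => rw [(hpv v hv).2.1]
    rw [map_add, ContinuousMap.add_apply, hconst]
  -- The curve `t ↦ s • p v (s * t)` solves the fixed point equation with initial velocity `s • v`,
  -- by homogeneity of the force, so uniqueness identifies it with `p (s • v)`. Consequently `Y`
  -- maps the ray through `v` to the geodesic with initial velocity `v`.
  have hscale : ∀ v : ℂ, ‖v‖ ≤ 1 → ∀ s ∈ Icc (-1 : ℝ) 1, ∀ t ∈ Icc (-1 : ℝ) 1,
      (p (s • v)).ext t = s • (p v).ext (s * t) := by
    intro v hv s hs t ht
    have hs' : |s| ≤ 1 := abs_le.2 hs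
    have hmul : ∀ t ∈ Icc (-1 : ℝ) 1, s * t ∈ Icc (-1 : ℝ) 1 := fun t ht => abs_le.1 (by
      rw [abs_mul]
      exact mul_le_one₀ hs' (abs_nonneg _) (abs_le.2 ht))
    set q : UnitCurve ℂ := ⟨fun t => s • (p v).ext (s * t),
      ((p v).continuous_ext.comp (by fun_prop)).const_smul s⟩ with hq
    have hqext : ∀ t ∈ Icc (-1 : ℝ) 1, q.ext t = s • (p v).ext (s * t) := fun t ht => by
      rw [UnitCurve.ext_of_mem _ ht]; rfl
    have hsub : ∀ {t σ : ℝ}, t ∈ Icc (-1 : ℝ) 1 → σ ∈ uIcc 0 t → σ ∈ Icc (-1 : ℝ) 1 := by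
      intro t σ ht hσ
      have h0 : (0 : ℝ) ∈ Icc (-1 : ℝ) 1 := by norm_num
      exact (uIcc_subset_Icc h0 ht) hσ
    have hKq : ∀ t ∈ Icc (-1 : ℝ) 1, (curvePrimitive q).ext t =
        (curvePrimitive (p v)).ext (s * t) := by
      intro t ht
      rw [UnitCurve.ext_of_mem _ ht, UnitCurve.ext_of_mem _ (hmul t ht), curvePrimitive_apply,
        curvePrimitive_apply, ← integral_ext_smul, ← intervalIntegral.integral_smul]
      exact intervalIntegral.integral_congr fun σ hσ => hqext σ (hsub ht hσ)
    have hsv : ‖s • v‖ ≤ 1 := by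
      rw [norm_smul]
      exact mul_le_one₀ hs' (norm_nonneg _) hv
    have hqp : q = p (s • v) := by
      refine (hpv (s • v) hsv).2.2 q ?_ ?_
      · refine lt_of_le_of_lt ?_ (hpv v hv).1
        rw [ContinuousMap.norm_le _ (norm_nonneg _)]
        intro t
        simp only [hq, ContinuousMap.coe_mk, norm_smul]
        exact (mul_le_of_le_one_left (norm_nonneg _) hs').trans (UnitCurve.norm_ext_le _ _)
      · ext ⟨t, ht⟩
        rw [ContinuousMap.add_apply, geodesicImpulse_apply hu _ ht, constCurve_apply]
        have e1 : (∫ σ in (0 : ℝ)..t, geodesicField u ((curvePrimitive q).ext σ, q.ext σ)) =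
            ∫ σ in (0 : ℝ)..t, s ^ 2 • geodesicField u ((curvePrimitive (p v)).ext (s * σ),
              (p v).ext (s * σ)) := by
          refine intervalIntegral.integral_congr fun σ hσ => ?_
          simp only [geodesicField]
          rw [hKq σ (hsub ht hσ), hqext σ (hsub ht hσ), geodesicForce_smul]
        rw [e1, intervalIntegral.integral_smul, sq, mul_smul, integral_ext_smul
          (fun σ => geodesicField u ((curvePrimitive (p v)).ext σ, (p v).ext σ)),
          ← geodesicImpulse_apply hu _ (hmul t ht)]
        change s • (p v).ext (s * t) = _
        rw [UnitCurve.ext_of_mem _ (hmul t ht)]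
        conv_lhs => rw [(hpv v hv).2.1]
        rw [ContinuousMap.add_apply, constCurve_apply, smul_add]
    rw [← hqp, hqext t ht]
  have hYscale : ∀ v : ℂ, ‖v‖ ≤ 1 → ∀ s ∈ Icc (-1 : ℝ) 1,
      Y (s • v) = (curvePrimitive (p v)).ext s := by
    intro v hv s hs
    have : ∫ σ in (0 : ℝ)..1, (p (s • v)).ext σ = ∫ σ in (0 : ℝ)..1, s • (p v).ext (s * σ) :=
      intervalIntegral.integral_congr fun σ hσ => hscale v hv s hs σ (by
        rw [uIcc_of_le zero_le_one] at hσ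
        exact ⟨by linarith [hσ.1], hσ.2⟩)
    rw [UnitCurve.ext_of_mem _ hs, curvePrimitive_apply]
    simp only [hY]
    rw [curvePrimitive_apply, this, intervalIntegral.integral_smul, integral_ext_smul, mul_one]
  have hball : ∀ {v : ℂ}, v ∈ ball (0 : ℂ) 1 → ‖v‖ ≤ 1 := fun hv => (mem_ball_zero_iff.1 hv).le
  refine ⟨Y, ?_, ?_, ?_, ?_, ?_, ?_⟩
  · simp [hY, hp0]
  -- The impulse is quadratic in the size of the velocity, hence `Y v - v` is of order `‖v‖ ^ 2`.
  · apply HasFDerivAt.of_isLittleO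
    rw [Asymptotics.isLittleO_iff]
    intro c hc
    filter_upwards [Metric.ball_mem_nhds (0 : ℂ) (lt_min one_pos hc)] with v hv
    rw [mem_ball_zero_iff, lt_min_iff] at hv
    have hY0 : Y 0 = 0 := by simp [hY, hp0]
    rw [hY0, hYsub v hv.1.le]
    simp only [sub_zero, ContinuousLinearMap.id_apply, add_sub_cancel_left]
    have hpn : ‖p v‖ ≤ 4 / 3 * ‖v‖ := by
      simpa [hp0] using hplip v 0 hv.1.le (by simp)
    calc _ ≤ ‖geodesicImpulse hu (p v)‖ :=
          (ContinuousMap.norm_coe_le_norm _ _).trans (norm_curvePrimitive_le _)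
      _ ≤ 4 * (1 / 128) * ‖p v‖ ^ 2 := norm_geodesicImpulse_le hu h1 (hpv v hv.1.le).1.le
      _ ≤ 4 * (1 / 128) * (4 / 3 * ‖v‖) ^ 2 := by gcongr
      _ ≤ ‖v‖ * ‖v‖ := by nlinarith [norm_nonneg v]
      _ ≤ c * ‖v‖ := by gcongr; exact hv.2.le
  · have hev : ContDiff ℝ 1 (fun q : UnitCurve ℂ => curvePrimitive q one) :=
      ((ContinuousMap.evalCLM (M := ℂ) ℝ one).comp (curvePrimitive (E := ℂ))).contDiff
    exact hev.comp_contDiffOn hp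
  · intro v hv
    exact ((ContinuousMap.norm_coe_le_norm _ _).trans (norm_curvePrimitive_le _)).trans_lt
      (hpv v (hball hv)).1
  · intro v hv w hw
    rw [hYsub v (hball hv), hYsub w (hball hw)]
    have e : v + curvePrimitive (geodesicImpulse hu (p v)) one
        - (w + curvePrimitive (geodesicImpulse hu (p w)) one) - (v - w) =
        curvePrimitive (geodesicImpulse hu (p v) - geodesicImpulse hu (p w)) one := by
      rw [map_sub, ContinuousMap.sub_apply]
      ring
    rw [e]
    calc _ ≤ ‖geodesicImpulse hu (p v) - geodesicImpulse hu (p w)‖ :=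
          (ContinuousMap.norm_coe_le_norm _ _).trans (norm_curvePrimitive_le _)
      _ ≤ 1 / 4 * ‖p v - p w‖ := hlip v w (hball hv) (hball hw)
      _ ≤ 1 / 4 * (4 / 3 * ‖v - w‖) := by gcongr; exact hplip v w (hball hv) (hball hw)
      _ ≤ 1 / 2 * ‖v - w‖ := by linarith [norm_nonneg (v - w)]
  · intro v hv
    refine ⟨(p v).ext, fun t ht => ?_⟩
    have ev : ∀ᶠ s in 𝓝 t, s ∈ Ioo (-1 : ℝ) 1 := Ioo_mem_nhds ht.1 ht.2
    constructor
    · refine (hasDerivAt_curvePrimitive (p v) ht).congr_of_eventuallyEq ?_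
      filter_upwards [ev] with s hs
      exact hYscale v hv.le s (Ioo_subset_Icc_self hs)
    · rw [hYscale v hv.le t (Ioo_subset_Icc_self ht)]
      have hc : Continuous fun s => geodesicField u ((curvePrimitive (p v)).ext s, (p v).ext s) :=
        (contDiff_geodesicField hu).continuous.comp
          ((UnitCurve.continuous_ext _).prodMk (UnitCurve.continuous_ext _))
      have h3 : HasDerivAt (fun t : ℝ => v + ∫ s in (0 : ℝ)..t,
          geodesicField u ((curvePrimitive (p v)).ext s, (p v).ext s))
          (geodesicField u ((curvePrimitive (p v)).ext t, (p v).ext t)) t :=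
        (intervalIntegral.integral_hasDerivAt_right (hc.intervalIntegrable _ _)
          (hc.stronglyMeasurableAtFilter _ _) hc.continuousAt).const_add v
      refine h3.congr_of_eventuallyEq ?_
      filter_upwards [ev] with s hs
      rw [UnitCurve.ext_of_mem _ (Ioo_subset_Icc_self hs)]
      conv_lhs => rw [(hpv v hv.le).2.1]
      rw [ContinuousMap.add_apply, constCurve_apply, geodesicImpulse_apply]

/-! ### Lower bounds for the injectivity radius by rescaling. -/

theorem InjRadiusGE.mono {ρ : ℂ → ℝ} {W : Set ℂ} {z : ℂ} {r r' : ℝ} (h : InjRadiusGE ρ W z r)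
    (hr : r' ≤ r) : InjRadiusGE ρ W z r' := by
  obtain ⟨X, h0, hd, hg, hm, hi, hc, hb⟩ := h
  have hs : ball (0 : ℂ) r' ⊆ ball 0 r := ball_subset_ball hr
  exact ⟨X, h0, hd, fun v hv t ht => hg v hv t ⟨by linarith [ht.1], by linarith [ht.2]⟩,
    hm.mono_left hs, hi.mono hs, hc.mono hs, fun w hw => hb w (hs hw)⟩

theorem fderiv_comp_affine {F : Type*} [NormedAddCommGroup F] [NormedSpace ℝ F] {f : ℂ → F}
    (hf : Differentiable ℝ f) (z : ℂ) (a : ℝ) (w : ℂ) :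
    fderiv ℝ (fun w => f (z + a • w)) w = a • fderiv ℝ f (z + a • w) := by
  have h1 : HasFDerivAt (fun w : ℂ => z + a • w) (a • ContinuousLinearMap.id ℝ ℂ) w :=
    ((hasFDerivAt_id w).const_smul a).const_add z
  have h2 := ((hf (z + a • w)).hasFDerivAt.comp w h1).fderiv
  rw [ContinuousLinearMap.comp_smul, ContinuousLinearMap.comp_id] at h2
  exact h2

theorem geodesicForce_smul_left (a : ℝ) (l : ℂ →L[ℝ] ℝ) (p : ℂ) :
    geodesicForce (a • l) p = a • geodesicForce l p := by
  simp only [geodesicForce, smul_apply, smul_eq_mul, Complex.real_smul]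
  push_cast
  ring

theorem norm_smul_smul_eq {F : Type*} [NormedAddCommGroup F] [NormedSpace ℝ F] {a : ℝ}
    (ha : 0 ≤ a) (x : F) : ‖a • a • x‖ = a * (a * ‖x‖) := by
  rw [norm_smul, norm_smul, Real.norm_of_nonneg ha]

theorem bijective_of_norm_sub_le {L : ℂ →L[ℝ] ℂ}
    (h : ∀ v, ‖L v - v‖ ≤ 1 / 2 * ‖v‖) : Function.Bijective L := by
  have hinj : Function.Injective L := by
    rw [injective_iff_map_eq_zero]
    intro v hv
    have := h v
    rw [hv, zero_sub, norm_neg] at this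
    exact norm_le_zero_iff.1 (by linarith)
  exact ⟨hinj, (LinearMap.injective_iff_surjective (f := L.toLinearMap)).1 hinj⟩

/-- A lower bound for the injectivity radius of `ρ² |dz|²` in terms of the first two derivatives of
`log ρ` near a point. -/
theorem injRadiusGE_of_bounds {ρ V : ℂ → ℝ} {W : Set ℂ} {z : ℂ} {A R δ : ℝ} (hR : 0 < R)
    (hδ : 0 < δ) (hA : 1 ≤ A) (hρ : 0 < ρ z) (hV : ContDiff ℝ 2 V)
    (hlog : ∀ w ∈ ball z (δ * R), Real.log (ρ w) = V w)
    (h1 : ∀ w ∈ ball z (δ * R), ‖fderiv ℝ V w‖ ≤ A / R)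
    (h2 : ∀ w ∈ ball z (δ * R), ‖fderiv ℝ (fderiv ℝ V) w‖ ≤ A / R ^ 2)
    (hW : ball z (δ * R) ⊆ W) :
    InjRadiusGE ρ W z (min (δ / 3) (1 / (128 * A)) * (R * ρ z)) := by
  -- The first bound keeps the rescaled ball of radius 3 inside `ball z (δ * R)`; the second brings
  -- the rescaled derivatives below `1 / 128`.
  set θ := min (δ / 3) (1 / (128 * A)) with hθ
  have hθ0 : 0 < θ := lt_min (by positivity) (by positivity)
  have hθδ : θ * 3 ≤ δ := by linarith [min_le_left (δ / 3) (1 / (128 * A))]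
  have hθA : θ * A ≤ 1 / 128 := by
    have := min_le_right (δ / 3) (1 / (128 * A))
    calc θ * A ≤ 1 / (128 * A) * A := by gcongr
      _ = 1 / 128 := by field_simp
  have hθ1 : θ ≤ 1 := by nlinarith
  set a := θ * R with ha
  have ha0 : 0 < a := by positivity
  have hin : ∀ w : ℂ, ‖w‖ < 3 → z + a • w ∈ ball z (δ * R) := by
    intro w hw
    rw [mem_ball, dist_eq_norm, add_sub_cancel_left, norm_smul, Real.norm_of_nonneg ha0.le, ha]
    calc θ * R * ‖w‖ < θ * R * 3 := by gcongr
      _ = θ * 3 * R := by ring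
      _ ≤ δ * R := by gcongr
  have hVd : Differentiable ℝ V := hV.differentiable two_ne_zero
  have hVdd : Differentiable ℝ (fderiv ℝ V) :=
    (hV.fderiv_right (m := 1) (by norm_num)).differentiable one_ne_zero
  set u : ℂ → ℝ := fun w => V (z + a • w) with hu
  have huc : ContDiff ℝ 2 u := hV.comp (contDiff_const.add (contDiff_id.const_smul a))
  have hu1 : ∀ w, fderiv ℝ u w = a • fderiv ℝ V (z + a • w) := fderiv_comp_affine hVd z a
  have hu2 : ∀ w, fderiv ℝ (fderiv ℝ u) w = a • a • fderiv ℝ (fderiv ℝ V) (z + a • w) := by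
    intro w
    have : fderiv ℝ u = fun w => a • fderiv ℝ V (z + a • w) := funext hu1
    rw [this, ← fderiv_comp_affine hVdd z a w]
    have hdd : DifferentiableAt ℝ (fun w => fderiv ℝ V (z + a • w)) w := (hVdd (z + a • w)).comp w
      ((differentiable_const z).add (differentiable_id.const_smul a) w)
    exact fderiv_fun_const_smul hdd a
  obtain ⟨Y, hY0, hYd, hYc, hYn, hYl, hYg⟩ := exists_expMap_normalized huc
    (fun w hw => by
      rw [hu1, norm_smul, Real.norm_of_nonneg ha0.le]
      calc a * ‖fderiv ℝ V (z + a • w)‖ ≤ a * (A / R) := by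
            gcongr; exact h1 _ (hin w (by simpa using hw))
        _ = θ * A := by rw [ha]; field_simp
        _ ≤ _ := hθA)
    (fun w hw => by
      rw [hu2]
      refine (norm_smul_smul_eq (F := ℂ →L[ℝ] ℂ →L[ℝ] ℝ) ha0.le _).trans_le ?_
      calc a * (a * ‖fderiv ℝ (fderiv ℝ V) (z + a • w)‖) ≤ a * (a * (A / R ^ 2)) := by
            gcongr; exact h2 _ (hin w (by simpa using hw))
        _ = θ * (θ * A) := by rw [ha]; field_simp
        _ ≤ 1 * (1 / 128) := by gcongr
        _ = _ := one_mul _)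
  -- The map `v ↦ z + a • Y (r⁻¹ • v)` has derivative `a / r = 1 / ρ z` at 0, as required for an
  -- isometric identification of the tangent space.
  set r := a * ρ z with hr
  have hr0 : 0 < r := by positivity
  have hrr : θ * (R * ρ z) = r := by rw [hr, ha]; ring
  rw [hrr]
  have hsc : ∀ v ∈ ball (0 : ℂ) r, r⁻¹ • v ∈ ball (0 : ℂ) 1 := by
    intro v hv
    rw [mem_ball_zero_iff] at hv ⊢
    rw [norm_smul, norm_inv, Real.norm_of_nonneg hr0.le, inv_mul_lt_iff₀ hr0, mul_one]
    exact hv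
  have hYd' : ∀ v ∈ ball (0 : ℂ) 1, HasFDerivAt Y (fderiv ℝ Y v) v := fun v hv =>
    ((hYc.differentiableOn one_ne_zero).differentiableAt (isOpen_ball.mem_nhds hv)).hasFDerivAt
  have hXd : ∀ v ∈ ball (0 : ℂ) r, HasFDerivAt (fun v : ℂ => z + a • Y (r⁻¹ • v))
      (a • r⁻¹ • fderiv ℝ Y (r⁻¹ • v)) v := by
    intro v hv
    have h3 : HasFDerivAt (fun v : ℂ => r⁻¹ • v) (r⁻¹ • ContinuousLinearMap.id ℝ ℂ) v :=
      (hasFDerivAt_id v).fun_const_smul _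
    have h4 := (hYd' _ (hsc v hv)).comp v h3
    rw [ContinuousLinearMap.comp_smul, ContinuousLinearMap.comp_id] at h4
    exact (h4.const_smul a).const_add z
  have hYbij : ∀ v ∈ ball (0 : ℂ) 1, Function.Bijective (fderiv ℝ Y v) := by
    intro v hv
    apply bijective_of_norm_sub_le
    have h3 : HasFDerivAt (fun v => Y v - v) (fderiv ℝ Y v - ContinuousLinearMap.id ℝ ℂ) v :=
      (hYd' v hv).sub (hasFDerivAt_id v)
    have h4 : ‖fderiv ℝ Y v - ContinuousLinearMap.id ℝ ℂ‖ ≤ 1 / 2 := by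
      refine h3.le_of_lip' (by norm_num) ?_
      filter_upwards [isOpen_ball.mem_nhds hv] with w hw
      have e : Y w - w - (Y v - v) = Y w - Y v - (w - v) := by ring
      rw [e]
      exact hYl w hw v hv
    intro h
    simpa using (fderiv ℝ Y v - ContinuousLinearMap.id ℝ ℂ).le_of_opNorm_le h4 h
  refine ⟨fun v => z + a • Y (r⁻¹ • v), by simp [hY0], ?_, ?_, ?_, ?_, ?_, ?_⟩
  · intro v
    rw [(hXd 0 (by simpa using hr0)).fderiv, smul_zero, hYd.fderiv]
    simp only [smul_apply, ContinuousLinearMap.id_apply, norm_smul, norm_inv,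
      Real.norm_of_nonneg hr0.le, Real.norm_of_nonneg ha0.le]
    rw [hr]
    field_simp
  · intro v hv t ht
    obtain ⟨p, hp⟩ := hYg v hv
    have hdiv : ∀ s ∈ Ioo (-r) r, s * r⁻¹ ∈ Ioo (-1 : ℝ) 1 := by
      intro s hs
      rw [← div_eq_mul_inv, mem_Ioo, lt_div_iff₀ hr0, div_lt_one hr0]
      exact ⟨by linarith [hs.1], hs.2⟩
    have hcd : ∀ s ∈ Ioo (-r) r, HasDerivAt (fun t : ℝ => z + a • Y (r⁻¹ • t • v))
        (a • r⁻¹ • p (s * r⁻¹)) s := by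
      intro s hs
      have h3 : HasDerivAt (fun s : ℝ => s * r⁻¹) r⁻¹ s := by
        simpa using (hasDerivAt_id s).mul_const r⁻¹
      have h4 := ((hp _ (hdiv s hs)).1.scomp s h3)
      have h5 := (h4.const_smul a).const_add z
      have e : (fun t : ℝ => z + a • Y (r⁻¹ • t • v)) =
          fun x => z + (a • (fun t : ℝ => Y (t • v)) ∘ fun s => s * r⁻¹) x := by
        funext τ
        simp only [Pi.smul_apply, Function.comp, smul_smul, mul_comm]
      rw [e]
      exact h5
    have hct : z + a • Y (r⁻¹ • t • v) ∈ ball z (δ * R) := by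
      refine hin _ ((hYn _ (hsc _ ?_)).trans (by norm_num))
      rw [mem_ball_zero_iff, norm_smul, hv, mul_one]
      exact abs_lt.2 ht
    have hVl : (fun w => Real.log (ρ w)) =ᶠ[𝓝 (z + a • Y (r⁻¹ • t • v))] V := by
      filter_upwards [isOpen_ball.mem_nhds hct] with w hw using hlog w hw
    refine ⟨(hcd t ht).differentiableAt, ?_⟩
    have hdc : deriv (fun t : ℝ => z + a • Y (r⁻¹ • t • v)) =ᶠ[𝓝 t]
        fun s => a • r⁻¹ • p (s * r⁻¹) := by
      filter_upwards [Ioo_mem_nhds ht.1 ht.2] with s hs using (hcd s hs).deriv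
    have h3 : HasDerivAt (fun s : ℝ => s * r⁻¹) r⁻¹ t := by
      simpa using (hasDerivAt_id t).mul_const r⁻¹
    have h4 := (((hp _ (hdiv t ht)).2.scomp t h3).const_smul r⁻¹).const_smul a
    refine (h4.congr_of_eventuallyEq hdc).congr_deriv ?_
    rw [hdc.eq_of_nhds, gradient_eq_complex, hVl.fderiv_eq]
    have e1 : (t * r⁻¹) • v = r⁻¹ • t • v := by rw [smul_smul, mul_comm]
    have e2 : ∀ (l : ℂ →L[ℝ] ℝ) (q : ℂ), ‖q‖ ^ 2 • ((l 1 : ℂ) + (l Complex.I : ℂ) * Complex.I)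
        - (2 * l q) • q = geodesicForce l q := fun _ _ => rfl
    rw [e2, geodesicField, hu1, e1, geodesicForce_smul_left, geodesicForce_smul,
      geodesicForce_smul]
    simp only [smul_smul]
    congr 1
    ring
  · intro v hv
    exact hW (hin _ ((hYn _ (hsc v hv)).trans (by norm_num)))
  · intro v hv w hw hvw
    have hYe : Y (r⁻¹ • v) = Y (r⁻¹ • w) := by
      have := add_left_cancel hvw
      exact (smul_right_injective ℂ ha0.ne') this
    have h3 := hYl _ (hsc v hv) _ (hsc w hw)
    rw [hYe, sub_self, zero_sub, norm_neg] at h3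
    have h4 : r⁻¹ • v - r⁻¹ • w = 0 := norm_le_zero_iff.1 (by linarith)
    exact (smul_right_injective ℂ (inv_ne_zero hr0.ne')) (sub_eq_zero.1 h4)
  · have h3 : ContDiffOn ℝ 1 (fun v : ℂ => Y (r⁻¹ • v)) (ball 0 r) :=
      hYc.comp (contDiff_id.const_smul r⁻¹).contDiffOn hsc
    exact contDiffOn_const.add (h3.const_smul a)
  · intro w hw
    rw [(hXd w hw).fderiv]
    have h3 : Function.Bijective fun x : ℂ => a • r⁻¹ • x :=
      (MulAction.bijective₀ ha0.ne').comp (MulAction.bijective₀ (inv_ne_zero hr0.ne'))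
    exact h3.comp (hYbij _ (hsc w hw))

/-! ### Clusters of points on the line -/

section Cluster

variable {n : ℕ} (a : Fin n → ℝ)

/-- A set of points whose distance to the other points is much larger than its diameter. -/
def IsCluster (I : Finset (Fin n)) : Prop :=
  I.Nonempty ∧ ∀ i ∈ I, ∀ i' ∈ I, ∀ k ∈ I, ∀ j ∉ I, 64 * |a i - a i'| ≤ |a k - a j|

/-- The diameter of a set of points. -/
def clusterDiam (I : Finset (Fin n)) : ℝ := Metric.diam (a '' I)

/-- The distance of a set of points to the other points. -/
def clusterGap (I : Finset (Fin n)) : ℝ := sInf {x | ∃ i ∈ I, ∃ j ∉ I, x = |a i - a j|}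

open Classical in
/-- A point of the cluster, taken as its center. -/
def clusterCenter (I : Finset (Fin n)) : ℝ := if h : I.Nonempty then a (I.min' h) else 0

/-- The inner radius of the annulus around a cluster. -/
def innerRadius (I : Finset (Fin n)) : ℝ := 4 * clusterDiam a I

/-- The inverse of the outer radius of the annulus around a cluster; it vanishes for the cluster
of all points. -/
def invOuterRadius (I : Finset (Fin n)) : ℝ := if I = Finset.univ then 0 else 8 / clusterGap a I

variable {a}

theorem exists_clusterCenter_eq {I : Finset (Fin n)} (h : I.Nonempty) :
    ∃ i ∈ I, clusterCenter a I = a i :=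
  ⟨I.min' h, I.min'_mem h, by simp [clusterCenter, h]⟩

theorem clusterDiam_nonneg (I : Finset (Fin n)) : 0 ≤ clusterDiam a I := Metric.diam_nonneg

theorem abs_sub_le_clusterDiam {I : Finset (Fin n)} {i j : Fin n} (hi : i ∈ I) (hj : j ∈ I) :
    |a i - a j| ≤ clusterDiam a I :=
  Metric.dist_le_diam_of_mem ((I.finite_toSet.image a).isBounded) (mem_image_of_mem a hi)
    (mem_image_of_mem a hj)

theorem clusterDiam_le {I : Finset (Fin n)} {r : ℝ} (hr : 0 ≤ r)
    (h : ∀ i ∈ I, ∀ j ∈ I, |a i - a j| ≤ r) : clusterDiam a I ≤ r := by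
  refine Metric.diam_le_of_forall_dist_le hr ?_
  rintro _ ⟨i, hi, rfl⟩ _ ⟨j, hj, rfl⟩
  exact h i hi j hj

theorem exists_abs_sub_eq_clusterDiam {I : Finset (Fin n)} (h : I.Nonempty) :
    ∃ i ∈ I, ∃ j ∈ I, clusterDiam a I = |a i - a j| := by
  obtain ⟨⟨i, j⟩, hij, hmax⟩ := (I ×ˢ I).exists_max_image (fun p => |a p.1 - a p.2|)
    (h.product h)
  rw [Finset.mem_product] at hij
  exact ⟨i, hij.1, j, hij.2, le_antisymm (clusterDiam_le (abs_nonneg _) fun i' hi' j' hj' =>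
    hmax (i', j') (Finset.mem_product.2 ⟨hi', hj'⟩)) (abs_sub_le_clusterDiam hij.1 hij.2)⟩

theorem clusterDiam_pos (ha : Function.Injective a) {I : Finset (Fin n)} {i j : Fin n}
    (hi : i ∈ I) (hj : j ∈ I) (hij : i ≠ j) : 0 < clusterDiam a I :=
  (abs_pos.2 (sub_ne_zero.2 (ha.ne hij))).trans_le (abs_sub_le_clusterDiam hi hj)

theorem innerRadius_pos (ha : Function.Injective a) {I : Finset (Fin n)} (hI : 1 < I.card) :
    0 < innerRadius a I := by
  obtain ⟨i, hi, j, hj, hij⟩ := Finset.one_lt_card.1 hI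
  exact mul_pos (by norm_num) (clusterDiam_pos ha hi hj hij)

theorem clusterDiam_singleton (i : Fin n) : clusterDiam a {i} = 0 := by
  simp [clusterDiam]

theorem clusterGap_le {I : Finset (Fin n)} {i j : Fin n} (hi : i ∈ I) (hj : j ∉ I) :
    clusterGap a I ≤ |a i - a j| :=
  csInf_le ⟨0, by rintro _ ⟨_, _, _, _, rfl⟩; positivity⟩ ⟨i, hi, j, hj, rfl⟩

theorem exists_clusterGap_eq {I : Finset (Fin n)} (h : I.Nonempty) (hu : I ≠ Finset.univ) :
    ∃ i ∈ I, ∃ j ∉ I, clusterGap a I = |a i - a j| := by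
  obtain ⟨j, hj⟩ : ∃ j, j ∉ I := by
    by_contra! hc
    exact hu (Finset.eq_univ_iff_forall.2 hc)
  obtain ⟨i, hi⟩ := h
  have hfin : {x | ∃ i ∈ I, ∃ j ∉ I, x = |a i - a j|}.Finite := by
    refine (Set.finite_range fun p : Fin n × Fin n => |a p.1 - a p.2|).subset ?_
    rintro _ ⟨i, _, j, _, rfl⟩
    exact ⟨(i, j), rfl⟩
  have hne : {x | ∃ i ∈ I, ∃ j ∉ I, x = |a i - a j|}.Nonempty := ⟨_, i, hi, j, hj, rfl⟩
  exact hne.csInf_mem hfin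

theorem clusterGap_pos (ha : Function.Injective a) {I : Finset (Fin n)} (h : I.Nonempty)
    (hu : I ≠ Finset.univ) : 0 < clusterGap a I := by
  obtain ⟨i, hi, j, hj, e⟩ := exists_clusterGap_eq (a := a) h hu
  rw [e]
  exact abs_pos.2 (sub_ne_zero.2 (ha.ne (by rintro rfl; exact hj hi)))

theorem IsCluster.diam_le_gap {I : Finset (Fin n)} (h : IsCluster a I) (hu : I ≠ Finset.univ) :
    64 * clusterDiam a I ≤ clusterGap a I := by
  obtain ⟨i, hi, j, hj, e⟩ := exists_clusterGap_eq (a := a) h.1 hu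
  obtain ⟨k, hk, l, hl, e'⟩ := exists_abs_sub_eq_clusterDiam (a := a) h.1
  rw [e, e']
  exact h.2 k hk l hl i hi j hj

theorem isCluster_univ [NeZero n] : IsCluster a Finset.univ :=
  ⟨Finset.univ_nonempty, fun _ _ _ _ _ _ j hj => absurd (Finset.mem_univ j) hj⟩

theorem isCluster_singleton (i : Fin n) : IsCluster a {i} := by
  refine ⟨Finset.singleton_nonempty i, fun k hk l hl m _ j _ => ?_⟩
  rw [Finset.mem_singleton] at hk hl
  simp [hk, hl]

/-- Two clusters are nested or disjoint. -/
theorem IsCluster.trichotomy (ha : Function.Injective a) {I J : Finset (Fin n)}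
    (hI : IsCluster a I) (hJ : IsCluster a J) : I ⊆ J ∨ J ⊆ I ∨ Disjoint I J := by
  by_contra! hc
  obtain ⟨h1, h2, h3⟩ := hc
  obtain ⟨k, hkI, hkJ⟩ := Finset.not_subset.1 h1
  obtain ⟨j, hjJ, hjI⟩ := Finset.not_subset.1 h2
  obtain ⟨i, hiI, hiJ⟩ := Finset.not_disjoint_iff.1 h3
  have h4 := hI.2 i hiI k hkI i hiI j hjI
  have h5 := hJ.2 i hiJ j hjJ i hiJ k hkJ
  have h6 : 0 < |a i - a k| := abs_pos.2 (sub_ne_zero.2 (ha.ne (by rintro rfl; exact hkJ hiJ)))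
  linarith

/-- Clusters are intervals. -/
theorem IsCluster.mem_of_lt (ha : StrictMono a) {I : Finset (Fin n)} (hI : IsCluster a I)
    {i j k : Fin n} (hi : i ∈ I) (hk : k ∈ I) (hij : i < j) (hjk : j < k) : j ∈ I := by
  by_contra hj
  have h := hI.2 i hi k hk i hi j hj
  have h1 := ha hij
  have h2 := ha hjk
  rw [abs_of_neg (by linarith), abs_of_neg (by linarith)] at h
  linarith

/-- The radii are `4 * diam` and `gap / 8`, so the cluster ratio 64 leaves at least a factor 2
between them. -/
theorem innerRadius_mul_invOuterRadius_le (ha : Function.Injective a) {I : Finset (Fin n)}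
    (hI : IsCluster a I) : innerRadius a I * invOuterRadius a I ≤ 1 / 2 := by
  rw [invOuterRadius, innerRadius]
  split_ifs with hu
  · norm_num
  · have h1 := hI.diam_le_gap hu
    have h2 := clusterGap_pos ha hI.1 hu
    rw [mul_div_assoc', div_le_iff₀ h2]
    linarith

theorem invOuterRadius_nonneg (ha : Function.Injective a) {I : Finset (Fin n)}
    (hI : I.Nonempty) : 0 ≤ invOuterRadius a I := by
  rw [invOuterRadius]
  split_ifs with hu
  · exact le_rfl
  · exact div_nonneg (by norm_num) (clusterGap_pos ha hI hu).le

theorem invOuterRadius_pos (ha : Function.Injective a) {I : Finset (Fin n)}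
    (hI : I.Nonempty) (hu : I ≠ Finset.univ) : 0 < invOuterRadius a I := by
  rw [invOuterRadius, if_neg hu]
  exact div_pos (by norm_num) (clusterGap_pos ha hI hu)

theorem invOuterRadius_univ : invOuterRadius a Finset.univ = 0 := if_pos rfl

theorem invOuterRadius_mul_le_iff (ha : Function.Injective a) {I : Finset (Fin n)}
    (hI : I.Nonempty) (hu : I ≠ Finset.univ) {x y : ℝ} :
    invOuterRadius a I * x ≤ y ↔ 8 * x ≤ y * clusterGap a I := by
  rw [invOuterRadius, if_neg hu, div_mul_eq_mul_div, div_le_iff₀ (clusterGap_pos ha hI hu)]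

/-- The doubled disk around a cluster lies well inside the inner disk of a larger one. -/
theorem norm_sub_center_lt_of_ssubset (ha : Function.Injective a) {I J : Finset (Fin n)}
    (hJ : J.Nonempty) (hJI : J ⊂ I) {z : ℂ}
    (hz : invOuterRadius a J * ‖z - clusterCenter a J‖ ≤ 2) :
    2 * ‖z - clusterCenter a I‖ < innerRadius a I := by
  obtain ⟨k, hkI, hkJ⟩ := Finset.exists_of_ssubset hJI
  have hu : J ≠ Finset.univ := by rintro rfl; exact hkJ (Finset.mem_univ k)
  rw [invOuterRadius_mul_le_iff ha hJ hu] at hz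
  obtain ⟨i, hi, ei⟩ := exists_clusterCenter_eq (a := a) hJ
  obtain ⟨j, hj, ej⟩ := exists_clusterCenter_eq (a := a) (hJ.mono hJI.1)
  have hd := clusterDiam_pos ha (hJI.1 hi) hkI (by rintro rfl; exact hkJ hi)
  -- A point of `I` outside `J` bounds the gap of `J` by the diameter of `I`. The doubled disk has
  -- radius `gap / 4`, so `z` lies within `5 / 4` diameters of the center of `I`, less than half the
  -- inner radius.
  have hg := (clusterGap_le (a := a) hi hkJ).trans (abs_sub_le_clusterDiam (hJI.1 hi) hkI)
  have hc := abs_sub_le_clusterDiam (a := a) (hJI.1 hi) hj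
  rw [← ei, ← ej] at hc
  have h1 : ‖z - clusterCenter a I‖ ≤ ‖z - clusterCenter a J‖ +
      |clusterCenter a J - clusterCenter a I| := by
    have := norm_add_le (z - clusterCenter a J) ((clusterCenter a J - clusterCenter a I : ℝ) : ℂ)
    rw [Complex.norm_real] at this
    have e : z - (clusterCenter a I : ℂ) = z - clusterCenter a J +
        ((clusterCenter a J - clusterCenter a I : ℝ) : ℂ) := by push_cast; ring
    rwa [e]
  rw [innerRadius]
  linarith

theorem clusterGap_le_abs_center_sub {I J : Finset (Fin n)} (hI : I.Nonempty) (hJ : J.Nonempty)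
    (hd : Disjoint I J) : clusterGap a I ≤ |clusterCenter a I - clusterCenter a J| := by
  obtain ⟨i, hi, ei⟩ := exists_clusterCenter_eq (a := a) hI
  obtain ⟨j, hj, ej⟩ := exists_clusterCenter_eq (a := a) hJ
  rw [ei, ej]
  exact clusterGap_le hi (Finset.disjoint_right.1 hd hj)

theorem ne_univ_of_disjoint {I J : Finset (Fin n)} (hJ : J.Nonempty) (hd : Disjoint I J) :
    I ≠ Finset.univ := by
  rintro rfl
  obtain ⟨j, hj⟩ := hJ
  exact Finset.disjoint_left.1 hd (Finset.mem_univ j) hj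

theorem abs_center_sub_le (c c' : ℝ) (z w : ℂ) : |c - c'| ≤ ‖z - c‖ + ‖z - w‖ + ‖w - c'‖ := by
  have h1 := norm_add_le (-(z - c) + (z - w)) (w - c')
  have h2 := norm_add_le (-(z - c)) (z - w)
  rw [norm_neg] at h2
  have h3 : ‖((c - c' : ℝ) : ℂ)‖ = |c - c'| := Complex.norm_real _
  rw [← h3]
  have e : ((c - c' : ℝ) : ℂ) = -(z - c) + (z - w) + (w - c') := by push_cast; ring
  rw [e]
  linarith

/-- The doubled disks around disjoint clusters are disjoint. -/
theorem lt_norm_sub_center_of_disjoint (ha : Function.Injective a) {I J : Finset (Fin n)}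
    (hI : I.Nonempty) (hJ : J.Nonempty) (hd : Disjoint I J) {z : ℂ}
    (hz : invOuterRadius a I * ‖z - clusterCenter a I‖ ≤ 2) :
    2 < invOuterRadius a J * ‖z - clusterCenter a J‖ := by
  by_contra! hc
  have hIu := ne_univ_of_disjoint hJ hd
  have hJu := ne_univ_of_disjoint hI hd.symm
  rw [invOuterRadius_mul_le_iff ha hI hIu] at hz
  rw [invOuterRadius_mul_le_iff ha hJ hJu] at hc
  -- Both gaps are at most the distance of the centers, while the two doubled disks have radii a
  -- quarter of the gaps; a common point would halve the distance of the centers.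
  have h1 := clusterGap_le_abs_center_sub (a := a) hI hJ hd
  have h2 := clusterGap_le_abs_center_sub (a := a) hJ hI hd.symm
  rw [abs_sub_comm] at h2
  have h3 := abs_center_sub_le (clusterCenter a I) (clusterCenter a J) z z
  rw [sub_self, norm_zero] at h3
  have h4 := clusterGap_pos ha hI hIu
  linarith

/-- All clusters strictly containing `I` meet, hence are nested, so one of minimal cardinality lies
in all the others. -/
theorem exists_parent (ha : Function.Injective a) {I : Finset (Fin n)} (hI : IsCluster a I)
    (hu : I ≠ Finset.univ) : ∃ S, IsCluster a S ∧ I ⊂ S ∧ ∀ J, IsCluster a J → I ⊂ J → S ⊆ J := by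
  classical
  have hne : NeZero n := ⟨by rintro rfl; exact hI.1.choose.elim0⟩
  obtain ⟨S, hS, hmin⟩ := (Finset.univ.filter fun S => IsCluster a S ∧ I ⊂ S).exists_min_image
    Finset.card ⟨Finset.univ, by
      simpa using ⟨isCluster_univ, Finset.ssubset_univ_iff.2 hu⟩⟩
  simp only [Finset.mem_filter, Finset.mem_univ, true_and] at hS hmin
  refine ⟨S, hS.1, hS.2, fun J hJ hIJ => ?_⟩
  rcases hS.1.trichotomy ha hJ with h | h | h
  · exact h
  · rw [Finset.eq_of_subset_of_card_le h (hmin J ⟨hJ, hIJ⟩)]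
  · obtain ⟨i, hi⟩ := hI.1
    exact absurd (hIJ.1 hi) (Finset.disjoint_left.1 h (hS.2.1 hi))

open Classical in
variable (a) in
/-- The smallest cluster strictly containing a given one. -/
def clusterParent (I : Finset (Fin n)) : Finset (Fin n) :=
  if h : ∃ S, IsCluster a S ∧ I ⊂ S ∧ ∀ J, IsCluster a J → I ⊂ J → S ⊆ J then h.choose
  else Finset.univ

theorem clusterParent_spec (ha : Function.Injective a) {I : Finset (Fin n)} (hI : IsCluster a I)
    (hu : I ≠ Finset.univ) : IsCluster a (clusterParent a I) ∧ I ⊂ clusterParent a I ∧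
      ∀ J, IsCluster a J → I ⊂ J → clusterParent a I ⊆ J := by
  have h := exists_parent ha hI hu
  rw [clusterParent, dif_pos h]
  exact h.choose_spec

theorem one_lt_card_clusterParent (ha : Function.Injective a) {I : Finset (Fin n)}
    (hI : IsCluster a I) (hu : I ≠ Finset.univ) : 1 < (clusterParent a I).card :=
  lt_of_le_of_lt (Finset.card_pos.2 hI.1) (Finset.card_lt_card (clusterParent_spec ha hI hu).2.1)

/-! ### The scales of a cluster and of its parent are comparable. -/

/-- The points at distance at most `r` from a given one. -/
def pointsNear (a : Fin n → ℝ) (i : Fin n) (r : ℝ) : Finset (Fin n) :=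
  Finset.univ.filter fun j => |a j - a i| ≤ r

theorem mem_pointsNear {i j : Fin n} {r : ℝ} : j ∈ pointsNear a i r ↔ |a j - a i| ≤ r := by
  simp [pointsNear]

/-- If the points within radius `r'` of `a i` do not form a cluster, some outside point is closer
than `64 * (2 * r')` to one of them, hence within `129 * r'` of `a i`. Each enlargement by 129 then
gains a point, which can happen fewer than `n` times. -/
theorem exists_isCluster_pointsNear (i : Fin n) {r : ℝ} (hr : 0 ≤ r) :
    ∃ m ≤ n, IsCluster a (pointsNear a i (r * 129 ^ m)) := by
  by_contra! hc
  have hcard : ∀ m ≤ n, m + 1 ≤ (pointsNear a i (r * 129 ^ m)).card := by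
    intro m
    induction m with
    | zero =>
      intro _
      exact Finset.card_pos.2 ⟨i, mem_pointsNear.2 (by simpa using hr)⟩
    | succ m ih =>
      intro hm
      refine (Nat.succ_le_succ (ih (by omega))).trans (Finset.card_lt_card ?_)
      have hnc := hc m (by omega)
      have hne : (pointsNear a i (r * 129 ^ m)).Nonempty :=
        ⟨i, mem_pointsNear.2 (by simp; positivity)⟩
      rw [IsCluster] at hnc
      push Not at hnc
      obtain ⟨j, hj, k, hk, l, hl, p, hp, hlt⟩ := hnc hne
      rw [Finset.ssubset_iff_of_subset]
      · refine ⟨p, mem_pointsNear.2 ?_, hp⟩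
        rw [mem_pointsNear] at hj hk hl
        have h1 : |a j - a k| ≤ |a j - a i| + |a k - a i| := by
          rw [abs_sub_comm (a k)]; exact abs_sub_le _ _ _
        have h2 : |a p - a i| ≤ |a l - a p| + |a l - a i| := by
          rw [abs_sub_comm (a l) (a p)]; exact abs_sub_le _ _ _
        rw [pow_succ]
        linarith
      · intro q hq
        rw [mem_pointsNear] at hq ⊢
        refine hq.trans ?_
        gcongr <;> norm_num
  have := (hcard n le_rfl).trans (Finset.card_le_univ _)
  rw [Fintype.card_fin] at this
  omega

/-- Start from a point of `T` realizing the gap and from the radius `clusterGap a T`: the points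
near it contain `T` and a further point, and after at most `n` enlargements by 129 they form a
cluster. It contains the parent, whose diameter is thus at most `2 * 129 ^ n` gaps. This is the
source of all constants depending on `n`. -/
theorem invOuterRadius_mul_innerRadius_parent_le (ha : Function.Injective a) {T : Finset (Fin n)}
    (hT : IsCluster a T) (hu : T ≠ Finset.univ) :
    invOuterRadius a T * innerRadius a (clusterParent a T) ≤ 128 * 129 ^ n := by
  obtain ⟨i, hi, j, hj, e⟩ := exists_clusterGap_eq (a := a) hT.1 hu
  have hg := clusterGap_pos ha hT.1 hu
  have hd := hT.diam_le_gap hu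
  obtain ⟨m, hm, hcl⟩ := exists_isCluster_pointsNear (a := a) i
    (r := clusterGap a T) hg.le
  have hpow : (1 : ℝ) ≤ 129 ^ m := one_le_pow₀ (by norm_num)
  have hle : clusterGap a T ≤ clusterGap a T * 129 ^ m := le_mul_of_one_le_right hg.le hpow
  have hsub : T ⊂ pointsNear a i (clusterGap a T * 129 ^ m) := by
    rw [Finset.ssubset_iff_of_subset]
    · refine ⟨j, mem_pointsNear.2 ?_, hj⟩
      rw [abs_sub_comm, ← e]
      exact hle
    · intro k hk
      rw [mem_pointsNear]
      have := abs_sub_le_clusterDiam (a := a) hk hi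
      linarith [clusterDiam_nonneg (a := a) T]
  have hpar := (clusterParent_spec ha hT hu).2.2 _ hcl hsub
  have hdp : clusterDiam a (clusterParent a T) ≤ 2 * (clusterGap a T * 129 ^ n) := by
    refine clusterDiam_le (by positivity) fun k hk l hl => ?_
    have hk' := mem_pointsNear.1 (hpar hk)
    have hl' := mem_pointsNear.1 (hpar hl)
    have h1 : |a k - a l| ≤ |a k - a i| + |a l - a i| := by
      rw [abs_sub_comm (a l)]; exact abs_sub_le _ _ _
    have h2 : clusterGap a T * 129 ^ m ≤ clusterGap a T * 129 ^ n := by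
      gcongr
      norm_num
    linarith
  rw [invOuterRadius_mul_le_iff ha hT.1 hu, innerRadius]
  nlinarith [pow_pos (by norm_num : (0 : ℝ) < 129) n]

end Cluster

/-! ### The tree of clusters -/

section ClusterTree

variable {n : ℕ} (a : Fin n → ℝ)

/-- Clusters with at least two points. -/
abbrev ClusterVertex : Type := {I : Finset (Fin n) // IsCluster a I ∧ 1 < I.card}

/-- Clusters with at least two points which are not the cluster of all points. -/
abbrev ClusterEdge : Type := {I : Finset (Fin n) // (IsCluster a I ∧ 1 < I.card) ∧ I ≠ Finset.univ}

/-- The cluster whose surrounding annulus is a given leg. -/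
def legCluster : ClusterEdge a ⊕ Fin (n + 1) → Finset (Fin n) :=
  Sum.elim (fun e => e.1) (Fin.lastCases Finset.univ fun i => {i})

/-- The length of the annulus around a cluster. -/
def clusterLength (I : Finset (Fin n)) : ℝ :=
  Real.log (1 / (innerRadius a I * invOuterRadius a I)) / Real.pi

variable {a}

@[simp] theorem legCluster_inl (e : ClusterEdge a) : legCluster a (.inl e) = e.1 := rfl

@[simp] theorem legCluster_last : legCluster a (.inr (Fin.last n)) = Finset.univ := by
  simp [legCluster]

@[simp] theorem legCluster_castSucc (i : Fin n) : legCluster a (.inr i.castSucc) = {i} := by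
  simp [legCluster]

theorem isCluster_legCluster [NeZero n] (l : ClusterEdge a ⊕ Fin (n + 1)) :
    IsCluster a (legCluster a l) := by
  rcases l with e | i
  · exact e.2.1.1
  · induction i using Fin.lastCases with
    | last => rw [legCluster_last]; exact isCluster_univ
    | cast i => rw [legCluster_castSucc]; exact isCluster_singleton i

/-- Together with `legCluster_injective` this identifies the legs with all clusters: the last
external leg is the cluster of all points, the other external legs are the single points, and the
internal legs are the rest. -/
theorem exists_legCluster_eq {I : Finset (Fin n)} (hI : IsCluster a I) :
    ∃ l, legCluster a l = I := by
  by_cases hu : I = Finset.univ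
  · exact ⟨.inr (Fin.last n), by simp [hu]⟩
  · by_cases hc : 1 < I.card
    · exact ⟨.inl ⟨I, ⟨hI, hc⟩, hu⟩, rfl⟩
    · obtain ⟨i, hi⟩ := Finset.card_eq_one.1 (le_antisymm (not_lt.1 hc) (Finset.card_pos.2 hI.1))
      exact ⟨.inr i.castSucc, by simp [hi]⟩

theorem singleton_ne_univ (hn : 2 ≤ n) (i : Fin n) : ({i} : Finset (Fin n)) ≠ Finset.univ := by
  intro h
  have := congrArg Finset.card h
  rw [Finset.card_singleton, Finset.card_univ, Fintype.card_fin] at this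
  omega

theorem legCluster_injective (hn : 2 ≤ n) : Function.Injective (legCluster a) := by
  rintro (e | i) (e' | j) h
  · exact congrArg Sum.inl (Subtype.ext h)
  · induction j using Fin.lastCases with
    | last => exact absurd (h.trans legCluster_last) e.2.2
    | cast j =>
      have h1 := e.2.1.2
      rw [legCluster_castSucc, legCluster_inl] at h
      rw [h, Finset.card_singleton] at h1
      exact absurd h1 (lt_irrefl 1)
  · induction i using Fin.lastCases with
    | last => exact absurd (h.symm.trans legCluster_last) e'.2.2
    | cast j =>
      have h1 := e'.2.1.2
      rw [legCluster_castSucc, legCluster_inl] at h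
      rw [← h, Finset.card_singleton] at h1
      exact absurd h1 (lt_irrefl 1)
  · induction i using Fin.lastCases with
    | last =>
      induction j using Fin.lastCases with
      | last => rfl
      | cast j =>
        rw [legCluster_last, legCluster_castSucc] at h
        exact absurd h.symm (singleton_ne_univ hn j)
    | cast i =>
      induction j using Fin.lastCases with
      | last =>
        rw [legCluster_last, legCluster_castSucc] at h
        exact absurd h (singleton_ne_univ hn i)
      | cast j =>
        rw [legCluster_castSucc, legCluster_castSucc, Finset.singleton_inj] at h
        rw [h]

/-- Take a largest cluster strictly inside `S` containing `i`; `{i}` is a candidate because `S` has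
a second point. -/
theorem exists_child (ha : Function.Injective a) {S : Finset (Fin n)} (hS : IsCluster a S)
    (hc : 1 < S.card) {i : Fin n} (hi : i ∈ S) :
    ∃ T, IsCluster a T ∧ i ∈ T ∧ T ⊂ S ∧ clusterParent a T = S := by
  classical
  obtain ⟨T, hT, hmax⟩ := (Finset.univ.filter fun T => IsCluster a T ∧ i ∈ T ∧ T ⊂ S).exists_max_image
    Finset.card ⟨{i}, by
      simp only [Finset.mem_filter, Finset.mem_univ, true_and, Finset.mem_singleton]
      refine ⟨isCluster_singleton i, (Finset.singleton_subset_iff.2 hi).ssubset_of_ne ?_⟩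
      rintro h
      rw [← h, Finset.card_singleton] at hc
      exact lt_irrefl 1 hc⟩
  simp only [Finset.mem_filter, Finset.mem_univ, true_and] at hT hmax
  have hTu : T ≠ Finset.univ := by
    rintro rfl
    exact hT.2.2.2 (Finset.subset_univ S)
  obtain ⟨h1, h2, h3⟩ := clusterParent_spec ha hT.1 hTu
  refine ⟨T, hT.1, hT.2.1, hT.2.2, ?_⟩
  by_contra hne
  have := hmax _ ⟨h1, h2.1 hT.2.1, (h3 S hS hT.2.2).ssubset_of_ne hne⟩
  exact absurd (Finset.card_lt_card h2) (by omega)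

/-- A largest cluster containing `i` but not `k` works: its parent must contain `k`, and any cluster
containing both points strictly contains it. The parent is thus the smallest cluster containing `i`
and `k`. -/
theorem exists_separating_cluster (ha : Function.Injective a) {i k : Fin n} (hik : i ≠ k) :
    ∃ T, IsCluster a T ∧ T ≠ Finset.univ ∧ i ∈ T ∧ k ∉ T ∧ k ∈ clusterParent a T ∧
      ∀ J, IsCluster a J → i ∈ J → k ∈ J → clusterParent a T ⊆ J := by
  classical
  obtain ⟨T, hT, hmax⟩ := (Finset.univ.filter fun T => IsCluster a T ∧ i ∈ T ∧ k ∉ T).exists_max_image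
    Finset.card ⟨{i}, by simpa using ⟨isCluster_singleton i, hik.symm⟩⟩
  simp only [Finset.mem_filter, Finset.mem_univ, true_and] at hT hmax
  have hTu : T ≠ Finset.univ := by
    rintro rfl
    exact hT.2.2 (Finset.mem_univ k)
  obtain ⟨h1, h2, h3⟩ := clusterParent_spec ha hT.1 hTu
  refine ⟨T, hT.1, hTu, hT.2.1, hT.2.2, ?_, fun J hJ hiJ hkJ => h3 J hJ ?_⟩
  · by_contra hk
    have := hmax _ ⟨h1, h2.1 hT.2.1, hk⟩
    exact absurd (Finset.card_lt_card h2) (by omega)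
  · rcases hT.1.trichotomy ha hJ with h | h | h
    · exact h.ssubset_of_ne (by rintro rfl; exact hT.2.2 hkJ)
    · exact absurd (h hkJ) hT.2.2
    · exact absurd hiJ (Finset.disjoint_left.1 h hT.2.1)

variable (hn : 2 ≤ n) (ha : StrictMono a)

/-- The vertex at the inner end of an internal leg. -/
def clusterSrc (e : ClusterEdge a) : ClusterVertex a := ⟨e.1, e.2.1⟩

/-- The vertex at the outer end of an internal leg. -/
def clusterTgt (e : ClusterEdge a) : ClusterVertex a :=
  ⟨clusterParent a e.1, (clusterParent_spec ha.injective e.2.1.1 e.2.2).1,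
    one_lt_card_clusterParent ha.injective e.2.1.1 e.2.2⟩

variable (a) in
/-- The cluster of all points. -/
def rootVertex : ClusterVertex a :=
  ⟨Finset.univ, ⟨⟨⟨0, by omega⟩, Finset.mem_univ _⟩, fun _ _ _ _ _ _ j hj =>
    absurd (Finset.mem_univ j) hj⟩, by rw [Finset.card_univ, Fintype.card_fin]; omega⟩

/-- The vertex at the end of an external leg. -/
def clusterAtt : Fin (n + 1) → ClusterVertex a :=
  Fin.lastCases (rootVertex a hn) fun i =>
    ⟨clusterParent a {i}, (clusterParent_spec ha.injective (isCluster_singleton i)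
      (singleton_ne_univ hn i)).1, one_lt_card_clusterParent ha.injective (isCluster_singleton i)
      (singleton_ne_univ hn i)⟩

@[simp] theorem clusterAtt_last : clusterAtt hn ha (Fin.last n) = rootVertex a hn := by
  simp [clusterAtt]

@[simp] theorem clusterAtt_castSucc (i : Fin n) :
    (clusterAtt hn ha i.castSucc).1 = clusterParent a {i} := by
  simp [clusterAtt]

/-- The end points of the legs. -/
def clusterEnds : ClusterEdge a ⊕ Fin (n + 1) → Sym2 (ClusterVertex a ⊕ Fin (n + 1)) :=
  Sum.elim (fun e => s(.inl (clusterSrc e), .inl (clusterTgt ha e)))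
    (fun i => s(.inl (clusterAtt hn ha i), .inr i))

theorem ssubset_clusterTgt (e : ClusterEdge a) : e.1 ⊂ (clusterTgt ha e).1 :=
  (clusterParent_spec ha.injective e.2.1.1 e.2.2).2.1

theorem clusterEnds_not_isDiag (l : ClusterEdge a ⊕ Fin (n + 1)) :
    ¬ (clusterEnds hn ha l).IsDiag := by
  rcases l with e | i
  · simp only [clusterEnds, Sum.elim_inl, Sym2.mk_isDiag_iff, Sum.inl.injEq]
    intro h
    exact (ssubset_clusterTgt ha e).ne (congrArg Subtype.val h)
  · simp [clusterEnds]

theorem clusterEnds_injective : Function.Injective (clusterEnds hn ha) := by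
  rintro (e | i) (e' | j) h
  · simp only [clusterEnds, Sum.elim_inl, Sym2.eq_iff, Sum.inl.injEq] at h
    rcases h with ⟨h, _⟩ | ⟨h1, h2⟩
    · exact congrArg Sum.inl (Subtype.ext (show (clusterSrc e).1 = (clusterSrc e').1 by rw [h]))
    · have e1 : e.1 = (clusterTgt ha e').1 := congrArg Subtype.val h1
      have e2 : (clusterTgt ha e).1 = e'.1 := congrArg Subtype.val h2
      have h3 := ssubset_clusterTgt ha e
      have h4 := ssubset_clusterTgt ha e'
      rw [← e1, ← e2] at h4
      exact absurd (h3.trans h4) (lt_irrefl _)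
  · simp [clusterEnds] at h
  · simp [clusterEnds] at h
  · simp only [clusterEnds, Sum.elim_inr, Sym2.eq_iff, Sum.inl.injEq, Sum.inr.injEq,
      reduceCtorEq, false_and, or_false] at h
    rw [h.2]

/-- The graph of clusters and external vertices. -/
abbrev clusterGraph : SimpleGraph (ClusterVertex a ⊕ Fin (n + 1)) :=
  SimpleGraph.fromEdgeSet (range (clusterEnds hn ha))

theorem clusterGraph_adj_iff {x y : ClusterVertex a ⊕ Fin (n + 1)} :
    (clusterGraph hn ha).Adj x y ↔ ∃ l, clusterEnds hn ha l = s(x, y) := by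
  rw [SimpleGraph.fromEdgeSet_adj]
  refine ⟨fun h => h.1, fun h => ⟨h, ?_⟩⟩
  rintro rfl
  obtain ⟨l, hl⟩ := h
  exact clusterEnds_not_isDiag hn ha l (by rw [hl]; exact rfl)

theorem clusterGraph_reachable_root (x : ClusterVertex a ⊕ Fin (n + 1)) :
    (clusterGraph hn ha).Reachable x (.inl (rootVertex a hn)) := by
  have h1 : ∀ m (v : ClusterVertex a), n - v.1.card = m →
      (clusterGraph hn ha).Reachable (.inl v) (.inl (rootVertex a hn)) := by
    intro m
    induction m using Nat.strong_induction_on with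
    | _ m ih =>
      intro v hv
      by_cases hu : v.1 = Finset.univ
      · have : v = rootVertex a hn := Subtype.ext hu
        rw [this]
      · set e : ClusterEdge a := ⟨v.1, v.2, hu⟩ with he
        have hadj : (clusterGraph hn ha).Adj (.inl v) (.inl (clusterTgt ha e)) :=
          (clusterGraph_adj_iff hn ha).2 ⟨.inl e, rfl⟩
        have hlt := Finset.card_lt_card (ssubset_clusterTgt ha e)
        have hle := Finset.card_le_univ (clusterTgt ha e).1
        rw [Fintype.card_fin] at hle
        exact hadj.reachable.trans (ih _ (by change v.1.card < _ at hlt; omega) _ rfl)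
  rcases x with v | i
  · exact h1 _ v rfl
  · have hadj : (clusterGraph hn ha).Adj (.inr i) (.inl (clusterAtt hn ha i)) :=
      (clusterGraph_adj_iff hn ha).2 ⟨.inr i, Sym2.eq_swap⟩
    exact hadj.reachable.trans (h1 _ _ rfl)

/-- Each vertex other than the root is the inner end of exactly one internal leg, the one of its own
cluster. -/
theorem card_clusterVertex (hn : 2 ≤ n) : Nat.card (ClusterVertex a) = Nat.card (ClusterEdge a) + 1 := by
  rw [← Finite.card_option]
  symm
  refine Nat.card_congr (Equiv.ofBijective
    (fun o : Option (ClusterEdge a) => o.elim (rootVertex a hn) clusterSrc) ⟨?_, ?_⟩)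
  · rintro (_ | e) (_ | e') h
    · rfl
    · exact absurd (congrArg Subtype.val h).symm e'.2.2
    · exact absurd (congrArg Subtype.val h) e.2.2
    · exact congrArg some (Subtype.ext
        (show (clusterSrc e).1 = (clusterSrc e').1 from congrArg Subtype.val h))
  · intro v
    by_cases hu : v.1 = Finset.univ
    · exact ⟨none, Subtype.ext hu.symm⟩
    · exact ⟨some ⟨v.1, v.2, hu⟩, rfl⟩

/-- Passing to parents connects every node to the root, and there is one more node than edges: each
external vertex adds one of each to the count for internal vertices. -/
theorem clusterGraph_isTree : (clusterGraph hn ha).IsTree := by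
  rw [SimpleGraph.isTree_iff_connected_and_card]
  refine ⟨⟨fun x y => (clusterGraph_reachable_root hn ha x).trans
    (clusterGraph_reachable_root hn ha y).symm⟩, ?_⟩
  have hes : (clusterGraph hn ha).edgeSet = range (clusterEnds hn ha) := by
    rw [SimpleGraph.edgeSet_fromEdgeSet, sdiff_eq_left, Set.disjoint_left]
    rintro _ ⟨l, rfl⟩
    exact clusterEnds_not_isDiag hn ha l
  rw [hes, Nat.card_range_of_injective (clusterEnds_injective hn ha), Nat.card_sum, Nat.card_sum,
    card_clusterVertex hn]
  ring

/-! ### Valence and planarity of the cluster tree. -/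

theorem inl_mem_clusterEnds_of_eq {v : ClusterVertex a} {l : ClusterEdge a ⊕ Fin (n + 1)}
    (h : legCluster a l = v.1) : Sum.inl v ∈ clusterEnds hn ha l := by
  rcases l with e | i
  · have : v = clusterSrc e := Subtype.ext h.symm
    rw [this]
    exact Sym2.mem_mk_left _ _
  · induction i using Fin.lastCases with
    | last =>
      have : v = rootVertex a hn := Subtype.ext (h.symm.trans legCluster_last)
      rw [this, ← clusterAtt_last hn ha]
      exact Sym2.mem_mk_left _ _
    | cast i =>
      have := v.2.2
      rw [← h, legCluster_castSucc, Finset.card_singleton] at this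
      exact absurd this (lt_irrefl 1)

theorem inl_mem_clusterEnds_of_parent {v : ClusterVertex a} {l : ClusterEdge a ⊕ Fin (n + 1)}
    (hu : legCluster a l ≠ Finset.univ) (h : clusterParent a (legCluster a l) = v.1) :
    Sum.inl v ∈ clusterEnds hn ha l := by
  rcases l with e | i
  · have : v = clusterTgt ha e := Subtype.ext h.symm
    rw [this]
    exact Sym2.mem_mk_right _ _
  · induction i using Fin.lastCases with
    | last => exact absurd legCluster_last hu
    | cast i =>
      rw [legCluster_castSucc] at h
      have : v = clusterAtt hn ha i.castSucc :=
        Subtype.ext (h.symm.trans (clusterAtt_castSucc hn ha i).symm)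
      rw [this]
      exact Sym2.mem_mk_left _ _

/-- The vertex `v` carries the leg of its own cluster and the legs of at least two children: the
child containing a point `i` is proper, and a point outside it lies in another child. -/
theorem three_le_clusterValence (v : ClusterVertex a) :
    3 ≤ {l | Sum.inl v ∈ clusterEnds hn ha l}.ncard := by
  obtain ⟨i, hi⟩ := v.2.1.1
  obtain ⟨T, hT, hiT, hTv, hTp⟩ := exists_child ha.injective v.2.1 v.2.2 hi
  obtain ⟨j, hj, hjT⟩ := Finset.exists_of_ssubset hTv
  obtain ⟨T', hT', hjT', hTv', hTp'⟩ := exists_child ha.injective v.2.1 v.2.2 hj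
  obtain ⟨l, hl⟩ := exists_legCluster_eq v.2.1
  obtain ⟨m, hm⟩ := exists_legCluster_eq hT
  obtain ⟨m', hm'⟩ := exists_legCluster_eq hT'
  have hne : ∀ {I : Finset (Fin n)}, I ⊂ v.1 → I ≠ Finset.univ := by
    rintro _ h rfl
    exact h.2 (Finset.subset_univ _)
  refine (Set.two_lt_ncard_iff (Set.toFinite _)).2 ⟨l, m, m', inl_mem_clusterEnds_of_eq hn ha hl,
    inl_mem_clusterEnds_of_parent hn ha (by rw [hm]; exact hne hTv) (by rw [hm, hTp]),
    inl_mem_clusterEnds_of_parent hn ha (by rw [hm']; exact hne hTv') (by rw [hm', hTp']), ?_, ?_, ?_⟩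
  · rintro rfl
    exact hTv.ne (hm.symm.trans hl)
  · rintro rfl
    exact hTv'.ne (hm'.symm.trans hl)
  · rintro rfl
    exact hjT (hm.symm.trans hm' ▸ hjT')

/-- The nodes below a cluster. -/
def nodesBelow (S : Finset (Fin n)) : Set (ClusterVertex a ⊕ Fin (n + 1)) :=
  {x | Sum.elim (fun v : ClusterVertex a => v.1 ⊆ S) (fun i => ∃ j ∈ S, j.castSucc = i) x}

theorem inr_mem_nodesBelow {S : Finset (Fin n)} {i : Fin n} :
    (Sum.inr i.castSucc : ClusterVertex a ⊕ Fin (n + 1)) ∈ nodesBelow S ↔ i ∈ S := by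
  simp [nodesBelow]

theorem last_notMem_nodesBelow {S : Finset (Fin n)} :
    (Sum.inr (Fin.last n) : ClusterVertex a ⊕ Fin (n + 1)) ∉ nodesBelow S := by
  rintro ⟨j, _, hj⟩
  exact (Fin.castSucc_lt_last j).ne hj

/-- Only the leg of a cluster leads out of the part of the tree below it. -/
theorem eq_of_adj_of_mem_nodesBelow {S : Finset (Fin n)} (hS : IsCluster a S)
    {x y : ClusterVertex a ⊕ Fin (n + 1)} (hxy : (clusterGraph hn ha).Adj x y)
    (hx : x ∈ nodesBelow S) (hy : y ∉ nodesBelow S) :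
    (∀ h : 1 < S.card, x = .inl ⟨S, hS, h⟩) ∧
      (S ≠ Finset.univ → ∃ v : ClusterVertex a, v.1 = clusterParent a S ∧ y = .inl v) := by
  obtain ⟨l, hl⟩ := (clusterGraph_adj_iff hn ha).1 hxy
  rcases l with e | i
  · simp only [clusterEnds, Sum.elim_inl, Sym2.eq_iff] at hl
    have h1 := ssubset_clusterTgt ha e
    rcases hl with ⟨rfl, rfl⟩ | ⟨rfl, rfl⟩
    · have h2 : e.1 ⊆ S := hx
      have h3 : ¬ (clusterTgt ha e).1 ⊆ S := hy
      have h4 : e.1 = S := by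
        by_contra hne
        exact h3 ((clusterParent_spec ha.injective e.2.1.1 e.2.2).2.2 S hS (h2.ssubset_of_ne hne))
      refine ⟨fun h => congrArg Sum.inl (Subtype.ext h4), fun _ => ⟨_, ?_, rfl⟩⟩
      rw [← h4]
      rfl
    · have h2 : (clusterTgt ha e).1 ⊆ S := hx
      exact absurd (h1.1.trans h2) hy
  · simp only [clusterEnds, Sum.elim_inr, Sym2.eq_iff] at hl
    induction i using Fin.lastCases with
    | last =>
      rcases hl with ⟨rfl, rfl⟩ | ⟨rfl, rfl⟩
      · rw [clusterAtt_last] at hx ⊢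
        have h2 : Finset.univ ⊆ S := hx
        have h3 : S = Finset.univ := Finset.eq_univ_of_forall fun i => h2 (Finset.mem_univ i)
        exact ⟨fun _ => congrArg Sum.inl (Subtype.ext h3.symm), fun h => absurd h3 h⟩
      · exact absurd hx last_notMem_nodesBelow
    | cast j =>
      have hp := clusterParent_spec ha.injective (isCluster_singleton (a := a) j)
        (singleton_ne_univ hn j)
      rcases hl with ⟨rfl, rfl⟩ | ⟨rfl, rfl⟩
      · have h2 : (clusterAtt hn ha j.castSucc).1 ⊆ S := hx
        rw [clusterAtt_castSucc] at h2
        exact absurd (inr_mem_nodesBelow.2 (h2 (hp.2.1.1 (Finset.mem_singleton_self j)))) hy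
      · have h2 := inr_mem_nodesBelow.1 hx
        have h3 : ¬ (clusterAtt hn ha j.castSucc).1 ⊆ S := hy
        rw [clusterAtt_castSucc] at h3
        have h4 : {j} = S := by
          by_contra hne
          exact h3 (hp.2.2 S hS ((Finset.singleton_subset_iff.2 h2).ssubset_of_ne hne))
        refine ⟨fun h => ?_, fun _ => ⟨_, ?_, rfl⟩⟩
        · rw [← h4, Finset.card_singleton] at h
          exact absurd h (lt_irrefl 1)
        · rw [clusterAtt_castSucc, h4]

/-- The part of the tree below `v` is left only through the leg of the cluster `v`, which starts at
`v`. -/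
theorem mem_support_of_leaves {v : ClusterVertex a} {x y : ClusterVertex a ⊕ Fin (n + 1)}
    (p : (clusterGraph hn ha).Walk x y) (hx : x ∈ nodesBelow v.1) (hy : y ∉ nodesBelow v.1) :
    Sum.inl v ∈ p.support := by
  obtain ⟨d, hd, h1, h2⟩ := p.exists_boundary_dart _ hx hy
  have := (eq_of_adj_of_mem_nodesBelow hn ha v.2.1 d.adj h1 h2).1 v.2.2
  rw [← this]
  exact p.dart_fst_mem_support_of_mem_darts hd

/-- The vertex is the parent of a maximal cluster `T` separating `i` from `k`. A walk from `i` to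
`k` must leave the part below `T`, and the only exit leads to this parent. -/
theorem exists_joining_cluster {i k : Fin n} (hik : i ≠ k) : ∃ v : ClusterVertex a, i ∈ v.1 ∧
    k ∈ v.1 ∧ (∀ J, IsCluster a J → i ∈ J → k ∈ J → v.1 ⊆ J) ∧
    ∀ p : (clusterGraph hn ha).Walk (.inr i.castSucc) (.inr k.castSucc), .inl v ∈ p.support := by
  obtain ⟨T, hT, hTu, hi, hk, hk', hmin⟩ := exists_separating_cluster ha.injective hik
  obtain ⟨h1, h2, h3⟩ := clusterParent_spec ha.injective hT hTu
  refine ⟨⟨_, h1, one_lt_card_clusterParent ha.injective hT hTu⟩, h2.1 hi, hk', hmin, fun p => ?_⟩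
  obtain ⟨d, hd, h4, h5⟩ := p.exists_boundary_dart (nodesBelow T) (inr_mem_nodesBelow.2 hi)
    (fun h => hk (inr_mem_nodesBelow.1 h))
  obtain ⟨v, hv, hdv⟩ := (eq_of_adj_of_mem_nodesBelow hn ha hT d.adj h4 h5).2 hTu
  have hm := p.dart_snd_mem_support_of_mem_darts hd
  rw [hdv] at hm
  convert hm
  exact hv.symm

/-- Let `v` be the smallest cluster containing `i` and `k`; it is an interval, so it contains `j`.
If `l` is not below `v`, then `q` leaves the part below `v` and passes through `v`, as does `p`.
Otherwise the smallest cluster `w` containing `j` and `l` contains `k`. If it also contains `i`,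
minimality gives `v = w`; if not, `p` passes through `w`. The vertex at infinity is below no
cluster. -/
theorem clusterGraph_noncrossing {i j k l : Fin (n + 1)} (hij : i < j) (hjk : j < k) (hkl : k < l)
    (p : (clusterGraph hn ha).Walk (.inr i) (.inr k))
    (q : (clusterGraph hn ha).Walk (.inr j) (.inr l)) : ∃ x, x ∈ p.support ∧ x ∈ q.support := by
  have hk := hkl.trans_le (Fin.le_last l)
  obtain ⟨k, rfl⟩ := Fin.exists_castSucc_eq.2 hk.ne
  obtain ⟨j, rfl⟩ := Fin.exists_castSucc_eq.2 (hjk.trans hk).ne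
  obtain ⟨i, rfl⟩ := Fin.exists_castSucc_eq.2 (hij.trans (hjk.trans hk)).ne
  rw [Fin.castSucc_lt_castSucc_iff] at hij hjk
  obtain ⟨v, hiv, hkv, hvmin, hv⟩ := exists_joining_cluster hn ha (hij.trans hjk).ne
  have hjv := v.2.1.mem_of_lt ha hiv hkv hij hjk
  by_cases hlv : Sum.inr l ∈ nodesBelow (a := a) v.1
  · induction l using Fin.lastCases with
    | last => exact absurd hlv last_notMem_nodesBelow
    | cast l =>
      rw [Fin.castSucc_lt_castSucc_iff] at hkl
      obtain ⟨w, hjw, hlw, hwmin, hw⟩ := exists_joining_cluster hn ha (hjk.trans hkl).ne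
      have hkw := w.2.1.mem_of_lt ha hjw hlw hjk hkl
      by_cases hiw : i ∈ w.1
      · have : v = w := Subtype.ext ((hvmin _ w.2.1 hiw hkw).antisymm
          (hwmin _ v.2.1 hjv (inr_mem_nodesBelow.1 hlv)))
        exact ⟨.inl v, hv p, this ▸ hw q⟩
      · refine ⟨.inl w, ?_, hw q⟩
        have := mem_support_of_leaves hn ha (v := w) p.reverse (inr_mem_nodesBelow.2 hkw)
          (fun h => hiw (inr_mem_nodesBelow.1 h))
        simpa using this
  · exact ⟨.inl v, hv p, mem_support_of_leaves hn ha q (inr_mem_nodesBelow.2 hjv) hlv⟩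

theorem innerRadius_mul_invOuterRadius_pos (e : ClusterEdge a) (ha : StrictMono a) :
    0 < innerRadius a e.1 * invOuterRadius a e.1 :=
  mul_pos (innerRadius_pos ha.injective e.2.1.2) (invOuterRadius_pos ha.injective e.2.1.1.1 e.2.2)

theorem clusterLength_pos (e : ClusterEdge a) (ha : StrictMono a) : 0 < clusterLength a e.1 := by
  have h1 := innerRadius_mul_invOuterRadius_pos e ha
  have h2 := innerRadius_mul_invOuterRadius_le ha.injective e.2.1.1
  exact div_pos (Real.log_pos ((one_lt_div h1).2 (by linarith))) Real.pi_pos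

/-- The metric ribbon tree of clusters. -/
def clusterTree : MetricRibbonTree (n + 1) where
  V := ClusterVertex a
  E := ClusterEdge a
  finite_V := inferInstance
  finite_E := inferInstance
  src := clusterSrc
  tgt := clusterTgt ha
  att := clusterAtt hn ha
  ends := clusterEnds hn ha
  ends_internal := fun _ => rfl
  ends_external := fun _ => rfl
  no_loop := clusterEnds_not_isDiag hn ha
  no_multiple := clusterEnds_injective hn ha
  isTree := clusterGraph_isTree hn ha
  three_le_valence := three_le_clusterValence hn ha
  noncrossing := fun _ _ _ _ h1 h2 h3 p q => clusterGraph_noncrossing hn ha h1 h2 h3 p q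
  length := Sum.elim (fun e => (clusterLength a e.1 : EReal)) fun _ => ⊤
  length_pos := by
    rintro (e | i)
    · exact EReal.coe_pos.2 (clusterLength_pos e ha)
    · exact EReal.coe_lt_top 0
  length_eq_top_iff := by
    rintro (e | i)
    · simp
    · simp

end ClusterTree

/-! ### Scale invariant bounds for the first two derivatives -/

/-- The derivatives of `f` at `z` up to order two are bounded by `A` at scale `R`. -/
structure ScaledBound (f : ℂ → ℝ) (A R : ℝ) (z : ℂ) : Prop where
  contDiff : ContDiff ℝ 2 f
  bound : ∀ k ≤ 2, ‖iteratedFDeriv ℝ k f z‖ ≤ A / R ^ k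

namespace ScaledBound

variable {f g : ℂ → ℝ} {A B R : ℝ} {z : ℂ}

theorem abs_le (h : ScaledBound f A R z) : |f z| ≤ A := by
  simpa using h.bound 0 (by norm_num)

theorem norm_fderiv_le (h : ScaledBound f A R z) : ‖fderiv ℝ f z‖ ≤ A / R := by
  simpa using h.bound 1 (by norm_num)

theorem norm_fderiv_fderiv_le (h : ScaledBound f A R z) :
    ‖fderiv ℝ (fderiv ℝ f) z‖ ≤ A / R ^ 2 := by
  rw [← norm_iteratedFDeriv_one, norm_iteratedFDeriv_fderiv]
  exact h.bound 2 le_rfl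

theorem nonneg (h : ScaledBound f A R z) : 0 ≤ A := (abs_nonneg _).trans h.abs_le

theorem mono (h : ScaledBound f A R z) (hR : 0 < R) (hAB : A ≤ B) : ScaledBound f B R z :=
  ⟨h.contDiff, fun k hk => (h.bound k hk).trans (by gcongr)⟩

theorem add (hf : ScaledBound f A R z) (hg : ScaledBound g B R z) :
    ScaledBound (fun z => f z + g z) (A + B) R z := by
  refine ⟨hf.contDiff.add hg.contDiff, fun k hk => ?_⟩
  have hk' : (k : WithTop ℕ∞) ≤ 2 := by exact_mod_cast hk
  have : iteratedFDeriv ℝ k (fun z => f z + g z) z = _ :=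
    iteratedFDeriv_add_apply (hf.contDiff.of_le hk').contDiffAt (hg.contDiff.of_le hk').contDiffAt
  rw [this, add_div]
  exact (norm_add_le _ _).trans (add_le_add (hf.bound k hk) (hg.bound k hk))

theorem neg (hf : ScaledBound f A R z) : ScaledBound (fun z => -f z) A R z := by
  refine ⟨hf.contDiff.neg, fun k hk => ?_⟩
  have : iteratedFDeriv ℝ k (fun z => -f z) z = _ := iteratedFDeriv_neg_apply
  rw [this, norm_neg]
  exact hf.bound k hk

/-- Leibniz' rule has binomial coefficients with sum `2 ^ k ≤ 4`, and the powers of `R` multiply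
correctly. -/
theorem mul (hf : ScaledBound f A R z) (hg : ScaledBound g B R z) (hR : 0 < R) :
    ScaledBound (fun z => f z * g z) (4 * (A * B)) R z := by
  refine ⟨hf.contDiff.mul hg.contDiff, fun k hk => ?_⟩
  have hk' : (k : WithTop ℕ∞) ≤ 2 := by exact_mod_cast hk
  refine (norm_iteratedFDeriv_mul_le hf.contDiff hg.contDiff z hk').trans ?_
  have hA := hf.nonneg
  have hB := hg.nonneg
  calc _ ≤ ∑ i ∈ Finset.range (k + 1), (k.choose i : ℝ) * (A * B / R ^ k) := by
        refine Finset.sum_le_sum fun i hi => ?_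
        have hik : i ≤ k := Nat.lt_succ_iff.1 (Finset.mem_range.1 hi)
        rw [mul_assoc]
        gcongr
        calc _ ≤ (A / R ^ i) * (B / R ^ (k - i)) := by
              gcongr
              · exact hf.bound i (hik.trans hk)
              · exact hg.bound (k - i) ((Nat.sub_le k i).trans hk)
          _ = A * B / R ^ k := by rw [div_mul_div_comm, ← pow_add, Nat.add_sub_of_le hik]
    _ = 2 ^ k * (A * B) / R ^ k := by
        rw [← Finset.sum_mul]
        have := Nat.sum_range_choose k
        rw [← Nat.cast_sum, this]
        push_cast
        ring
    _ ≤ _ := by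
        gcongr
        calc (2 : ℝ) ^ k ≤ 2 ^ 2 := by gcongr; norm_num
          _ = 4 := by norm_num

theorem const (c : ℝ) (hR : 0 < R) : ScaledBound (fun _ => c) |c| R z := by
  refine ⟨contDiff_const, fun k _ => ?_⟩
  rcases k with _ | k
  · simp
  · rw [iteratedFDeriv_const_of_ne (Nat.succ_ne_zero k)]
    simp only [Pi.zero_apply, norm_zero]
    positivity

theorem sum {ι : Type*} (s : Finset ι) {f : ι → ℂ → ℝ} (hR : 0 < R)
    (h : ∀ i ∈ s, ScaledBound (f i) A R z) :
    ScaledBound (fun z => ∑ i ∈ s, f i z) (s.card * A) R z := by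
  classical
  induction s using Finset.induction_on with
  | empty => simpa using const (z := z) 0 hR
  | insert i s hi ih =>
    have h1 := (h i (Finset.mem_insert_self i s)).add
      (ih fun j hj => h j (Finset.mem_insert_of_mem hj))
    simp only [Finset.sum_insert hi, Finset.card_insert_of_notMem hi]
    refine h1.mono hR (le_of_eq ?_)
    push_cast
    ring

end ScaledBound

/-- The square of the distance to `c`, scaled by `k`. -/
def scaledDistSq (k c : ℝ) (z : ℂ) : ℝ := k ^ 2 * ‖z - c‖ ^ 2

theorem contDiff_scaledDistSq (k c : ℝ) {m : WithTop ℕ∞} : ContDiff ℝ m (scaledDistSq k c) :=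
  contDiff_const.mul ((contDiff_id.sub contDiff_const).norm_sq ℝ)

theorem fderiv_scaledDistSq (k c : ℝ) :
    fderiv ℝ (scaledDistSq k c) = fun z : ℂ => (2 * k ^ 2) • innerSL ℝ (z - (c : ℂ)) := by
  funext z
  have h1 : HasFDerivAt (fun z : ℂ => z - (c : ℂ)) (ContinuousLinearMap.id ℝ ℂ) z :=
    (hasFDerivAt_id z).sub_const _
  have h2 := (h1.norm_sq.const_mul (k ^ 2)).fderiv
  refine h2.trans ?_
  ext
  simp
  ring

/-- The form `(D / R) ^ i` of the bound is what the estimate for derivatives of a composition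
requires; the summand 1 makes `D ≥ 1`, so that lower powers of `D` are dominated by higher ones. -/
theorem norm_iteratedFDeriv_scaledDistSq_le {k c M R : ℝ} {z : ℂ} (hR : 0 < R) (hk : 0 ≤ k)
    (hkR : k * R ≤ M) (hz : ‖z - c‖ ≤ 4 * R) {i : ℕ} (h1 : 1 ≤ i) (h2 : i ≤ 2) :
    ‖iteratedFDeriv ℝ i (scaledDistSq k c) z‖ ≤ ((8 * M ^ 2 + 1) / R) ^ i := by
  have hkM : k ^ 2 * R ^ 2 ≤ M ^ 2 := by
    rw [← mul_pow]
    exact pow_le_pow_left₀ (by positivity) hkR 2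
  interval_cases i
  · rw [norm_iteratedFDeriv_one, fderiv_scaledDistSq, norm_smul, innerSL_apply_norm, pow_one,
      Real.norm_of_nonneg (by positivity), le_div_iff₀ hR]
    calc 2 * k ^ 2 * ‖z - c‖ * R ≤ 2 * k ^ 2 * (4 * R) * R := by gcongr
      _ = 8 * (k ^ 2 * R ^ 2) := by ring
      _ ≤ 8 * M ^ 2 + 1 := by linarith
  · rw [← norm_iteratedFDeriv_fderiv, norm_iteratedFDeriv_one, fderiv_scaledDistSq]
    have h3 : HasFDerivAt (fun z : ℂ => (2 * k ^ 2) • innerSL ℝ (z - (c : ℂ)))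
        ((2 * k ^ 2) • innerSL ℝ (E := ℂ)) z :=
      (((innerSL ℝ (E := ℂ)).hasFDerivAt (x := z - c)).comp z
        ((hasFDerivAt_id z).sub_const _)).const_smul (2 * k ^ 2)
    rw [h3.fderiv]
    refine (ContinuousLinearMap.opNorm_le_bound _ (by positivity) (M := 2 * k ^ 2)
      fun v => ?_).trans ?_
    · rw [smul_apply, norm_smul, innerSL_apply_norm,
        Real.norm_of_nonneg (by positivity)]
    · rw [div_pow, le_div_iff₀ (by positivity)]
      nlinarith [sq_nonneg M]

/-- Functions of the scaled distance have derivatives bounded in a scale invariant way. -/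
theorem exists_scaledBound_comp {f : ℝ → ℝ} (hf : ContDiff ℝ 2 f) (M : ℝ) :
    ∃ C, 0 ≤ C ∧ ∀ (k c R : ℝ) (z : ℂ), 0 < R → 0 ≤ k → k * R ≤ M → ‖z - c‖ ≤ 4 * R →
      ScaledBound (fun z => f (scaledDistSq k c z)) C R z := by
  have hb : ∀ i : Fin 3, ∃ C, ∀ t ∈ Icc (0 : ℝ) ((4 * M) ^ 2), ‖iteratedFDeriv ℝ i f t‖ ≤ C :=
    fun i => isCompact_Icc.exists_bound_of_continuousOn
      (hf.continuous_iteratedFDeriv (by exact_mod_cast Nat.lt_succ_iff.1 i.2)).continuousOn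
  choose C hC using hb
  set C0 := |C 0| + |C 1| + |C 2| with hC0
  have hCi : ∀ i ≤ 2, ∀ t ∈ Icc (0 : ℝ) ((4 * M) ^ 2), ‖iteratedFDeriv ℝ i f t‖ ≤ C0 := by
    intro i hi t ht
    have h0 := abs_nonneg (C 0)
    have h1 := abs_nonneg (C 1)
    have h2 := abs_nonneg (C 2)
    have h3 := hC ⟨i, Nat.lt_succ_iff.2 hi⟩ t ht
    have h4 := le_abs_self (C ⟨i, Nat.lt_succ_iff.2 hi⟩)
    refine h3.trans (h4.trans ?_)
    interval_cases i
    · change |C 0| ≤ _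
      linarith
    · change |C 1| ≤ _
      linarith
    · change |C 2| ≤ _
      linarith
  have hC00 : 0 ≤ C0 := by positivity
  -- The composition estimate gives `i! * C0 * (D / R) ^ i` with `i ≤ 2`, and `i! ≤ 2`, `D ^ i ≤ D ^
  -- 2`.
  refine ⟨2 * C0 * (8 * M ^ 2 + 1) ^ 2, by positivity, fun k c R z hR hk hkR hz =>
    ⟨hf.comp (contDiff_scaledDistSq k c), fun i hi => ?_⟩⟩
  -- The outer function is evaluated only on a fixed compact interval, where its derivatives are
  -- bounded independently of `k`, `c` and `R`.
  have hmem : scaledDistSq k c z ∈ Icc (0 : ℝ) ((4 * M) ^ 2) := by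
    constructor
    · rw [scaledDistSq]; positivity
    · rw [scaledDistSq, ← mul_pow]
      refine pow_le_pow_left₀ (by positivity) ?_ 2
      nlinarith
  have h1 := norm_iteratedFDeriv_comp_le hf (contDiff_scaledDistSq k c) (n := i)
    (by exact_mod_cast hi) z (C := C0) (D := (8 * M ^ 2 + 1) / R)
    (fun j hj => hCi j (hj.trans hi) _ hmem)
    (fun j hj1 hj2 => norm_iteratedFDeriv_scaledDistSq_le hR hk hkR hz hj1 (hj2.trans hi))
  refine h1.trans ?_
  rw [div_pow, mul_div_assoc']
  gcongr
  · exact_mod_cast (Nat.factorial_le hi)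
  · nlinarith [sq_nonneg M]

/-! ### The conformal factor -/

/-- A smooth function with value `1` on `t ≤ 1` and `0` on `t ≥ 4`. -/
def cutoff (t : ℝ) : ℝ := Real.smoothTransition ((4 - t) / 3)

/-- A smooth function on the line which equals `-log t / 2` for `t ≥ 1 / 4`. -/
def logProfile (t : ℝ) : ℝ := -(1 / 2) * Real.log t * Real.smoothTransition (8 * t - 1)

theorem cutoff_of_le {t : ℝ} (h : t ≤ 1) : cutoff t = 1 :=
  Real.smoothTransition.one_of_one_le (by linarith)

theorem cutoff_of_ge {t : ℝ} (h : 4 ≤ t) : cutoff t = 0 :=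
  Real.smoothTransition.zero_of_nonpos (by linarith)

theorem contDiff_cutoff : ContDiff ℝ ∞ cutoff :=
  Real.smoothTransition.contDiff.comp ((contDiff_const.sub contDiff_id).div_const 3)

theorem logProfile_of_ge {t : ℝ} (h : 1 / 4 ≤ t) : logProfile t = -(1 / 2) * Real.log t := by
  rw [logProfile, Real.smoothTransition.one_of_one_le (by linarith), mul_one]

theorem contDiff_logProfile : ContDiff ℝ ∞ logProfile := by
  rw [contDiff_iff_contDiffAt]
  intro t
  by_cases ht : t = 0
  · have : logProfile =ᶠ[𝓝 t] fun _ => 0 := by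
      filter_upwards [Iio_mem_nhds (show t < 1 / 8 by rw [ht]; norm_num)] with s hs
      rw [logProfile, Real.smoothTransition.zero_of_nonpos (by linarith [mem_Iio.1 hs]), mul_zero]
    exact contDiffAt_const.congr_of_eventuallyEq this
  · exact (contDiffAt_const.mul (Real.contDiffAt_log.2 ht)).mul
      (Real.smoothTransition.contDiff.comp
        ((contDiff_const.mul contDiff_id).sub contDiff_const)).contDiffAt

section Potential

variable {n : ℕ} (a : Fin n → ℝ)

/-- The cutoff function of the disk bounded by the outer circle around a cluster. -/
def clusterCutoff (I : Finset (Fin n)) (z : ℂ) : ℝ :=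
  cutoff (scaledDistSq (invOuterRadius a I) (clusterCenter a I) z)

/-- A function which equals `-log |z - c|` outside of the inner disk around a cluster. -/
def clusterPotential (I : Finset (Fin n)) (z : ℂ) : ℝ :=
  if 1 < I.card then -Real.log (innerRadius a I) +
    logProfile (scaledDistSq (innerRadius a I)⁻¹ (clusterCenter a I) z)
  else -(1 / 2) * Real.log (‖z - clusterCenter a I‖ ^ 2)

open Classical in
/-- The clusters strictly contained in a given set. -/
def clustersBelow (I : Finset (Fin n)) : Finset (Finset (Fin n)) :=
  Finset.univ.filter fun T => IsCluster a T ∧ T ⊂ I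

open Classical in
/-- All clusters. -/
def allClusters : Finset (Finset (Fin n)) := Finset.univ.filter (IsCluster a)

open Classical in
/-- The maximal clusters strictly contained in a given one. -/
def clusterChildren (S : Finset (Fin n)) : Finset (Finset (Fin n)) :=
  Finset.univ.filter fun T => IsCluster a T ∧ T ⊂ S ∧ clusterParent a T = S

/-- The weight of the potential of a cluster. -/
def clusterWeight (I : Finset (Fin n)) (z : ℂ) : ℝ :=
  clusterCutoff a I z * ∏ T ∈ clustersBelow a I, (1 - clusterCutoff a T z)

/-- The logarithm of the conformal factor, up to a constant. -/
def logFactor (z : ℂ) : ℝ :=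
  ∑ I ∈ allClusters a, clusterWeight a I z * clusterPotential a I z

/-- The conformal factor of the model metric. -/
def modelFactor (z : ℂ) : ℝ := Real.exp (logFactor a z) / Real.pi

/-- A globally smooth function which agrees with the logarithm of the conformal factor near the
piece of a vertex, up to a constant. -/
def localPotential (S : Finset (Fin n)) (z : ℂ) : ℝ :=
  logProfile (scaledDistSq (innerRadius a S)⁻¹ (clusterCenter a S) z) +
    ∑ T ∈ clusterChildren a S, clusterCutoff a T z *
      (Real.log (innerRadius a S * invOuterRadius a T) +
        (logProfile (scaledDistSq (invOuterRadius a T) (clusterCenter a T) z) +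
          -logProfile (scaledDistSq (innerRadius a S)⁻¹ (clusterCenter a S) z)))

variable {a}

theorem mem_clustersBelow {I T : Finset (Fin n)} :
    T ∈ clustersBelow a I ↔ IsCluster a T ∧ T ⊂ I := by
  simp [clustersBelow]

theorem mem_allClusters {I : Finset (Fin n)} : I ∈ allClusters a ↔ IsCluster a I := by
  simp [allClusters]

theorem mem_clusterChildren {S T : Finset (Fin n)} :
    T ∈ clusterChildren a S ↔ IsCluster a T ∧ T ⊂ S ∧ clusterParent a T = S := by
  simp [clusterChildren]

theorem contDiff_clusterCutoff (I : Finset (Fin n)) : ContDiff ℝ ∞ (clusterCutoff a I) :=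
  contDiff_cutoff.comp (contDiff_scaledDistSq _ _)

theorem clusterCutoff_eq_one (ha : Function.Injective a) {I : Finset (Fin n)} (hI : I.Nonempty)
    {z : ℂ} (h : invOuterRadius a I * ‖z - clusterCenter a I‖ ≤ 1) : clusterCutoff a I z = 1 := by
  have := mul_nonneg (invOuterRadius_nonneg ha hI) (norm_nonneg (z - clusterCenter a I))
  apply cutoff_of_le
  rw [scaledDistSq, ← mul_pow]
  nlinarith

theorem clusterCutoff_eq_zero {I : Finset (Fin n)} {z : ℂ}
    (h : 2 ≤ invOuterRadius a I * ‖z - clusterCenter a I‖) : clusterCutoff a I z = 0 := by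
  apply cutoff_of_ge
  rw [scaledDistSq, ← mul_pow]
  nlinarith

theorem clusterPotential_of_card {I : Finset (Fin n)} (hI : 1 < I.card) (z : ℂ) :
    clusterPotential a I z = -Real.log (innerRadius a I) +
      logProfile (scaledDistSq (innerRadius a I)⁻¹ (clusterCenter a I) z) := if_pos hI

/-- The profile takes the square of the scaled distance, so its threshold `1 / 4` means scaled
distance `1 / 2`. -/
theorem logProfile_scaledDistSq {k c : ℝ} {z : ℂ} (hk : 0 < k) (h : 1 / 2 ≤ k * ‖z - c‖) :
    logProfile (scaledDistSq k c z) = -Real.log k - Real.log ‖z - c‖ := by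
  have h0 : 0 < ‖z - c‖ := by
    by_contra hc
    have : ‖z - c‖ = 0 := le_antisymm (not_lt.1 hc) (norm_nonneg _)
    rw [this] at h
    norm_num at h
  rw [scaledDistSq, ← mul_pow, logProfile_of_ge (by nlinarith), Real.log_pow,
    Real.log_mul hk.ne' h0.ne']
  push_cast
  ring

theorem clusterPotential_of_le (ha : Function.Injective a) {I : Finset (Fin n)} {z : ℂ}
    (h : innerRadius a I ≤ 2 * ‖z - clusterCenter a I‖) :
    clusterPotential a I z = -Real.log ‖z - clusterCenter a I‖ := by
  rw [clusterPotential]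
  split_ifs with hc
  · have hR := innerRadius_pos ha hc
    rw [logProfile_scaledDistSq (inv_pos.2 hR) (by
      rw [inv_mul_eq_div, le_div_iff₀ hR]
      linarith), Real.log_inv]
    ring
  · rw [Real.log_pow]
    push_cast
    ring

/-! ### Local expressions of the conformal factor. -/

theorem clusterWeight_eq_zero_of_ssubset (ha : Function.Injective a) {S I : Finset (Fin n)}
    (hS : IsCluster a S) (hSI : S ⊂ I) {z : ℂ}
    (hz : invOuterRadius a S * ‖z - clusterCenter a S‖ ≤ 1) : clusterWeight a I z = 0 := by
  rw [clusterWeight, Finset.prod_eq_zero (mem_clustersBelow.2 ⟨hS, hSI⟩), mul_zero]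
  rw [clusterCutoff_eq_one ha hS.1 hz, sub_self]

theorem clusterWeight_eq_zero_of_cutoff {I : Finset (Fin n)} {z : ℂ}
    (hz : clusterCutoff a I z = 0) : clusterWeight a I z = 0 := by
  rw [clusterWeight, hz, zero_mul]

/-- Inside the outer disk of `S`, a larger cluster is killed by the factor `1 - clusterCutoff a S`,
and a disjoint one by its own cutoff, because the doubled disks are disjoint. -/
theorem clusterWeight_eq_zero (ha : Function.Injective a) {S I : Finset (Fin n)}
    (hS : IsCluster a S) (hI : IsCluster a I) (hIS : ¬ I ⊆ S) {z : ℂ}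
    (hz : invOuterRadius a S * ‖z - clusterCenter a S‖ ≤ 1) : clusterWeight a I z = 0 := by
  rcases hS.trichotomy ha hI with h | h | h
  · exact clusterWeight_eq_zero_of_ssubset ha hS
      (h.ssubset_of_ne (by rintro rfl; exact hIS le_rfl)) hz
  · exact absurd h hIS
  · exact clusterWeight_eq_zero_of_cutoff (clusterCutoff_eq_zero
      (lt_norm_sub_center_of_disjoint ha hS.1 hI.1 h (by linarith)).le)

theorem logFactor_eq_clusterPotential (ha : Function.Injective a) {S : Finset (Fin n)}
    (hS : IsCluster a S) {z : ℂ} (hz : invOuterRadius a S * ‖z - clusterCenter a S‖ ≤ 1)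
    (h : ∀ T, IsCluster a T → T ⊂ S → clusterCutoff a T z = 0) :
    logFactor a z = clusterPotential a S z := by
  rw [logFactor, Finset.sum_eq_single_of_mem S (mem_allClusters.2 hS), clusterWeight,
    clusterCutoff_eq_one ha hS.1 hz, Finset.prod_eq_one, one_mul, one_mul]
  · intro T hT
    obtain ⟨h1, h2⟩ := mem_clustersBelow.1 hT
    rw [h T h1 h2, sub_zero]
  · intro I hI hne
    rw [mem_allClusters] at hI
    by_cases hIS : I ⊆ S
    · rw [clusterWeight_eq_zero_of_cutoff (h I hI (hIS.ssubset_of_ne hne)), zero_mul]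
    · rw [clusterWeight_eq_zero ha hS hI hIS hz, zero_mul]

/-- Only `S` and `T` contribute, and their weights reduce to `1 - clusterCutoff a T` and
`clusterCutoff a T`. -/
theorem logFactor_eq_interpolation (ha : Function.Injective a) {S T : Finset (Fin n)}
    (hS : IsCluster a S) (hT : IsCluster a T) (hTS : T ⊂ S) {z : ℂ}
    (hz : invOuterRadius a S * ‖z - clusterCenter a S‖ ≤ 1)
    (h : ∀ J, IsCluster a J → J ⊂ S → J ≠ T → clusterCutoff a J z = 0) :
    logFactor a z = clusterPotential a S z +
      clusterCutoff a T z * (clusterPotential a T z - clusterPotential a S z) := by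
  rw [logFactor, Finset.sum_eq_add_of_mem S T (mem_allClusters.2 hS) (mem_allClusters.2 hT)
    hTS.ne']
  · have h1 : clusterWeight a T z = clusterCutoff a T z := by
      rw [clusterWeight, Finset.prod_eq_one, mul_one]
      intro J hJ
      obtain ⟨h1, h2⟩ := mem_clustersBelow.1 hJ
      rw [h J h1 (h2.trans hTS) h2.ne, sub_zero]
    have h2 : clusterWeight a S z = 1 - clusterCutoff a T z := by
      rw [clusterWeight, clusterCutoff_eq_one ha hS.1 hz, one_mul]
      refine Finset.prod_eq_single_of_mem T (mem_clustersBelow.2 ⟨hT, hTS⟩) fun J hJ hne => ?_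
      obtain ⟨h1, h2⟩ := mem_clustersBelow.1 hJ
      rw [h J h1 h2 hne, sub_zero]
    rw [h1, h2]
    ring
  · intro I hI hne
    rw [mem_allClusters] at hI
    by_cases hIS : I ⊆ S
    · rw [clusterWeight_eq_zero_of_cutoff (h I hI (hIS.ssubset_of_ne hne.1) hne.2), zero_mul]
    · rw [clusterWeight_eq_zero ha hS hI hIS hz, zero_mul]

/-- The metric is that of a flat cylinder on the annulus around a cluster. -/
theorem logFactor_eq_neg_log (ha : Function.Injective a) {I : Finset (Fin n)}
    (hI : IsCluster a I) {z : ℂ} (hz : invOuterRadius a I * ‖z - clusterCenter a I‖ ≤ 1)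
    (h : innerRadius a I ≤ 2 * ‖z - clusterCenter a I‖) :
    logFactor a z = -Real.log ‖z - clusterCenter a I‖ := by
  rw [logFactor_eq_clusterPotential ha hI hz, clusterPotential_of_le ha h]
  intro T hT hTI
  apply clusterCutoff_eq_zero
  by_contra! hc
  exact absurd (norm_sub_center_lt_of_ssubset ha hT.1 hTI hc.le) (not_lt.2 h)

/-- Inside the inner disk of a cluster, all outer radii of larger clusters are far away. -/
theorem invOuterRadius_mul_lt_of_ssubset (ha : Function.Injective a) {S T : Finset (Fin n)}
    (hS : IsCluster a S) (hT : T.Nonempty) (hTS : T ⊂ S) {z : ℂ}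
    (hz : invOuterRadius a T * ‖z - clusterCenter a T‖ ≤ 2) :
    invOuterRadius a S * ‖z - clusterCenter a S‖ ≤ 1 / 4 := by
  have h1 := norm_sub_center_lt_of_ssubset ha hT hTS hz
  have h2 := innerRadius_mul_invOuterRadius_le ha hS
  have h3 := invOuterRadius_nonneg ha hS.1
  nlinarith

/-- Away from the half-size outer disks, at most one cutoff below `S` is nonzero: for nested
clusters the point would be at scaled distance at most `1 / 4` from the larger one, and for disjoint
ones the supports do not meet. -/
theorem clusterCutoff_eq_zero_of_ne (ha : Function.Injective a) {S T J : Finset (Fin n)}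
    (hT : IsCluster a T) (hTS : T ⊂ S) (hJ : IsCluster a J) (hJS : J ⊂ S) (hne : J ≠ T) {z : ℂ}
    (hz : ∀ T, IsCluster a T → T ⊂ S → 1 / 2 ≤ invOuterRadius a T * ‖z - clusterCenter a T‖)
    (h : clusterCutoff a T z ≠ 0) : clusterCutoff a J z = 0 := by
  have h2 : invOuterRadius a T * ‖z - clusterCenter a T‖ ≤ 2 := by
    by_contra! hc
    exact h (clusterCutoff_eq_zero hc.le)
  apply clusterCutoff_eq_zero
  by_contra! hc
  rcases hT.trichotomy ha hJ with h1 | h1 | h1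
  · have h3 := invOuterRadius_mul_lt_of_ssubset ha hJ hT.1 (h1.ssubset_of_ne hne.symm) h2
    linarith [hz J hJ hJS]
  · have h3 := invOuterRadius_mul_lt_of_ssubset ha hT hJ.1 (h1.ssubset_of_ne hne) hc.le
    linarith [hz T hT hTS]
  · linarith [lt_norm_sub_center_of_disjoint ha hT.1 hJ.1 h1 h2]

/-- At most one smaller cluster `T` has a nonzero cutoff, and it is a child of `S`, since otherwise
the point would be too close to the parent of `T`. Moreover the point is outside the inner disk of
`T`, so the potential of `T` is a pure logarithm. Rewriting it by the profile at the outer scale of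
`T` removes the singularities and the smaller scale of `T`. -/
theorem logFactor_eq_localPotential (ha : Function.Injective a) {S : Finset (Fin n)}
    (hS : IsCluster a S) (hc : 1 < S.card) {z : ℂ}
    (hzS : invOuterRadius a S * ‖z - clusterCenter a S‖ ≤ 1)
    (hz : ∀ T, IsCluster a T → T ⊂ S → 1 / 2 ≤ invOuterRadius a T * ‖z - clusterCenter a T‖) :
    logFactor a z = -Real.log (innerRadius a S) + localPotential a S z := by
  by_cases h : ∃ T, IsCluster a T ∧ T ⊂ S ∧ clusterCutoff a T z ≠ 0
  · obtain ⟨T, hT, hTS, hne⟩ := h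
    have hTu : T ≠ Finset.univ := by
      rintro rfl
      exact hTS.2 (Finset.subset_univ _)
    have hzero : ∀ J, IsCluster a J → J ⊂ S → J ≠ T → clusterCutoff a J z = 0 :=
      fun J hJ hJS hJT => clusterCutoff_eq_zero_of_ne ha hT hTS hJ hJS hJT hz hne
    have hTc : T ∈ clusterChildren a S := by
      refine mem_clusterChildren.2 ⟨hT, hTS, ?_⟩
      obtain ⟨h1, h2, h3⟩ := clusterParent_spec ha hT hTu
      by_contra hP
      have h4 := (h3 S hS hTS).ssubset_of_ne hP
      have h5 : invOuterRadius a T * ‖z - clusterCenter a T‖ ≤ 2 := by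
        by_contra! hc
        exact hne (clusterCutoff_eq_zero hc.le)
      linarith [invOuterRadius_mul_lt_of_ssubset ha h1 hT.1 h2 h5, hz _ h1 h4]
    rw [logFactor_eq_interpolation ha hS hT hTS hzS hzero, localPotential,
      Finset.sum_eq_single_of_mem T hTc, clusterPotential_of_card hc]
    · have hk := invOuterRadius_pos ha hT.1 hTu
      have hR := innerRadius_pos ha hc
      have h1 := hz T hT hTS
      have h2 := innerRadius_mul_invOuterRadius_le ha hT
      have h3 : innerRadius a T ≤ ‖z - clusterCenter a T‖ := by
        by_contra! hlt
        nlinarith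
      rw [clusterPotential_of_le ha (by linarith [norm_nonneg (z - clusterCenter a T)]),
        logProfile_scaledDistSq hk h1, Real.log_mul hR.ne' hk.ne']
      ring
    · intro J hJ hJT
      obtain ⟨h1, h2, _⟩ := mem_clusterChildren.1 hJ
      rw [hzero J h1 h2 hJT, zero_mul]
  · push Not at h
    rw [logFactor_eq_clusterPotential ha hS hzS h, localPotential, Finset.sum_eq_zero,
      clusterPotential_of_card hc, add_zero]
    intro T hT
    obtain ⟨h1, h2, _⟩ := mem_clusterChildren.1 hT
    rw [h T h1 h2, zero_mul]

theorem contDiffAt_clusterPotential {I : Finset (Fin n)} (hI : I.Nonempty) {z : ℂ}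
    (hz : z ∉ Complex.ofReal '' range a) : ContDiffAt ℝ ∞ (clusterPotential a I) z := by
  by_cases hc : 1 < I.card
  · have : clusterPotential a I = fun z => -Real.log (innerRadius a I) +
        logProfile (scaledDistSq (innerRadius a I)⁻¹ (clusterCenter a I) z) :=
      funext (clusterPotential_of_card hc)
    rw [this]
    exact (contDiff_const.add
      (contDiff_logProfile.comp (contDiff_scaledDistSq _ _))).contDiffAt
  · have : clusterPotential a I =
        fun z : ℂ => -(1 / 2) * Real.log (‖z - (clusterCenter a I : ℂ)‖ ^ 2) :=
      funext fun _ => if_neg hc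
    rw [this]
    obtain ⟨i, _, ei⟩ := exists_clusterCenter_eq (a := a) hI
    have hne : z - clusterCenter a I ≠ 0 := by
      intro h
      exact hz ⟨a i, ⟨i, rfl⟩, by rw [← ei]; exact (sub_eq_zero.1 h).symm⟩
    have h1 : ContDiffAt ℝ ∞ (fun z : ℂ => ‖z - clusterCenter a I‖ ^ 2) z :=
      ((contDiff_id.sub contDiff_const).norm_sq ℝ).contDiffAt
    exact contDiffAt_const.mul (h1.log (pow_ne_zero 2 (norm_ne_zero_iff.2 hne)))

theorem contDiffOn_modelFactor :
    ContDiffOn ℝ ∞ (modelFactor a) (Complex.ofReal '' range a)ᶜ := by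
  intro z hz
  apply ContDiffAt.contDiffWithinAt
  have h1 : ContDiffAt ℝ ∞ (logFactor a) z := by
    refine ContDiffAt.sum fun I hI => ContDiffAt.mul ?_
      (contDiffAt_clusterPotential (mem_allClusters.1 hI).1 hz)
    refine (contDiff_clusterCutoff I).contDiffAt.mul ?_
    exact contDiffAt_prod fun T _ => contDiffAt_const.sub (contDiff_clusterCutoff T).contDiffAt
  exact h1.exp.div_const _

theorem modelFactor_pos (z : ℂ) : 0 < modelFactor a z :=
  div_pos (Real.exp_pos _) Real.pi_pos

theorem norm_conj_sub_ofReal (z : ℂ) (c : ℝ) : ‖starRingEnd ℂ z - c‖ = ‖z - c‖ := by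
  rw [← Complex.norm_conj (z - c), map_sub, Complex.conj_ofReal]

/-- The centers are real, so all distances entering the factor are invariant under conjugation. -/
theorem modelFactor_conj (z : ℂ) : modelFactor a (starRingEnd ℂ z) = modelFactor a z := by
  simp only [modelFactor, logFactor, clusterWeight, clusterCutoff, clusterPotential, scaledDistSq,
    norm_conj_sub_ofReal]

theorem log_modelFactor (z : ℂ) :
    Real.log (modelFactor a z) = logFactor a z - Real.log Real.pi := by
  rw [modelFactor, Real.log_div (Real.exp_pos _).ne' Real.pi_pos.ne', Real.log_exp]

/-- The lower bound is `4 * 8`, since the gap of a child is at most the diameter of `S`; the upper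
bound is the comparability of scales. -/
theorem abs_log_innerRadius_mul_le (ha : Function.Injective a) {S T : Finset (Fin n)}
    (hT : T ∈ clusterChildren a S) :
    32 ≤ innerRadius a S * invOuterRadius a T ∧
      innerRadius a S * invOuterRadius a T ≤ 128 * 129 ^ n := by
  obtain ⟨h1, h2, h3⟩ := mem_clusterChildren.1 hT
  have hTu : T ≠ Finset.univ := by
    rintro rfl
    exact h2.2 (Finset.subset_univ _)
  constructor
  · obtain ⟨k, hkS, hkT⟩ := Finset.exists_of_ssubset h2
    obtain ⟨i, hi⟩ := h1.1
    have h4 := (clusterGap_le (a := a) hi hkT).trans (abs_sub_le_clusterDiam (h2.1 hi) hkS)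
    have h5 := clusterGap_pos ha h1.1 hTu
    rw [innerRadius, invOuterRadius, if_neg hTu, mul_div_assoc', le_div_iff₀ h5]
    linarith
  · have := invOuterRadius_mul_innerRadius_parent_le ha h1 hTu
    rwa [h3, mul_comm] at this

theorem norm_sub_center_le (ha : Function.Injective a) {S T : Finset (Fin n)} (hT : T.Nonempty)
    (hTS : T ⊂ S) (z : ℂ) :
    ‖z - clusterCenter a T‖ ≤ ‖z - clusterCenter a S‖ + innerRadius a S := by
  have h1 := norm_sub_center_lt_of_ssubset ha hT hTS (z := clusterCenter a T) (by simp)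
  have h2 := norm_add_le (z - clusterCenter a S) (clusterCenter a S - clusterCenter a T)
  rw [sub_add_sub_cancel, norm_sub_rev (clusterCenter a S : ℂ)] at h2
  linarith [norm_nonneg ((clusterCenter a T : ℂ) - clusterCenter a S)]

/-- Uniform bounds for the local expression of the conformal factor. -/
theorem exists_scaledBound_localPotential (n : ℕ) : ∃ A : ℝ, 1 ≤ A ∧
    ∀ (a : Fin n → ℝ), StrictMono a → ∀ S : Finset (Fin n), 1 < S.card → ∀ z : ℂ,
      ‖z - clusterCenter a S‖ ≤ 3 * innerRadius a S →
      ScaledBound (localPotential a S) A (innerRadius a S) z := by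
  -- This `M` bounds `k * R` for all scalings `k` that occur: the inverse inner radius of `S` and
  -- the inverse outer radii of its children.
  set M : ℝ := 128 * 129 ^ n with hM
  have hM1 : 1 ≤ M := by
    have : (1 : ℝ) ≤ 129 ^ n := one_le_pow₀ (by norm_num)
    linarith
  obtain ⟨H, hH0, hH⟩ := exists_scaledBound_comp (contDiff_logProfile.of_le ENat.LEInfty.out) M
  obtain ⟨P, hP0, hP⟩ := exists_scaledBound_comp (contDiff_cutoff.of_le ENat.LEInfty.out) M
  set L : ℝ := Real.log M with hL
  have hL0 : 0 ≤ L := Real.log_nonneg hM1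
  set K : ℝ := 4 * (P * (L + (H + H))) with hK
  have hK0 : 0 ≤ K := by positivity
  -- The children are subsets of `Fin n`, so there are at most `2 ^ n` of them; the summand 1 only
  -- ensures `1 ≤ A`.
  refine ⟨1 + (H + 2 ^ n * K), by linarith [mul_nonneg (pow_nonneg zero_le_two n) hK0],
    fun a ha S hS z hz => ?_⟩
  have hR := innerRadius_pos ha.injective hS
  have h1 : ScaledBound (fun z => logProfile (scaledDistSq (innerRadius a S)⁻¹
      (clusterCenter a S) z)) H (innerRadius a S) z :=
    hH _ _ _ z hR (inv_pos.2 hR).le (by rwa [inv_mul_cancel₀ hR.ne']) (by linarith)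
  have h2 : ∀ T ∈ clusterChildren a S, ScaledBound (fun z => clusterCutoff a T z *
      (Real.log (innerRadius a S * invOuterRadius a T) +
        (logProfile (scaledDistSq (invOuterRadius a T) (clusterCenter a T) z) +
          -logProfile (scaledDistSq (innerRadius a S)⁻¹ (clusterCenter a S) z)))) K
      (innerRadius a S) z := by
    intro T hT
    obtain ⟨hT1, hT2, hT3⟩ := mem_clusterChildren.1 hT
    obtain ⟨h3, h4⟩ := abs_log_innerRadius_mul_le ha.injective hT
    have h5 := norm_sub_center_le ha.injective hT1.1 hT2 z
    have hk := invOuterRadius_nonneg ha.injective hT1.1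
    have h6 : ScaledBound (fun _ => Real.log (innerRadius a S * invOuterRadius a T)) L
        (innerRadius a S) z := by
      refine (ScaledBound.const _ hR).mono hR ?_
      rw [abs_of_nonneg (Real.log_nonneg (by linarith))]
      exact Real.log_le_log (by linarith) h4
    have h7 : invOuterRadius a T * innerRadius a S ≤ M := by rwa [mul_comm]
    exact (hP _ _ _ z hR hk h7 (by linarith)).mul
      (h6.add ((hH _ _ _ z hR hk h7 (by linarith)).add h1.neg)) hR
  refine (h1.add (ScaledBound.sum _ hR h2)).mono hR ?_
  have h3 : ((clusterChildren a S).card : ℝ) ≤ 2 ^ n := by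
    have := Finset.card_le_univ (clusterChildren a S)
    rw [Fintype.card_finset, Fintype.card_fin] at this
    exact_mod_cast this
  have h4 := mul_le_mul_of_nonneg_right h3 hK0
  linarith

end Potential

/-! ### The Cayley transform of a marked disk -/

/-- The Cayley transform from the unit disk to the upper half plane, with pole `p`. -/
def cayley (p z : ℂ) : ℂ := Complex.I * (p + z) / (p - z)

/-- The inverse Cayley transform. -/
def cayleyInv (p w : ℂ) : ℂ := p * (w - Complex.I) / (w + Complex.I)

theorem cayleyInv_cayley {p z : ℂ} (hp : p ≠ 0) (hz : z ≠ p) : cayleyInv p (cayley p z) = z := by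
  have h1 : p - z ≠ 0 := sub_ne_zero.2 hz.symm
  have e1 : cayley p z - Complex.I = 2 * Complex.I * z / (p - z) := by
    rw [cayley]; field_simp; ring
  have e2 : cayley p z + Complex.I = 2 * Complex.I * p / (p - z) := by
    rw [cayley]; field_simp; ring
  rw [cayleyInv, e1, e2]
  field_simp [Complex.I_ne_zero]

theorem cayley_cayleyInv {p w : ℂ} (hp : p ≠ 0) (hw : w + Complex.I ≠ 0) :
    cayley p (cayleyInv p w) = w := by
  have e1 : p + cayleyInv p w = 2 * p * w / (w + Complex.I) := by
    rw [cayleyInv]; field_simp; ring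
  have e2 : p - cayleyInv p w = 2 * p * Complex.I / (w + Complex.I) := by
    rw [cayleyInv]; field_simp; ring
  rw [cayley, e1, e2]
  field_simp [Complex.I_ne_zero]

theorem cayleyInv_ne {p w : ℂ} (hp : p ≠ 0) (hw : w + Complex.I ≠ 0) : cayleyInv p w ≠ p := by
  rw [cayleyInv, Ne, div_eq_iff hw]
  intro h
  have h1 := mul_left_cancel₀ hp h
  have h2 : (2 : ℂ) * Complex.I = 0 := by linear_combination -h1
  simp [Complex.I_ne_zero] at h2

theorem cayley_im {p z : ℂ} (hp : ‖p‖ = 1) :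
    (cayley p z).im = (1 - ‖z‖ ^ 2) / Complex.normSq (p - z) := by
  have h1 : p.re * p.re + p.im * p.im = 1 := by
    rw [← Complex.normSq_apply, Complex.normSq_eq_norm_sq, hp, one_pow]
  have h2 : ‖z‖ ^ 2 = z.re * z.re + z.im * z.im := by
    rw [← Complex.normSq_eq_norm_sq, Complex.normSq_apply]
  rw [cayley, Complex.div_im, h2, ← h1]
  simp only [Complex.mul_re, Complex.mul_im, Complex.I_re, Complex.I_im, Complex.add_re,
    Complex.add_im, Complex.sub_re, Complex.sub_im]
  ring

theorem add_I_ne_zero {w : ℂ} (hw : 0 ≤ w.im) : w + Complex.I ≠ 0 := by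
  intro h
  have := congrArg Complex.im h
  simp at this
  linarith

theorem norm_cayleyInv {p w : ℂ} (hp : ‖p‖ = 1) (hw : 0 ≤ w.im) :
    0 ≤ 1 - ‖cayleyInv p w‖ ^ 2 ∧ (0 < w.im → 0 < 1 - ‖cayleyInv p w‖ ^ 2) := by
  have hI := add_I_ne_zero hw
  have hN : 0 < Complex.normSq (w + Complex.I) := Complex.normSq_pos.2 hI
  have e : 1 - ‖cayleyInv p w‖ ^ 2 = 4 * w.im / Complex.normSq (w + Complex.I) := by
    rw [cayleyInv, norm_div, norm_mul, hp, one_mul, div_pow, ← Complex.normSq_eq_norm_sq,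
      ← Complex.normSq_eq_norm_sq, eq_div_iff hN.ne', sub_mul, div_mul_cancel₀ _ hN.ne']
    simp only [Complex.normSq_apply, Complex.add_re, Complex.add_im, Complex.sub_re,
      Complex.sub_im, Complex.I_re, Complex.I_im]
    ring
  rw [e]
  exact ⟨by positivity, fun h => by positivity⟩

/-- The phase of the half sum of the angles cancels from the quotient, leaving minus the cotangent
of half their difference. -/
theorem cayley_exp {α β : ℝ} (h : Real.sin ((β - α) / 2) ≠ 0) :
    cayley (Complex.exp (α * Complex.I)) (Complex.exp (β * Complex.I)) =
      ((-Real.cos ((β - α) / 2) / Real.sin ((β - α) / 2) : ℝ) : ℂ) := by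
  set m := Complex.exp (((α + β) / 2 : ℂ) * Complex.I) with hm
  set w := Complex.exp (((β - α) / 2 : ℂ) * Complex.I) with hw
  have hm0 : m ≠ 0 := Complex.exp_ne_zero _
  have hw0 : w ≠ 0 := Complex.exp_ne_zero _
  have e1 : Complex.exp (α * Complex.I) = m * w⁻¹ := by
    rw [hm, hw, ← Complex.exp_neg, ← Complex.exp_add]
    congr 1
    ring
  have e2 : Complex.exp (β * Complex.I) = m * w := by
    rw [hm, hw, ← Complex.exp_add]
    congr 1
    ring
  have ew : Complex.exp (-((β - α) / 2 : ℂ) * Complex.I) = w⁻¹ := by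
    rw [hw, ← Complex.exp_neg]
    congr 1
    ring
  have ec : ((Real.cos ((β - α) / 2) : ℝ) : ℂ) = (w + w⁻¹) / 2 := by
    rw [Complex.ofReal_cos, Complex.cos]
    push_cast
    rw [ew]
  have es : ((Real.sin ((β - α) / 2) : ℝ) : ℂ) = (w⁻¹ - w) * Complex.I / 2 := by
    rw [Complex.ofReal_sin, Complex.sin]
    push_cast
    rw [ew]
  have hs : (w⁻¹ - w) ≠ 0 := by
    intro h0
    rw [h0, zero_mul, zero_div] at es
    exact h (by exact_mod_cast es)
  have hs' : m * w⁻¹ - m * w ≠ 0 := by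
    rw [← mul_sub]
    exact mul_ne_zero hm0 hs
  rw [cayley, e1, e2, Complex.ofReal_div, Complex.ofReal_neg, ec, es,
    div_eq_div_iff hs' (div_ne_zero (mul_ne_zero hs Complex.I_ne_zero) two_ne_zero)]
  linear_combination (m * w⁻¹ + m * w) * (w⁻¹ - w) / 2 * Complex.I_mul_I

/-- The sign is that of `sin (y - x)`. This monotonicity turns the counterclockwise order into the
order of the line. -/
theorem neg_cot_lt {x y : ℝ} (hx : -Real.pi < x) (hy : y < 0) (hxy : x < y) :
    -Real.cos x / Real.sin x < -Real.cos y / Real.sin y := by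
  have h1 : Real.sin x < 0 := Real.sin_neg_of_neg_of_neg_pi_lt (hxy.trans hy) hx
  have h2 : Real.sin y < 0 := Real.sin_neg_of_neg_of_neg_pi_lt hy (hx.trans hxy)
  have h3 : 0 < Real.sin (y - x) := Real.sin_pos_of_pos_of_lt_pi (by linarith) (by linarith)
  rw [Real.sin_sub] at h3
  have e : -Real.cos y / Real.sin y - -Real.cos x / Real.sin x =
      (Real.sin y * Real.cos x - Real.cos y * Real.sin x) / (Real.sin x * Real.sin y) := by
    have hx0 := h1.ne
    have hy0 := h2.ne
    rw [div_sub_div _ _ hy0 hx0, div_eq_div_iff (mul_ne_zero hy0 hx0) (mul_ne_zero hx0 hy0)]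
    ring
  have := div_pos h3 (mul_pos_of_neg_of_neg h1 h2)
  linarith

theorem tendsto_cayleyInv_cobounded (p : ℂ) :
    Tendsto (cayleyInv p) (Bornology.cobounded ℂ) (𝓝 p) := by
  have h1 : Tendsto (fun w : ℂ => (w + Complex.I)⁻¹) (Bornology.cobounded ℂ) (𝓝 0) :=
    Filter.tendsto_inv₀_cobounded.comp <| tendsto_norm_atTop_iff_cobounded.1 <|
      tendsto_atTop_mono (f := fun w : ℂ => ‖w‖ + -‖Complex.I‖)
        (fun w => by linarith [norm_le_add_norm_add w Complex.I])
        (tendsto_atTop_add_const_right _ _ tendsto_norm_cobounded_atTop)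
  have h2 : Tendsto (fun w : ℂ => p - 2 * p * Complex.I * (w + Complex.I)⁻¹)
      (Bornology.cobounded ℂ) (𝓝 (p - 2 * p * Complex.I * 0)) :=
    tendsto_const_nhds.sub (h1.const_mul _)
  rw [mul_zero, sub_zero] at h2
  refine h2.congr' ?_
  have hne : {-Complex.I}ᶜ ∈ Bornology.cobounded ℂ :=
    Bornology.isBounded_def.1 Bornology.isBounded_singleton
  filter_upwards [hne] with w hw
  have : w + Complex.I ≠ 0 := fun h => hw (eq_neg_of_add_eq_zero_left h)
  rw [cayleyInv]
  field_simp
  ring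

/-- The conformal model of a marked disk given by the Cayley transform and the model metric. -/
theorem exists_conformalModel {n : ℕ} (D : MarkedDisk (n + 1)) :
    ∃ (a : Fin n → ℝ) (M : ConformalModel D), StrictMono a ∧ M.punctures = range a ∧
      M.ρ = modelFactor a ∧
      (∀ i : Fin n, Tendsto M.chart.symm (𝓝 (a i : ℂ)) (𝓝 (D.pt i.castSucc))) ∧
      Tendsto M.chart.symm (Bornology.cobounded ℂ) (𝓝 (D.pt (Fin.last n))) := by
  obtain ⟨θ, hθ, hθ2, hpt⟩ := D.counterclockwise
  set p := D.pt (Fin.last n) with hp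
  have hp1 : ‖p‖ = 1 := by rw [hp, hpt, Complex.norm_exp_ofReal_mul_I]
  have hp0 : p ≠ 0 := by
    intro h
    rw [h, norm_zero] at hp1
    exact zero_ne_one hp1
  -- The last angle is the largest and all angles lie within less than `2π`, so these half
  -- differences are in `(-π, 0)`, where minus the cotangent is increasing.
  set δ : Fin n → ℝ := fun i => (θ i.castSucc - θ (Fin.last n)) / 2 with hδ
  have hδ1 : ∀ i, -Real.pi < δ i := fun i => by
    have := hθ2 (Fin.last n) i.castSucc
    simp only [hδ]
    linarith
  have hδ2 : ∀ i, δ i < 0 := fun i => by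
    have := hθ (Fin.castSucc_lt_last i)
    simp only [hδ]
    linarith
  set a : Fin n → ℝ := fun i => -Real.cos (δ i) / Real.sin (δ i) with ha
  have hmono : StrictMono a := fun i j hij => neg_cot_lt (hδ1 i) (hδ2 j) (by
    have := hθ (Fin.castSucc_lt_castSucc_iff.2 hij)
    simp only [hδ]
    linarith)
  have hcay : ∀ i : Fin n, cayley p (D.pt i.castSucc) = a i := by
    intro i
    rw [hp, hpt, hpt]
    exact cayley_exp (Real.sin_neg_of_neg_of_neg_pi_lt (hδ2 i) (hδ1 i)).ne
  have hptne : ∀ i : Fin n, D.pt i.castSucc ≠ p := by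
    intro i h
    have h1 := cayley_exp (α := θ (Fin.last n)) (β := θ i.castSucc)
      (Real.sin_neg_of_neg_of_neg_pi_lt (hδ2 i) (hδ1 i)).ne
    have h2 : Real.exp 0 = 1 := Real.exp_zero
    rw [hp, hpt, hpt, Complex.exp_eq_exp_iff_exists_int] at h
    obtain ⟨m, hm⟩ := h
    have h3 : θ i.castSucc = θ (Fin.last n) + m * (2 * Real.pi) := by
      have h4 : (θ i.castSucc : ℂ) * Complex.I =
          ((θ (Fin.last n) + m * (2 * Real.pi) : ℝ) : ℂ) * Complex.I := by
        rw [hm]; push_cast; ring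
      exact_mod_cast mul_right_cancel₀ Complex.I_ne_zero h4
    have h5 := hδ1 i
    have h6 := hδ2 i
    simp only [hδ, h3] at h5 h6
    have h7 : (m : ℝ) < 0 := by
      by_contra! hc
      nlinarith [Real.pi_pos]
    have h8 : (-1 : ℝ) < m := by
      by_contra! hc
      nlinarith [Real.pi_pos]
    have h9 : m < 0 := by exact_mod_cast h7
    have h10 : -1 < m := by exact_mod_cast h8
    omega
  have hinv : ∀ i : Fin n, cayleyInv p (a i) = D.pt i.castSucc := fun i => by
    rw [← hcay, cayleyInv_cayley hp0 (hptne i)]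
  have hcarrier : ∀ z, z ∈ D.carrier ↔ ‖z‖ ≤ 1 ∧ z ≠ p ∧ ∀ i : Fin n, z ≠ D.pt i.castSucc := by
    intro z
    rw [MarkedDisk.carrier, Set.mem_sdiff, mem_closedBall_zero_iff]
    refine and_congr_right fun _ => ⟨fun h => ⟨fun h' => h ⟨_, h'.symm⟩, fun i h' =>
      h ⟨_, h'.symm⟩⟩, ?_⟩
    rintro ⟨h1, h2⟩ ⟨i, hi⟩
    induction i using Fin.lastCases with
    | last => exact h1 hi.symm
    | cast i => exact h2 i hi.symm
  have hns : ∀ {z : ℂ}, z ≠ p → 0 < Complex.normSq (p - z) := fun h =>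
    Complex.normSq_pos.2 (sub_ne_zero.2 h.symm)
  have hcont : ∀ w : ℂ, 0 ≤ w.im → ContinuousAt (cayleyInv p) w := fun w hw =>
    (continuousAt_const.mul (continuousAt_id.sub continuousAt_const)).div
      (continuousAt_id.add continuousAt_const) (add_I_ne_zero hw)
  let e : PartialEquiv ℂ ℂ :=
    { toFun := cayley p
      invFun := cayleyInv p
      source := D.carrier
      target := {z : ℂ | 0 ≤ z.im} \ (Complex.ofReal '' range a)
      map_source' := by
        intro z hz
        obtain ⟨h1, h2, h3⟩ := (hcarrier z).1 hz
        refine ⟨?_, ?_⟩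
        · change 0 ≤ (cayley p z).im
          rw [cayley_im hp1]
          have : ‖z‖ ^ 2 ≤ 1 := pow_le_one₀ (norm_nonneg _) h1
          exact div_nonneg (by linarith) (hns h2).le
        · rintro ⟨_, ⟨i, rfl⟩, hi⟩
          rw [← cayleyInv_cayley hp0 h2, ← hi, hinv] at h3
          exact h3 i rfl
      map_target' := by
        rintro w ⟨hw, hwa⟩
        refine (hcarrier _).2 ⟨?_, cayleyInv_ne hp0 (add_I_ne_zero hw), fun i hi => ?_⟩
        · have := (norm_cayleyInv hp1 hw).1
          nlinarith [norm_nonneg (cayleyInv p w)]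
        · apply hwa
          refine ⟨a i, ⟨i, rfl⟩, ?_⟩
          rw [← hcay, ← hi, cayley_cayleyInv hp0 (add_I_ne_zero hw)]
      left_inv' := fun z hz => cayleyInv_cayley hp0 ((hcarrier z).1 hz).2.1
      right_inv' := fun w hw => cayley_cayleyInv hp0 (add_I_ne_zero hw.1) }
  have hball : ∀ z ∈ ball (0 : ℂ) 1, z ≠ p := by
    rintro z hz rfl
    rw [mem_ball_zero_iff, hp1] at hz
    exact lt_irrefl _ hz
  have hdiff : ∀ z, z ≠ p → DifferentiableAt ℂ (cayley p) z := fun z hz =>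
    ((differentiableAt_const _).mul ((differentiableAt_const _).add differentiableAt_id)).div
      ((differentiableAt_const _).sub differentiableAt_id) (sub_ne_zero.2 hz.symm)
  have hdiff' : ∀ w : ℂ, 0 < w.im → DifferentiableAt ℂ (cayleyInv p) w := fun w hw =>
    DifferentiableAt.fun_div (c := fun w : ℂ => p * (w - Complex.I))
      (d := fun w : ℂ => w + Complex.I)
      ((differentiableAt_id.sub_const _).const_mul _) (differentiableAt_id.add_const _)
      (add_I_ne_zero hw.le)
  let M : ConformalModel D :=
    { punctures := range a
      finite_punctures := finite_range a
      chart := e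
      chart_source := rfl
      chart_target := rfl
      continuousOn_chart := fun z hz =>
        (hdiff z ((hcarrier z).1 hz).2.1).continuousAt.continuousWithinAt
      continuousOn_chart_symm := fun w hw => (hcont w hw.1).continuousWithinAt
      image_interior := by
        apply Subset.antisymm
        · rintro _ ⟨z, hz, rfl⟩
          change 0 < (cayley p z).im
          rw [cayley_im hp1]
          rw [mem_ball_zero_iff] at hz
          have : ‖z‖ ^ 2 < 1 := pow_lt_one₀ (norm_nonneg _) hz two_ne_zero
          exact div_pos (by linarith) (hns (hball z (by simpa using hz)))
        · intro w hw
          have hw' : 0 < w.im := hw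
          refine ⟨cayleyInv p w, ?_, cayley_cayleyInv hp0 (add_I_ne_zero hw'.le)⟩
          rw [mem_ball_zero_iff]
          have := (norm_cayleyInv hp1 hw'.le).2 hw'
          nlinarith [norm_nonneg (cayleyInv p w)]
      holomorphic_chart := fun z hz => (hdiff z (hball z hz)).differentiableWithinAt
      holomorphic_chart_symm := fun w hw => (hdiff' w hw).differentiableWithinAt
      ρ := modelFactor a
      ρ_smooth := contDiffOn_modelFactor
      ρ_pos := fun z _ => modelFactor_pos z
      ρ_conj := modelFactor_conj }
  refine ⟨a, M, hmono, rfl, rfl, fun i => ?_, tendsto_cayleyInv_cobounded p⟩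
  have := (hcont (a i) (by simp)).tendsto
  rw [hinv] at this
  exact this

/-! ### Half annuli as flat strips -/

/-- The conformal map from a strip to a half annulus around `c`. -/
def stripMap (c k s : ℝ) (w : ℂ) : ℂ := c + s * k * Complex.exp (s * Real.pi * w)

/-- The logarithmic coordinate on an annulus around `c`. -/
def annulusCoord (c k s : ℝ) (z : ℂ) : ℝ := s * Real.log (‖z - c‖ / k) / Real.pi

/-- The half annulus which is the image of a strip. -/
def halfAnnulus (c k s : ℝ) (γ : EReal) : Set ℂ :=
  {z | 0 ≤ z.im ∧ z ≠ c ∧ 0 < annulusCoord c k s z ∧ (annulusCoord c k s z : EReal) < γ}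

section Strip

variable {c k s : ℝ}

theorem norm_stripMap_sub (hk : 0 < k) (hs : s = 1 ∨ s = -1) (w : ℂ) :
    ‖stripMap c k s w - c‖ = k * Real.exp (s * Real.pi * w.re) := by
  rw [stripMap, add_sub_cancel_left, norm_mul, norm_mul, Complex.norm_exp, Complex.norm_real,
    Complex.norm_real, Real.norm_of_nonneg hk.le]
  have h1 : ‖s‖ = 1 := by rcases hs with rfl | rfl <;> norm_num
  have h2 : ((s : ℂ) * Real.pi * w).re = s * Real.pi * w.re := by simp
  rw [h1, one_mul, h2]

theorem annulusCoord_stripMap (hk : 0 < k) (hs : s = 1 ∨ s = -1) (w : ℂ) :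
    annulusCoord c k s (stripMap c k s w) = w.re := by
  rw [annulusCoord, norm_stripMap_sub hk hs, mul_div_cancel_left₀ _ hk.ne', Real.log_exp]
  have := Real.pi_pos.ne'
  rcases hs with rfl | rfl <;> field_simp

theorem stripMap_im (hs : s = 1 ∨ s = -1) (w : ℂ) : (stripMap c k s w).im =
    k * Real.exp (s * Real.pi * w.re) * Real.sin (Real.pi * w.im) := by
  have h2 : ((s : ℂ) * Real.pi * w).re = s * Real.pi * w.re := by simp
  have h3 : ((s : ℂ) * Real.pi * w).im = s * (Real.pi * w.im) := by simp; ring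
  have h4 : ((s : ℂ) * k * Complex.exp (s * Real.pi * w)).im =
      s * k * (Complex.exp (s * Real.pi * w)).im := by
    rw [← Complex.ofReal_mul, Complex.im_ofReal_mul]
  rw [stripMap, Complex.add_im, Complex.ofReal_im, zero_add, h4, Complex.exp_im, h2, h3]
  rcases hs with rfl | rfl
  · simp [mul_assoc]
  · rw [neg_one_mul (Real.pi * w.im), Real.sin_neg]
    ring

/-- The inverse is the logarithm: the modulus gives the real part, and the argument divided by `π`
the imaginary part `y`. For `s = -1` the sign in front of the exponential turns the angle `-π y`
into `π (1 - y)`, which keeps the image in the upper half plane. -/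
theorem bijOn_stripMap (hk : 0 < k) (hs : s = 1 ∨ s = -1) (γ : EReal) :
    BijOn (stripMap c k s) (flatStrip γ) (halfAnnulus c k s γ) := by
  have hpi := Real.pi_pos
  refine ⟨?_, ?_, ?_⟩
  · rintro w ⟨h1, h2, h3, h4⟩
    refine ⟨?_, ?_, ?_, ?_⟩
    · rw [stripMap_im hs]
      have : 0 ≤ Real.sin (Real.pi * w.im) :=
        Real.sin_nonneg_of_nonneg_of_le_pi (by positivity) (by nlinarith)
      positivity
    · intro h
      have := norm_stripMap_sub (c := c) hk hs w
      rw [h, sub_self, norm_zero] at this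
      have h5 : 0 < k * Real.exp (s * Real.pi * w.re) := by positivity
      exact h5.ne this
    · rwa [annulusCoord_stripMap hk hs]
    · rwa [annulusCoord_stripMap hk hs]
  · rintro w ⟨h1, h2, h3, h4⟩ w' ⟨h1', h2', h3', h4'⟩ h
    have hre : w.re = w'.re := by
      rw [← annulusCoord_stripMap (c := c) hk hs w, h, annulusCoord_stripMap hk hs]
    have hs0 : (s : ℂ) ≠ 0 := by rcases hs with rfl | rfl <;> norm_num
    have hk0 : (k : ℂ) ≠ 0 := by exact_mod_cast hk.ne'
    have h5 := mul_left_cancel₀ (mul_ne_zero hs0 hk0) (add_left_cancel h)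
    obtain ⟨m, hm⟩ := Complex.exp_eq_exp_iff_exists_int.1 h5
    have h6 := congrArg Complex.im hm
    have e1 : ((s : ℂ) * Real.pi * w).im = s * (Real.pi * w.im) := by simp; ring
    have e2 : ((s : ℂ) * Real.pi * w').im = s * (Real.pi * w'.im) := by simp; ring
    have e3 : ((m : ℂ) * (2 * Real.pi * Complex.I)).im = m * (2 * Real.pi) := by simp
    rw [Complex.add_im, e1, e2, e3] at h6
    have h7 : s * (w.im - w'.im) = 2 * m := by
      have : Real.pi * (s * (w.im - w'.im)) = Real.pi * (2 * m) := by linarith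
      exact mul_left_cancel₀ hpi.ne' this
    have h8 : |s * (w.im - w'.im)| ≤ 1 := by
      rcases hs with rfl | rfl <;> rw [abs_le] <;> constructor <;> linarith
    rw [h7, abs_le] at h8
    have h9 : m = 0 := by
      have a1 : (-1 : ℝ) < m := by linarith
      have a2 : (m : ℝ) < 1 := by linarith
      have a3 : -1 < m := by exact_mod_cast a1
      have a4 : m < 1 := by exact_mod_cast a2
      omega
    rw [h9, Int.cast_zero, mul_zero] at h7
    refine Complex.ext hre ?_
    rcases hs with rfl | rfl <;> linarith
  · rintro z ⟨h1, h2, h3, h4⟩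
    have hz : z - c ≠ 0 := sub_ne_zero.2 h2
    have hz' : 0 < ‖z - c‖ := norm_pos_iff.2 hz
    have him : 0 ≤ (z - c).im := by simpa using h1
    have ha0 : 0 ≤ Complex.arg (z - c) := Complex.arg_nonneg_iff.2 him
    have ha1 := Complex.arg_le_pi (z - c)
    set x := annulusCoord c k s z with hx
    have hkx : (k : ℂ) * Complex.exp (s * Real.pi * x) = ‖z - c‖ := by
      have : k * Real.exp (s * Real.pi * x) = ‖z - c‖ := by
        have e : s * Real.pi * x = Real.log (‖z - c‖ / k) := by
          rw [hx, annulusCoord]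
          rcases hs with rfl | rfl <;> field_simp
        rw [e, Real.exp_log (by positivity), mul_div_cancel₀ _ hk.ne']
      rw [← this]
      push_cast
      rfl
    have hpi0 : (Real.pi : ℂ) ≠ 0 := by exact_mod_cast hpi.ne'
    rcases hs with rfl | rfl
    · refine ⟨⟨x, Complex.arg (z - c) / Real.pi⟩, ⟨h3, h4, div_nonneg ha0 hpi.le,
        (div_le_one hpi).2 ha1⟩, ?_⟩
      have e : ((1 : ℝ) : ℂ) * Real.pi * (⟨x, Complex.arg (z - c) / Real.pi⟩ : ℂ) =
          ((1 : ℝ) : ℂ) * Real.pi * x + Complex.arg (z - c) * Complex.I := by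
        rw [Complex.mk_eq_add_mul_I]
        push_cast
        field_simp
      rw [stripMap, e, Complex.exp_add, mul_assoc, ← mul_assoc (k : ℂ), hkx,
        Complex.norm_mul_exp_arg_mul_I]
      simp
    · refine ⟨⟨x, 1 - Complex.arg (z - c) / Real.pi⟩, ⟨h3, h4,
        sub_nonneg.2 ((div_le_one hpi).2 ha1), by
          have := div_nonneg ha0 hpi.le
          simp only
          linarith⟩, ?_⟩
      have e : ((-1 : ℝ) : ℂ) * Real.pi * (⟨x, 1 - Complex.arg (z - c) / Real.pi⟩ : ℂ) =
          ((-1 : ℝ) : ℂ) * Real.pi * x + (Complex.arg (z - c) * Complex.I -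
            Real.pi * Complex.I) := by
        rw [Complex.mk_eq_add_mul_I]
        push_cast
        field_simp
        ring
      rw [stripMap, e, Complex.exp_add, mul_assoc, ← mul_assoc (k : ℂ), hkx, Complex.exp_sub,
        Complex.exp_pi_mul_I, mul_div_assoc', Complex.norm_mul_exp_arg_mul_I]
      push_cast
      ring

theorem uniqueDiffOn_flatStrip (γ : EReal) : UniqueDiffOn ℝ (flatStrip γ) := by
  intro w hw
  have hconv : Convex ℝ {x : ℝ | (x : EReal) < γ} := by
    refine OrdConnected.convex ⟨fun x _ y hy z hz => ?_⟩
    exact lt_of_le_of_lt (EReal.coe_le_coe_iff.2 hz.2) hy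
  have h : Convex ℝ (flatStrip γ) := by
    have e : flatStrip γ = Complex.reLm ⁻¹' (Ioi 0 ∩ {x : ℝ | (x : EReal) < γ}) ∩
        Complex.imLm ⁻¹' Icc 0 1 := by
      ext w
      simp [flatStrip, and_assoc]
    rw [e]
    exact (((convex_Ioi 0).inter hconv).linear_preimage _).inter
      ((convex_Icc 0 1).linear_preimage _)
  refine (uniqueDiffOn_convex h ⟨⟨w.re, 1 / 2⟩, ?_⟩) w hw
  have ho : IsOpen {w : ℂ | 0 < w.re ∧ (w.re : EReal) < γ ∧ 0 < w.im ∧ w.im < 1} :=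
    (isOpen_lt continuous_const Complex.continuous_re).inter
      ((isOpen_lt (continuous_coe_real_ereal.comp Complex.continuous_re) continuous_const).inter
        ((isOpen_lt continuous_const Complex.continuous_im).inter
          (isOpen_lt Complex.continuous_im continuous_const)))
  refine mem_interior.2 ⟨_, fun z hz => ⟨hz.1, hz.2.1, hz.2.2.1.le, hz.2.2.2.le⟩, ho,
    hw.1, hw.2.1, ?_, ?_⟩ <;> norm_num

theorem hasDerivAt_stripMap (hs : s = 1 ∨ s = -1) (w : ℂ) :
    HasDerivAt (stripMap c k s) (k * Real.pi * Complex.exp (s * Real.pi * w)) w := by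
  have h := (((hasDerivAt_id w).const_mul ((s : ℂ) * Real.pi)).cexp.const_mul
    ((s : ℂ) * k)).const_add (c : ℂ)
  refine h.congr_deriv ?_
  rcases hs with rfl | rfl
  · simp only [id]
    push_cast
    ring
  · simp only [id]
    push_cast
    ring

theorem contDiff_stripMap : ContDiff ℝ ∞ (stripMap c k s) := by
  have : ContDiff ℝ ∞ (fun w : ℂ => Complex.exp (s * Real.pi * w)) :=
    Complex.contDiff_exp.comp (contDiff_const.mul contDiff_id)
  exact contDiff_const.add (contDiff_const.mul this)

/-- The derivative has modulus `π * ‖z - c‖`, the inverse of the conformal factor, and the imaginary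
part is a positive multiple of `sin (π y)`. -/
theorem isStripIsometry_stripMap {N : ℕ} {D : MarkedDisk N} (M : ConformalModel D) (hk : 0 < k)
    (hs : s = 1 ∨ s = -1) {γ : EReal}
    (hρ : ∀ z ∈ halfAnnulus c k s γ, M.ρ z = (Real.pi * ‖z - c‖)⁻¹) :
    M.IsStripIsometry γ (halfAnnulus c k s γ) (stripMap c k s) where
  bijOn := bijOn_stripMap hk hs γ
  smooth := contDiff_stripMap.contDiffOn
  isometric := by
    intro w hw v
    have h1 := (hasDerivAt_stripMap (c := c) (k := k) hs w).hasFDerivAt.restrictScalars ℝ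
    have hF := hρ _ ((bijOn_stripMap hk hs γ).1 hw)
    rw [h1.hasFDerivWithinAt.fderivWithin (uniqueDiffOn_flatStrip γ w hw), hF,
      norm_stripMap_sub hk hs]
    have h2 : ((s : ℂ) * Real.pi * w).re = s * Real.pi * w.re := by simp
    have hpi := Real.pi_pos
    have h3 : ‖(k : ℂ) * Real.pi * Complex.exp (s * Real.pi * w)‖ =
        Real.pi * (k * Real.exp (s * Real.pi * w.re)) := by
      rw [norm_mul, norm_mul, Complex.norm_exp, h2, Complex.norm_real, Complex.norm_real,
        Real.norm_of_nonneg hk.le, Real.norm_of_nonneg hpi.le]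
      ring
    have h4 : 0 < Real.pi * (k * Real.exp (s * Real.pi * w.re)) := by positivity
    simp only [ContinuousLinearMap.coe_restrictScalars', ContinuousLinearMap.toSpanSingleton_apply,
      smul_eq_mul]
    rw [norm_mul, h3]
    field_simp
  boundary := by
    rintro w ⟨h1, h2, h3, h4⟩
    have hpi := Real.pi_pos
    have h5 : k * Real.exp (s * Real.pi * w.re) ≠ 0 := by positivity
    rw [stripMap_im hs, mul_eq_zero, or_iff_right h5]
    constructor
    · intro h
      rcases eq_or_lt_of_le h3 with h6 | h6
      · exact Or.inl h6.symm
      rcases eq_or_lt_of_le h4 with h7 | h7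
      · exact Or.inr h7
      exact absurd h (Real.sin_pos_of_pos_of_lt_pi (by positivity) (by nlinarith)).ne'
    · rintro (h | h) <;> simp [h]

theorem tendsto_stripMap_inner (k : ℝ) :
    Tendsto (stripMap c k (-1)) (comap Complex.re atTop) (𝓝 c) := by
  have h1 : Tendsto (fun w : ℂ => Complex.exp (((-1 : ℝ) : ℂ) * Real.pi * w))
      (comap Complex.re atTop) (𝓝 0) := by
    rw [tendsto_zero_iff_norm_tendsto_zero]
    have h2 : Tendsto (fun x : ℝ => Real.exp (-(Real.pi * x))) atTop (𝓝 0) :=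
      Real.tendsto_exp_neg_atTop_nhds_zero.comp (tendsto_id.const_mul_atTop Real.pi_pos)
    refine (h2.comp tendsto_comap).congr fun w => ?_
    rw [Complex.norm_exp]
    simp
  have h3 := (h1.const_mul (((-1 : ℝ) : ℂ) * k)).const_add (c : ℂ)
  rwa [mul_zero, add_zero] at h3

theorem tendsto_stripMap_outer (hk : 0 < k) :
    Tendsto (stripMap c k 1) (comap Complex.re atTop) (Bornology.cobounded ℂ) := by
  rw [← tendsto_norm_atTop_iff_cobounded]
  have h2 : Tendsto (fun x : ℝ => k * Real.exp (1 * Real.pi * x) - ‖(c : ℂ)‖) atTop atTop := by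
    refine tendsto_atTop_add_const_right _ _ (Tendsto.const_mul_atTop hk
      (Real.tendsto_exp_atTop.comp (tendsto_id.const_mul_atTop ?_)))
    rw [one_mul]
    exact Real.pi_pos
  refine tendsto_atTop_mono (fun w => ?_) (h2.comp tendsto_comap)
  have h3 := norm_sub_le (stripMap c k 1 w) (c : ℂ)
  rw [norm_stripMap_sub hk (Or.inl rfl)] at h3
  simp only [Function.comp_apply]
  linarith

end Strip

/-! ### The pieces of the decomposition -/

section Pieces

variable {n : ℕ}

section Defs

variable (a : Fin n → ℝ)

/-- The closed upper half plane without the points `a i`. -/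
def puncturedHalfPlane : Set ℂ := {z | 0 ≤ z.im} \ (Complex.ofReal '' range a)

/-- The piece of a vertex. -/
def vertexPiece (S : Finset (Fin n)) : Set ℂ :=
  {z | z ∈ puncturedHalfPlane a ∧ ‖z - clusterCenter a S‖ ≤ innerRadius a S ∧
    ∀ T, IsCluster a T → T ⊂ S → 1 ≤ invOuterRadius a T * ‖z - clusterCenter a T‖}

/-- The piece of a leg. -/
def annulusPiece (I : Finset (Fin n)) : Set ℂ :=
  {z | z ∈ puncturedHalfPlane a ∧ innerRadius a I < ‖z - clusterCenter a I‖ ∧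
    invOuterRadius a I * ‖z - clusterCenter a I‖ < 1}

/-- The piece of a leg together with the arcs where it is attached to the pieces of vertices. -/
def closedAnnulusPiece (I : Finset (Fin n)) : Set ℂ :=
  {z | z ∈ puncturedHalfPlane a ∧ innerRadius a I ≤ ‖z - clusterCenter a I‖ ∧
    invOuterRadius a I * ‖z - clusterCenter a I‖ ≤ 1}

end Defs

variable {a : Fin n → ℝ}

theorem annulusPiece_subset (I : Finset (Fin n)) : annulusPiece a I ⊆ closedAnnulusPiece a I :=
  fun _ h => ⟨h.1, h.2.1.le, h.2.2.le⟩

/-- The disk comparisons are applied to the cluster `{i}`: according to whether it is inside `I` or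
disjoint from it, `a i` is the center of `I`, inside the inner circle, or outside the outer one. -/
theorem notMem_range_of_mem_annulus (ha : Function.Injective a) {I : Finset (Fin n)}
    (hI : IsCluster a I) {z : ℂ} (hz : z ≠ clusterCenter a I)
    (h1 : innerRadius a I ≤ ‖z - clusterCenter a I‖)
    (h2 : invOuterRadius a I * ‖z - clusterCenter a I‖ ≤ 1) : z ∉ Complex.ofReal '' range a := by
  rintro ⟨_, ⟨i, rfl⟩, rfl⟩
  have hpos : 0 < ‖(a i : ℂ) - clusterCenter a I‖ := norm_pos_iff.2 (sub_ne_zero.2 hz)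
  have hc : clusterCenter a {i} = a i := by
    obtain ⟨j, hj, e⟩ := exists_clusterCenter_eq (a := a) (Finset.singleton_nonempty i)
    rw [e, Finset.mem_singleton.1 hj]
  have h3 : invOuterRadius a {i} * ‖(a i : ℂ) - clusterCenter a {i}‖ = 0 := by
    rw [hc, sub_self, norm_zero, mul_zero]
  rcases (isCluster_singleton i).trichotomy ha hI with h | h | h
  · rcases h.eq_or_ssubset with h | h
    · rw [← h, hc, sub_self, norm_zero] at hpos
      exact lt_irrefl _ hpos
    · have := norm_sub_center_lt_of_ssubset ha (Finset.singleton_nonempty i) h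
        (z := a i) (by rw [h3]; norm_num)
      linarith
  · have h4 : I = {i} := (Finset.subset_singleton_iff.1 h).resolve_left hI.1.ne_empty
    rw [h4, hc, sub_self, norm_zero] at hpos
    exact lt_irrefl _ hpos
  · have := lt_norm_sub_center_of_disjoint ha (Finset.singleton_nonempty i) hI.1 h
      (z := a i) (by rw [h3]; norm_num)
    linarith

theorem ne_center_of_mem_puncturedHalfPlane {I : Finset (Fin n)} (hI : I.Nonempty) {z : ℂ}
    (hz : z ∈ puncturedHalfPlane a) : z ≠ clusterCenter a I := by
  rintro rfl
  obtain ⟨i, _, e⟩ := exists_clusterCenter_eq (a := a) hI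
  exact hz.2 ⟨a i, ⟨i, rfl⟩, by rw [e]⟩

theorem invOuterRadius_mul_norm_le_half (ha : Function.Injective a) {S : Finset (Fin n)}
    (hS : IsCluster a S) {z : ℂ} (hz : ‖z - clusterCenter a S‖ ≤ innerRadius a S) :
    invOuterRadius a S * ‖z - clusterCenter a S‖ ≤ 1 / 2 := by
  have h1 := innerRadius_mul_invOuterRadius_le ha hS
  have h2 := mul_le_mul_of_nonneg_left hz (invOuterRadius_nonneg ha hS.1)
  linarith [mul_comm (innerRadius a S) (invOuterRadius a S)]

/-- Pieces of different vertices are disjoint. -/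
theorem eq_of_mem_vertexPiece (ha : Function.Injective a) {S S' : Finset (Fin n)}
    (hS : IsCluster a S) (hS' : IsCluster a S') {z : ℂ} (h : z ∈ vertexPiece a S)
    (h' : z ∈ vertexPiece a S') : S = S' := by
  have h1 := invOuterRadius_mul_norm_le_half ha hS h.2.1
  have h2 := invOuterRadius_mul_norm_le_half ha hS' h'.2.1
  by_contra hne
  rcases hS.trichotomy ha hS' with h3 | h3 | h3
  · linarith [h'.2.2 S hS (h3.ssubset_of_ne hne)]
  · linarith [h.2.2 S' hS' (h3.ssubset_of_ne (Ne.symm hne))]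
  · linarith [lt_norm_sub_center_of_disjoint ha hS.1 hS'.1 h3 (z := z) (by linarith)]

/-- The closed pieces of different legs are disjoint. -/
theorem eq_of_mem_closedAnnulusPiece (ha : Function.Injective a) {I J : Finset (Fin n)}
    (hI : IsCluster a I) (hJ : IsCluster a J) {z : ℂ} (h : z ∈ closedAnnulusPiece a I)
    (h' : z ∈ closedAnnulusPiece a J) : I = J := by
  by_contra hne
  have h1 := norm_nonneg (z - clusterCenter a I)
  have h2 := norm_nonneg (z - clusterCenter a J)
  rcases hI.trichotomy ha hJ with h3 | h3 | h3
  · have := norm_sub_center_lt_of_ssubset ha hI.1 (h3.ssubset_of_ne hne) (z := z)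
      (by linarith [h.2.2])
    linarith [h'.2.1]
  · have := norm_sub_center_lt_of_ssubset ha hJ.1 (h3.ssubset_of_ne (Ne.symm hne)) (z := z)
      (by linarith [h'.2.2])
    linarith [h.2.1]
  · linarith [lt_norm_sub_center_of_disjoint ha hI.1 hJ.1 h3 (z := z) (by linarith [h.2.2]),
      h'.2.2]

/-- The piece of a vertex meets the closed piece of a leg only in an arc of its boundary. -/
theorem boundary_of_mem_vertexPiece (ha : Function.Injective a) {S I : Finset (Fin n)}
    (hS : IsCluster a S) (hI : IsCluster a I) {z : ℂ} (h : z ∈ vertexPiece a S)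
    (h' : z ∈ closedAnnulusPiece a I) :
    (I = S ∧ ‖z - clusterCenter a I‖ = innerRadius a I) ∨
      (I ≠ Finset.univ ∧ clusterParent a I = S ∧
        invOuterRadius a I * ‖z - clusterCenter a I‖ = 1) := by
  have h1 := invOuterRadius_mul_norm_le_half ha hS h.2.1
  rcases hI.trichotomy ha hS with h3 | h3 | h3
  · rcases h3.eq_or_ssubset with h3 | h3
    · refine Or.inl ⟨h3, le_antisymm ?_ h'.2.1⟩
      rw [h3]
      exact h.2.1
    · have hu : I ≠ Finset.univ := by
        rintro rfl
        exact h3.2 (Finset.subset_univ _)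
      obtain ⟨h4, h5, h6⟩ := clusterParent_spec ha hI hu
      refine Or.inr ⟨hu, ?_, le_antisymm h'.2.2 (h.2.2 I hI h3)⟩
      by_contra hne
      have h7 := h.2.2 _ h4 ((h6 S hS h3).ssubset_of_ne hne)
      have h8 := invOuterRadius_mul_lt_of_ssubset ha h4 hI.1 h5 (z := z) (by linarith [h'.2.2])
      linarith
  · rcases h3.eq_or_ssubset with h3 | h3
    · refine Or.inl ⟨h3.symm, le_antisymm ?_ h'.2.1⟩
      rw [← h3]
      exact h.2.1
    · have := norm_sub_center_lt_of_ssubset ha hS.1 h3 (z := z) (by linarith)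
      linarith [h'.2.1, norm_nonneg (z - clusterCenter a I)]
  · linarith [lt_norm_sub_center_of_disjoint ha hI.1 hS.1 h3 (z := z) (by linarith [h'.2.2])]

/-- The pieces cover the surface. -/
theorem exists_piece [NeZero n] {z : ℂ} (hz : z ∈ puncturedHalfPlane a) :
    (∃ S, (IsCluster a S ∧ 1 < S.card) ∧ z ∈ vertexPiece a S) ∨
      ∃ I, IsCluster a I ∧ z ∈ annulusPiece a I := by
  classical
  -- Take a smallest cluster whose open outer disk contains `z`; the cluster of all points is a
  -- candidate because its inverse outer radius is 0. The point is then in the annulus of `I` or, by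
  -- minimality, in the vertex piece of `I`.
  obtain ⟨I, hI, hmin⟩ := (Finset.univ.filter fun I =>
    IsCluster a I ∧ invOuterRadius a I * ‖z - clusterCenter a I‖ < 1).exists_min_image
    Finset.card ⟨Finset.univ, by
      simp only [Finset.mem_filter, Finset.mem_univ, true_and]
      exact ⟨isCluster_univ, by rw [invOuterRadius_univ, zero_mul]; exact one_pos⟩⟩
  simp only [Finset.mem_filter, Finset.mem_univ, true_and] at hI hmin
  rcases lt_or_ge (innerRadius a I) ‖z - clusterCenter a I‖ with h | h
  · exact Or.inr ⟨I, hI.1, hz, h, hI.2⟩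
  · refine Or.inl ⟨I, ⟨hI.1, ?_⟩, hz, h, fun T hT hTI => ?_⟩
    · by_contra hc
      obtain ⟨i, hi⟩ := Finset.card_eq_one.1 (le_antisymm (not_lt.1 hc) (Finset.card_pos.2 hI.1.1))
      have : innerRadius a I = 0 := by rw [hi, innerRadius, clusterDiam_singleton, mul_zero]
      rw [this] at h
      exact ne_center_of_mem_puncturedHalfPlane hI.1.1 hz (sub_eq_zero.1 (norm_le_zero_iff.1 h))
    · by_contra! hc
      exact absurd (hmin T ⟨hT, hc⟩) (not_le.2 (Finset.card_lt_card hTI))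

/-- The top of the outer boundary circle belongs to the piece, since all disks of smaller clusters
lie well inside. -/
theorem vertexPiece_nonempty (ha : Function.Injective a) {S : Finset (Fin n)} (hc : 1 < S.card) :
    (vertexPiece a S).Nonempty := by
  have hR := innerRadius_pos ha hc
  have hn : ‖(clusterCenter a S + innerRadius a S * Complex.I : ℂ) - clusterCenter a S‖ =
      innerRadius a S := by
    rw [add_sub_cancel_left, norm_mul, Complex.norm_I, Complex.norm_real, mul_one,
      Real.norm_of_nonneg hR.le]
  refine ⟨clusterCenter a S + innerRadius a S * Complex.I, ⟨?_, ?_⟩, hn.le, fun T hT hTS => ?_⟩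
  · simpa using hR.le
  · rintro ⟨x, _, hx⟩
    have := congrArg Complex.im hx
    simp only [Complex.ofReal_im, Complex.add_im, Complex.mul_im, Complex.ofReal_re,
      Complex.I_im, Complex.I_re, mul_one, mul_zero, add_zero, zero_add] at this
    exact hR.ne this
  · by_contra! h
    have := norm_sub_center_lt_of_ssubset ha hT.1 hTS (by linarith)
    rw [hn] at this
    linarith

theorem isClosed_vertexPiece (S : Finset (Fin n)) :
    IsClosed ((Subtype.val : puncturedHalfPlane a → ℂ) ⁻¹' vertexPiece a S) := by
  have h : ((Subtype.val : puncturedHalfPlane a → ℂ) ⁻¹' vertexPiece a S) =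
      {z : puncturedHalfPlane a | ‖(z : ℂ) - clusterCenter a S‖ ≤ innerRadius a S} ∩
      ⋂ T, ⋂ (_ : IsCluster a T), ⋂ (_ : T ⊂ S),
        {z : puncturedHalfPlane a | 1 ≤ invOuterRadius a T * ‖(z : ℂ) - clusterCenter a T‖} := by
    ext z
    simp [vertexPiece]
  rw [h]
  refine (isClosed_le (by fun_prop) (by fun_prop)).inter (isClosed_iInter fun T =>
    isClosed_iInter fun _ => isClosed_iInter fun _ => isClosed_le (by fun_prop) (by fun_prop))

theorem isClosed_closedAnnulusPiece (I : Finset (Fin n)) :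
    IsClosed ((Subtype.val : puncturedHalfPlane a → ℂ) ⁻¹' closedAnnulusPiece a I) := by
  have h : ((Subtype.val : puncturedHalfPlane a → ℂ) ⁻¹' closedAnnulusPiece a I) =
      {z : puncturedHalfPlane a | innerRadius a I ≤ ‖(z : ℂ) - clusterCenter a I‖} ∩
        {z : puncturedHalfPlane a | invOuterRadius a I * ‖(z : ℂ) - clusterCenter a I‖ ≤ 1} := by
    ext z
    simp [closedAnnulusPiece]
  rw [h]
  exact (isClosed_le (by fun_prop) (by fun_prop)).inter (isClosed_le (by fun_prop) (by fun_prop))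

end Pieces

/-! ### The projection to the tree -/

section Projection

variable {n : ℕ}

section Defs

variable (a : Fin n → ℝ)

/-- The direction of a leg: outwards, except for the legs of single points. -/
def legSign : ClusterEdge a ⊕ Fin (n + 1) → ℝ :=
  Sum.elim (fun _ => 1) (Fin.lastCases 1 fun _ => -1)

/-- The radius of the circle where a leg starts. -/
def legRadius : ClusterEdge a ⊕ Fin (n + 1) → ℝ :=
  Sum.elim (fun e => innerRadius a e.1)
    (Fin.lastCases (innerRadius a Finset.univ) fun i => (invOuterRadius a {i})⁻¹)

/-- The length coordinate on a leg. -/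
def legCoord (l : ClusterEdge a ⊕ Fin (n + 1)) (z : ℂ) : ℝ :=
  annulusCoord (clusterCenter a (legCluster a l)) (legRadius a l) (legSign a l) z

/-- The length of a leg. -/
def legLength : ClusterEdge a ⊕ Fin (n + 1) → EReal :=
  Sum.elim (fun e => (clusterLength a e.1 : EReal)) fun _ => ⊤

end Defs

variable {a : Fin n → ℝ}

@[simp] theorem legSign_last : legSign a (.inr (Fin.last n)) = 1 := by simp [legSign]

@[simp] theorem legSign_castSucc (i : Fin n) : legSign a (.inr i.castSucc) = -1 := by
  simp [legSign]

@[simp] theorem legRadius_last :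
    legRadius a (.inr (Fin.last n)) = innerRadius a Finset.univ := by simp [legRadius]

@[simp] theorem legRadius_castSucc (i : Fin n) :
    legRadius a (.inr i.castSucc) = (invOuterRadius a {i})⁻¹ := by
  simp [legRadius]

theorem legSign_eq (l : ClusterEdge a ⊕ Fin (n + 1)) : legSign a l = 1 ∨ legSign a l = -1 := by
  rcases l with e | i
  · exact Or.inl rfl
  · induction i using Fin.lastCases with
    | last => simp
    | cast i => simp

theorem one_lt_card_univ (hn : 2 ≤ n) : 1 < (Finset.univ : Finset (Fin n)).card := by
  rw [Finset.card_univ, Fintype.card_fin]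
  omega

theorem legRadius_pos (hn : 2 ≤ n) (ha : StrictMono a) (l : ClusterEdge a ⊕ Fin (n + 1)) :
    0 < legRadius a l := by
  rcases l with e | i
  · exact innerRadius_pos ha.injective e.2.1.2
  · induction i using Fin.lastCases with
    | last =>
      rw [legRadius_last]
      exact innerRadius_pos ha.injective (one_lt_card_univ hn)
    | cast i =>
      rw [legRadius_castSucc]
      exact inv_pos.2 (invOuterRadius_pos ha.injective (Finset.singleton_nonempty i)
        (singleton_ne_univ hn i))

theorem legCoord_inl (e : ClusterEdge a) (z : ℂ) : legCoord a (.inl e) z =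
    Real.log (‖z - clusterCenter a e.1‖ / innerRadius a e.1) / Real.pi := by
  rw [legCoord, annulusCoord]
  simp [legSign, legRadius]

theorem legCoord_last (z : ℂ) : legCoord a (.inr (Fin.last n)) z =
    Real.log (‖z - clusterCenter a Finset.univ‖ / innerRadius a Finset.univ) / Real.pi := by
  rw [legCoord, annulusCoord]
  simp

theorem legCoord_castSucc (i : Fin n) (z : ℂ) : legCoord a (.inr i.castSucc) z =
    -Real.log (invOuterRadius a {i} * ‖z - clusterCenter a {i}‖) / Real.pi := by
  rw [legCoord, annulusCoord]
  simp [mul_comm]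

theorem innerRadius_singleton (i : Fin n) : innerRadius a {i} = 0 := by
  rw [innerRadius, clusterDiam_singleton, mul_zero]

/-- Reading off the position on a leg from the coordinate. -/
theorem legCoord_iff (hn : 2 ≤ n) (ha : StrictMono a) (l : ClusterEdge a ⊕ Fin (n + 1)) {z : ℂ}
    (hz : z ≠ clusterCenter a (legCluster a l)) :
    ((0 < legCoord a l z ∧ (legCoord a l z : EReal) < legLength a l) ↔
      innerRadius a (legCluster a l) < ‖z - clusterCenter a (legCluster a l)‖ ∧
      invOuterRadius a (legCluster a l) * ‖z - clusterCenter a (legCluster a l)‖ < 1) ∧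
    ((0 ≤ legCoord a l z ∧ (legCoord a l z : EReal) ≤ legLength a l) ↔
      innerRadius a (legCluster a l) ≤ ‖z - clusterCenter a (legCluster a l)‖ ∧
      invOuterRadius a (legCluster a l) * ‖z - clusterCenter a (legCluster a l)‖ ≤ 1) := by
  have hr : 0 < ‖z - clusterCenter a (legCluster a l)‖ := norm_pos_iff.2 (sub_ne_zero.2 hz)
  have hpi := Real.pi_pos
  rcases l with e | i
  · rw [legCoord_inl]
    simp only [legCluster_inl] at hr ⊢
    have hR := innerRadius_pos ha.injective e.2.1.2
    have hκ := invOuterRadius_pos ha.injective e.2.1.1.1 e.2.2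
    simp only [legLength, Sum.elim_inl, clusterLength, EReal.coe_lt_coe_iff, EReal.coe_le_coe_iff]
    set r := ‖z - clusterCenter a e.1‖
    have h1 : 0 < r / innerRadius a e.1 := by positivity
    have h2 : 0 < 1 / (innerRadius a e.1 * invOuterRadius a e.1) := by positivity
    have e1 : r / innerRadius a e.1 < 1 / (innerRadius a e.1 * invOuterRadius a e.1) ↔
        invOuterRadius a e.1 * r < 1 := by
      rw [div_lt_div_iff₀ hR (by positivity)]
      constructor <;> intro h <;> nlinarith
    have e2 : r / innerRadius a e.1 ≤ 1 / (innerRadius a e.1 * invOuterRadius a e.1) ↔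
        invOuterRadius a e.1 * r ≤ 1 := by
      rw [div_le_div_iff₀ hR (by positivity)]
      constructor <;> intro h <;> nlinarith
    constructor
    · rw [div_lt_div_iff_of_pos_right hpi, Real.log_lt_log_iff h1 h2, e1, lt_div_iff₀ hpi, zero_mul,
        Real.log_pos_iff h1.le, one_lt_div hR]
    · rw [div_le_div_iff_of_pos_right hpi, Real.log_le_log_iff h1 h2, e2, le_div_iff₀ hpi, zero_mul,
        Real.log_nonneg_iff h1, one_le_div hR]
  · induction i using Fin.lastCases with
    | last =>
      rw [legCoord_last]
      simp only [legCluster_last] at hr ⊢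
      have hR := innerRadius_pos ha.injective (one_lt_card_univ hn)
      set r := ‖z - clusterCenter a Finset.univ‖
      have h1 : 0 < r / innerRadius a Finset.univ := by positivity
      simp only [legLength, Sum.elim_inr, invOuterRadius_univ, zero_mul, EReal.coe_lt_top, le_top,
        and_true, zero_lt_one, zero_le_one]
      constructor
      · rw [lt_div_iff₀ hpi, zero_mul, Real.log_pos_iff h1.le, one_lt_div hR]
      · rw [le_div_iff₀ hpi, zero_mul, Real.log_nonneg_iff h1, one_le_div hR]
    | cast i =>
      rw [legCoord_castSucc]
      simp only [legCluster_castSucc] at hr ⊢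
      have hκ := invOuterRadius_pos ha.injective (Finset.singleton_nonempty i)
        (singleton_ne_univ hn i)
      rw [innerRadius_singleton]
      set r := ‖z - clusterCenter a {i}‖
      have h1 : 0 < invOuterRadius a {i} * r := by positivity
      simp only [legLength, Sum.elim_inr, EReal.coe_lt_top, le_top, and_true, hr, hr.le, true_and]
      constructor
      · rw [lt_div_iff₀ hpi, zero_mul, neg_pos, Real.log_neg_iff h1]
      · rw [le_div_iff₀ hpi, zero_mul, neg_nonneg, Real.log_nonpos_iff h1.le]

theorem annulusPiece_eq_halfAnnulus (hn : 2 ≤ n) (ha : StrictMono a)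
    (l : ClusterEdge a ⊕ Fin (n + 1)) : annulusPiece a (legCluster a l) =
      halfAnnulus (clusterCenter a (legCluster a l)) (legRadius a l) (legSign a l)
        (legLength a l) := by
  have : NeZero n := ⟨by omega⟩
  have hI := isCluster_legCluster l
  ext z
  constructor
  · rintro ⟨h1, h2, h3⟩
    have hz := ne_center_of_mem_puncturedHalfPlane hI.1 h1
    exact ⟨h1.1, hz, ((legCoord_iff hn ha l hz).1.2 ⟨h2, h3⟩)⟩
  · rintro ⟨h1, hz, h2⟩
    obtain ⟨h3, h4⟩ := (legCoord_iff hn ha l hz).1.1 h2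
    exact ⟨⟨h1, notMem_range_of_mem_annulus ha.injective hI hz h3.le h4.le⟩, h3, h4⟩

theorem legCoord_mem_of_mem_closedAnnulusPiece (hn : 2 ≤ n) (ha : StrictMono a)
    {l : ClusterEdge a ⊕ Fin (n + 1)} {z : ℂ} (hz : z ∈ closedAnnulusPiece a (legCluster a l)) :
    0 ≤ legCoord a l z ∧ (legCoord a l z : EReal) ≤ legLength a l := by
  have : NeZero n := ⟨by omega⟩
  exact (legCoord_iff hn ha l
    (ne_center_of_mem_puncturedHalfPlane (isCluster_legCluster l).1 hz.1)).2.2 hz.2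

theorem continuousOn_legCoord (hn : 2 ≤ n) (ha : StrictMono a) (l : ClusterEdge a ⊕ Fin (n + 1)) :
    ContinuousOn (legCoord a l) (puncturedHalfPlane a) := by
  have : NeZero n := ⟨by omega⟩
  have hk := legRadius_pos hn ha l
  refine ContinuousOn.div_const (ContinuousOn.mul continuousOn_const
    (ContinuousOn.log (by fun_prop) fun z hz => ?_)) _
  exact div_ne_zero (norm_ne_zero_iff.2 (sub_ne_zero.2
    (ne_center_of_mem_puncturedHalfPlane (isCluster_legCluster l).1 hz))) hk.ne'

variable (hn : 2 ≤ n) (ha : StrictMono a)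

/-- The point of the tree with given coordinate on a leg. -/
def treePoint (l : ClusterEdge a ⊕ Fin (n + 1)) (t : ℝ) : (clusterTree hn ha).Space :=
  open Classical in
  if h : 0 ≤ t ∧ (t : EReal) ≤ legLength a l then (clusterTree hn ha).legPoint l ⟨t, h⟩
  else (clusterTree hn ha).vertexPoint (rootVertex a hn)

open Classical in
/-- The projection of the surface to the tree. -/
def treeProjection (z : ℂ) : (clusterTree hn ha).Space :=
  if h : ∃ v : ClusterVertex a, z ∈ vertexPiece a v.1 then (clusterTree hn ha).vertexPoint h.choose
  else if h : ∃ l, z ∈ closedAnnulusPiece a (legCluster a l) then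
    treePoint hn ha h.choose (legCoord a h.choose z)
  -- A default value, not reached on the surface because the pieces cover it.
  else (clusterTree hn ha).vertexPoint (rootVertex a hn)

theorem treePoint_eq {l : ClusterEdge a ⊕ Fin (n + 1)} {t : ℝ}
    (h : 0 ≤ t ∧ (t : EReal) ≤ legLength a l) :
    treePoint hn ha l t = (clusterTree hn ha).legPoint l ⟨t, h⟩ := dif_pos h

theorem treeProjection_of_mem_vertexPiece {v : ClusterVertex a} {z : ℂ}
    (hz : z ∈ vertexPiece a v.1) :
    treeProjection hn ha z = (clusterTree hn ha).vertexPoint v := by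
  have h : ∃ v : ClusterVertex a, z ∈ vertexPiece a v.1 := ⟨v, hz⟩
  have e : h.choose = v := Subtype.ext
    (eq_of_mem_vertexPiece ha.injective h.choose.2.1 v.2.1 h.choose_spec hz)
  rw [treeProjection, dif_pos h, e]

theorem legPoint_eq_vertexPoint_start (l : ClusterEdge a ⊕ Fin (n + 1)) {t : ℝ} (h0 : t = 0)
    (h : 0 ≤ t ∧ (t : EReal) ≤ legLength a l) :
    (clusterTree hn ha).legPoint l ⟨t, h⟩ =
      (clusterTree hn ha).vertexPoint ((clusterTree hn ha).start l) :=
  Quot.sound (MetricRibbonTree.Glue.atStart (Γ := clusterTree hn ha) l ⟨t, h⟩ h0)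

theorem legPoint_eq_vertexPoint_tgt (e : ClusterEdge a) {t : ℝ} (h0 : t = clusterLength a e.1)
    (h : 0 ≤ t ∧ (t : EReal) ≤ legLength a (.inl e)) :
    (clusterTree hn ha).legPoint (.inl e) ⟨t, h⟩ =
      (clusterTree hn ha).vertexPoint (clusterTgt ha e) :=
  Quot.sound (MetricRibbonTree.Glue.atEnd (Γ := clusterTree hn ha) e ⟨t, h⟩
    (congrArg ((↑) : ℝ → EReal) h0))

/-- On an arc shared with a vertex piece, the coordinate is 0 or the full length, and the gluing
relation identifies that end of the leg with the vertex. This is the compatibility needed for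
continuity. -/
theorem treeProjection_of_mem_closedAnnulusPiece {l : ClusterEdge a ⊕ Fin (n + 1)} {z : ℂ}
    (hz : z ∈ closedAnnulusPiece a (legCluster a l)) :
    treeProjection hn ha z = treePoint hn ha l (legCoord a l z) := by
  have : NeZero n := ⟨by omega⟩
  have hpi := Real.pi_pos
  by_cases hv : ∃ v : ClusterVertex a, z ∈ vertexPiece a v.1
  · obtain ⟨v, hv⟩ := hv
    have hmem := legCoord_mem_of_mem_closedAnnulusPiece hn ha hz
    rw [treeProjection_of_mem_vertexPiece hn ha hv, treePoint_eq hn ha hmem]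
    symm
    rcases boundary_of_mem_vertexPiece ha.injective v.2.1 (isCluster_legCluster l) hv hz with
      ⟨h1, h2⟩ | ⟨h1, h2, h3⟩
    · rcases l with e | i
      · have h3 : legCoord a (.inl e) z = 0 := by
          rw [legCluster_inl] at h2
          rw [legCoord_inl, h2, div_self (innerRadius_pos ha.injective e.2.1.2).ne', Real.log_one,
            zero_div]
        rw [legPoint_eq_vertexPoint_start hn ha _ h3]
        exact congrArg _ (Subtype.ext h1)
      · induction i using Fin.lastCases with
        | last =>
          have h3 : legCoord a (.inr (Fin.last n)) z = 0 := by
            rw [legCluster_last] at h2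
            rw [legCoord_last, h2,
              div_self (innerRadius_pos ha.injective (one_lt_card_univ hn)).ne', Real.log_one,
              zero_div]
          rw [legPoint_eq_vertexPoint_start hn ha _ h3]
          refine congrArg _ (Subtype.ext ?_)
          rw [← h1, legCluster_last]
          exact congrArg Subtype.val (clusterAtt_last hn ha)
        | cast i =>
          have := v.2.2
          rw [← h1, legCluster_castSucc, Finset.card_singleton] at this
          exact absurd this (lt_irrefl 1)
    · rcases l with e | i
      · have h4 : legCoord a (.inl e) z = clusterLength a e.1 := by
          rw [legCluster_inl] at h3
          have hR := innerRadius_pos ha.injective e.2.1.2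
          have hκ := invOuterRadius_pos ha.injective e.2.1.1.1 e.2.2
          rw [legCoord_inl, clusterLength]
          congr 2
          rw [div_eq_div_iff hR.ne' (by positivity), ← h3]
          ring
        refine (legPoint_eq_vertexPoint_tgt hn ha _ h4 hmem).trans ?_
        exact congrArg _ (Subtype.ext h2)
      · induction i using Fin.lastCases with
        | last => exact absurd legCluster_last h1
        | cast i =>
          have h4 : legCoord a (.inr i.castSucc) z = 0 := by
            rw [legCluster_castSucc] at h3
            rw [legCoord_castSucc, h3, Real.log_one, neg_zero, zero_div]
          rw [legPoint_eq_vertexPoint_start hn ha _ h4]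
          refine congrArg _ (Subtype.ext ?_)
          rw [← h2, legCluster_castSucc]
          exact clusterAtt_castSucc hn ha i
  · have h : ∃ l, z ∈ closedAnnulusPiece a (legCluster a l) := ⟨l, hz⟩
    have e : h.choose = l := legCluster_injective hn (eq_of_mem_closedAnnulusPiece ha.injective
      (isCluster_legCluster _) (isCluster_legCluster l) h.choose_spec hz)
    rw [treeProjection, dif_neg hv, dif_pos h, e]

/-- The vertex pieces and the closed annulus pieces form a finite cover by relatively closed sets,
on each of which the projection is given by a continuous formula. -/
theorem continuousOn_treeProjection :
    ContinuousOn (treeProjection hn ha) (puncturedHalfPlane a) := by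
  have : NeZero n := ⟨by omega⟩
  rw [continuousOn_iff_continuous_domRestrict]
  let f : ClusterVertex a ⊕ (ClusterEdge a ⊕ Fin (n + 1)) → Set (puncturedHalfPlane a) :=
    Sum.elim (fun v => Subtype.val ⁻¹' vertexPiece a v.1)
      (fun l => Subtype.val ⁻¹' closedAnnulusPiece a (legCluster a l))
  refine (locallyFinite_of_finite f).continuous ?_ ?_ ?_
  · refine eq_univ_of_forall fun z => ?_
    rcases exists_piece z.2 with ⟨S, hS, h⟩ | ⟨I, hI, h⟩
    · exact mem_iUnion.2 ⟨.inl ⟨S, hS⟩, h⟩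
    · obtain ⟨l, rfl⟩ := exists_legCluster_eq hI
      exact mem_iUnion.2 ⟨.inr l, annulusPiece_subset _ h⟩
  · rintro (v | l)
    · exact isClosed_vertexPiece _
    · exact isClosed_closedAnnulusPiece _
  · rintro (v | l)
    · exact continuousOn_const.congr fun z hz => treeProjection_of_mem_vertexPiece hn ha hz
    · rw [continuousOn_iff_continuous_domRestrict]
      have h1 : ∀ z : f (.inr l), 0 ≤ legCoord a l z ∧ (legCoord a l z : EReal) ≤ legLength a l :=
        fun z => legCoord_mem_of_mem_closedAnnulusPiece hn ha z.2
      have h2 : Continuous fun z : f (.inr l) => legCoord a l (z : ℂ) :=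
        (continuousOn_iff_continuous_domRestrict.1 (continuousOn_legCoord hn ha l)).comp
          continuous_subtype_val
      have h3 : Continuous fun z : f (.inr l) => (clusterTree hn ha).legPoint l ⟨_, h1 z⟩ :=
        continuous_quot_mk.comp (continuous_inr.comp (continuous_sigmaMk.comp
          (h2.subtype_mk h1)))
      refine h3.congr fun z => ?_
      have h4 := treeProjection_of_mem_closedAnnulusPiece hn ha (l := l) (z := z) z.2
      rw [treePoint_eq hn ha (h1 z)] at h4
      exact h4.symm

/-- The isometric chart of the piece of a leg. -/
def legChart (a : Fin n → ℝ) (l : ClusterEdge a ⊕ Fin (n + 1)) : ℂ → ℂ :=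
  stripMap (clusterCenter a (legCluster a l)) (legRadius a l) (legSign a l)

theorem bijOn_legChart (hn : 2 ≤ n) (ha : StrictMono a) (l : ClusterEdge a ⊕ Fin (n + 1)) :
    BijOn (legChart a l) (flatStrip (legLength a l)) (annulusPiece a (legCluster a l)) := by
  rw [annulusPiece_eq_halfAnnulus hn ha]
  exact bijOn_stripMap (legRadius_pos hn ha l) (legSign_eq l) _

theorem treeProjection_legChart {l : ClusterEdge a ⊕ Fin (n + 1)} {w : ℂ}
    (hw : w ∈ flatStrip (legLength a l)) :
    treeProjection hn ha (legChart a l w) =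
      (clusterTree hn ha).legPoint l ⟨w.re, hw.1.le, hw.2.1.le⟩ := by
  have h1 : legCoord a l (legChart a l w) = w.re :=
    annulusCoord_stripMap (legRadius_pos hn ha l) (legSign_eq l) w
  rw [treeProjection_of_mem_closedAnnulusPiece hn ha
    (annulusPiece_subset _ ((bijOn_legChart hn ha l).1 hw)), h1,
    treePoint_eq hn ha ⟨hw.1.le, hw.2.1.le⟩]

/-- The pieces of the decomposition. -/
def treePiece : (clusterTree hn ha).Stratum → Set ℂ :=
  Sum.elim (fun v : ClusterVertex a => vertexPiece a v.1) fun l => annulusPiece a (legCluster a l)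

theorem iUnion_treePiece : ⋃ ν, treePiece hn ha ν = puncturedHalfPlane a := by
  have : NeZero n := ⟨by omega⟩
  apply Subset.antisymm
  · refine iUnion_subset ?_
    rintro (v | l)
    · exact fun z hz => hz.1
    · exact fun z hz => hz.1
  · intro z hz
    rcases exists_piece hz with ⟨S, hS, h⟩ | ⟨I, hI, h⟩
    · exact mem_iUnion.2 ⟨.inl ⟨S, hS⟩, h⟩
    · obtain ⟨l, rfl⟩ := exists_legCluster_eq hI
      exact mem_iUnion.2 ⟨.inr l, h⟩

theorem treeProjection_image (ν : (clusterTree hn ha).Stratum) :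
    treeProjection hn ha '' treePiece hn ha ν = (clusterTree hn ha).stratumSet ν := by
  rcases ν with v | l
  · change treeProjection hn ha '' vertexPiece a v.1 = {(clusterTree hn ha).vertexPoint v}
    have hne := vertexPiece_nonempty ha.injective v.2.2
    refine Subset.antisymm ?_ ?_
    · rintro _ ⟨z, hz, rfl⟩
      exact treeProjection_of_mem_vertexPiece hn ha hz
    · rintro _ rfl
      obtain ⟨z, hz⟩ := hne
      exact ⟨z, hz, treeProjection_of_mem_vertexPiece hn ha hz⟩
  · change treeProjection hn ha '' annulusPiece a (legCluster a l) = _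
    refine (congrArg _ (bijOn_legChart hn ha l).image_eq.symm).trans (Subset.antisymm ?_ ?_)
    · rintro _ ⟨_, ⟨w, hw, rfl⟩, rfl⟩
      exact ⟨_, hw.1, hw.2.1, treeProjection_legChart hn ha hw⟩
    · rintro _ ⟨x, h1, h2, rfl⟩
      have hw : (⟨x.1, 0⟩ : ℂ) ∈ flatStrip (legLength a l) := ⟨h1, h2, le_rfl, zero_le_one⟩
      exact ⟨_, ⟨_, hw, rfl⟩, treeProjection_legChart hn ha hw⟩

theorem isStripIsometry_legChart (hn : 2 ≤ n) (ha : StrictMono a) {D : MarkedDisk (n + 1)} (M : ConformalModel D)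
    (hM : M.ρ = modelFactor a) (l : ClusterEdge a ⊕ Fin (n + 1)) :
    M.IsStripIsometry (legLength a l) (annulusPiece a (legCluster a l)) (legChart a l) := by
  have : NeZero n := ⟨by omega⟩
  rw [annulusPiece_eq_halfAnnulus hn ha]
  refine isStripIsometry_stripMap M (legRadius_pos hn ha l) (legSign_eq l) fun z hz => ?_
  have hpos : 0 < ‖z - clusterCenter a (legCluster a l)‖ := norm_pos_iff.2 (sub_ne_zero.2 hz.2.1)
  rw [← annulusPiece_eq_halfAnnulus hn ha] at hz
  rw [hM, modelFactor, logFactor_eq_neg_log ha.injective (isCluster_legCluster l) hz.2.2.le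
    (by linarith [hz.2.1]), Real.exp_neg, Real.exp_log hpos, mul_inv, div_eq_inv_mul]

end Projection

/-! ### Paths of bounded speed -/

/-- In `Y` there is a smooth path from `x` to `y` of Euclidean speed at most `L`. -/
def JoinedWithSpeed (Y : Set ℂ) (L : ℝ) (x y : ℂ) : Prop :=
  ∃ c : ℝ → ℂ, ContDiff ℝ 1 c ∧ MapsTo c (Icc 0 1) Y ∧ c 0 = x ∧ c 1 = y ∧
    ∀ s ∈ Icc (0 : ℝ) 1, ‖deriv c s‖ ≤ L

namespace JoinedWithSpeed

variable {Y : Set ℂ} {L L' : ℝ} {x y z : ℂ}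

theorem symm (h : JoinedWithSpeed Y L x y) : JoinedWithSpeed Y L y x := by
  obtain ⟨c, h1, h2, h3, h4, h5⟩ := h
  have hmem : ∀ s ∈ Icc (0 : ℝ) 1, 1 - s ∈ Icc (0 : ℝ) 1 := fun s hs =>
    ⟨by linarith [hs.2], by linarith [hs.1]⟩
  refine ⟨fun s => c (1 - s), h1.comp (contDiff_const.sub contDiff_id), fun s hs => h2 (hmem s hs),
    by simp [h4], by simp [h3], fun s hs => ?_⟩
  rw [deriv_comp_const_sub, norm_neg]
  exact h5 _ (hmem s hs)

theorem mono (h : JoinedWithSpeed Y L x y) (hL : L ≤ L') : JoinedWithSpeed Y L' x y := by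
  obtain ⟨c, h1, h2, h3, h4, h5⟩ := h
  exact ⟨c, h1, h2, h3, h4, fun s hs => (h5 s hs).trans hL⟩

/-- Each path is reparametrized by the smooth transition on its half of the time interval, so it is
constant during the other half and the sum of the two minus `y` is a `C¹` concatenation. The factor
depends only on the derivative of the transition. -/
theorem exists_trans : ∃ K : ℝ, 0 < K ∧ ∀ (Y : Set ℂ) (L L' : ℝ) (x y z : ℂ), 0 ≤ L → 0 ≤ L' →
    JoinedWithSpeed Y L x y → JoinedWithSpeed Y L' y z →
      JoinedWithSpeed Y (K * (L + L')) x z := by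
  have hτ : ContDiff ℝ 1 Real.smoothTransition := Real.smoothTransition.contDiff
  obtain ⟨K, hK⟩ := (isCompact_Icc (a := (-1 : ℝ)) (b := 2)).exists_bound_of_continuousOn
    (hτ.continuous_deriv le_rfl).continuousOn
  have hK0 : 0 ≤ K := (norm_nonneg _).trans (hK 0 (by norm_num))
  refine ⟨2 * K + 1, by linarith, ?_⟩
  rintro Y L L' x y z hL hL' ⟨c, h1, h2, h3, h4, h5⟩ ⟨d, g1, g2, g3, g4, g5⟩
  have hmem : ∀ t, Real.smoothTransition t ∈ Icc (0 : ℝ) 1 := fun t =>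
    ⟨Real.smoothTransition.nonneg t, Real.smoothTransition.le_one t⟩
  have hu : ∀ s, HasDerivAt (fun s : ℝ => Real.smoothTransition (2 * s))
      (deriv Real.smoothTransition (2 * s) * 2) s := fun s => by
    have a1 := (hτ.differentiable one_ne_zero (2 * s)).hasDerivAt
    have a2 := (hasDerivAt_id s).const_mul 2
    rw [mul_one] at a2
    exact a1.comp s a2
  have hv : ∀ s, HasDerivAt (fun s : ℝ => Real.smoothTransition (2 * s - 1))
      (deriv Real.smoothTransition (2 * s - 1) * 2) s := fun s => by
    have a1 := (hτ.differentiable one_ne_zero (2 * s - 1)).hasDerivAt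
    have a2 := ((hasDerivAt_id s).const_mul 2).sub_const 1
    rw [mul_one] at a2
    exact a1.comp s a2
  refine ⟨fun s => c (Real.smoothTransition (2 * s)) + (d (Real.smoothTransition (2 * s - 1)) - y),
    ?_, ?_, ?_, ?_, ?_⟩
  · exact (h1.comp (hτ.comp (contDiff_const.mul contDiff_id))).add
      ((g1.comp (hτ.comp ((contDiff_const.mul contDiff_id).sub contDiff_const))).sub contDiff_const)
  · intro s _
    rcases le_total (2 * s) 1 with h | h
    · have e : Real.smoothTransition (2 * s - 1) = 0 :=
        Real.smoothTransition.zero_of_nonpos (by linarith)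
      simp only [e, g3, sub_self, add_zero]
      exact h2 (hmem _)
    · have e : Real.smoothTransition (2 * s) = 1 := Real.smoothTransition.one_of_one_le h
      simp only [e, h4, add_sub_cancel]
      exact g2 (hmem _)
  · simp [h3, g3, Real.smoothTransition.zero_of_nonpos]
  · have e1 : Real.smoothTransition (2 * 1) = 1 :=
      Real.smoothTransition.one_of_one_le (by norm_num)
    have e2 : Real.smoothTransition (2 * 1 - 1) = 1 :=
      Real.smoothTransition.one_of_one_le (by norm_num)
    simp only [e1, e2, h4, g4, add_sub_cancel]
  · intro s hs
    have hc := (h1.differentiable one_ne_zero (Real.smoothTransition (2 * s))).hasDerivAt.scomp s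
      (hu s)
    have hd := (g1.differentiable one_ne_zero
      (Real.smoothTransition (2 * s - 1))).hasDerivAt.scomp s (hv s)
    have hcd := (hc.add (hd.sub_const y)).deriv
    have e : (fun s => c (Real.smoothTransition (2 * s)) +
      (d (Real.smoothTransition (2 * s - 1)) - y)) =
      (c ∘ fun s => Real.smoothTransition (2 * s)) +
        fun s => (d ∘ fun s => Real.smoothTransition (2 * s - 1)) s - y := rfl
    rw [e, hcd]
    refine (norm_add_le _ _).trans ?_
    rw [norm_smul, norm_smul, norm_mul, norm_mul, Real.norm_two]
    have b1 := hK (2 * s) ⟨by linarith [hs.1], by linarith [hs.2]⟩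
    have b2 := hK (2 * s - 1) ⟨by linarith [hs.1], by linarith [hs.2]⟩
    have b3 := h5 _ (hmem (2 * s))
    have b4 := g5 _ (hmem (2 * s - 1))
    have b5 : ‖deriv Real.smoothTransition (2 * s)‖ * 2 * ‖deriv c (Real.smoothTransition (2 * s))‖ ≤
        K * 2 * L := by gcongr
    have b6 : ‖deriv Real.smoothTransition (2 * s - 1)‖ * 2 *
        ‖deriv d (Real.smoothTransition (2 * s - 1))‖ ≤ K * 2 * L' := by gcongr
    linarith

theorem innerDist_le (h : JoinedWithSpeed Y L x y) {ρ : ℂ → ℝ} {P : ℝ} (hρ0 : ∀ z, 0 ≤ ρ z)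
    (hρ : ∀ z ∈ Y, ρ z ≤ P) : innerDist ρ Y x y ≤ ENNReal.ofReal (P * L) := by
  obtain ⟨c, h1, h2, h3, h4, h5⟩ := h
  refine (iInf₂_le c ⟨h1.contDiffOn, h2, h3, h4⟩).trans ?_
  have hb : ∀ s ∈ Icc (0 : ℝ) 1,
      ENNReal.ofReal (ρ (c s) * ‖derivWithin c (Icc 0 1) s‖) ≤ ENNReal.ofReal (P * L) := by
    intro s hs
    apply ENNReal.ofReal_le_ofReal
    have e : derivWithin c (Icc 0 1) s = deriv c s :=
      (h1.differentiable one_ne_zero s).derivWithin (uniqueDiffOn_Icc zero_lt_one s hs)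
    rw [e]
    exact mul_le_mul (hρ _ (h2 hs)) (h5 s hs) (norm_nonneg _) ((hρ0 _).trans (hρ _ (h2 hs)))
  calc pathLength ρ c ≤ ∫⁻ _ in Icc (0 : ℝ) 1, ENNReal.ofReal (P * L) :=
        MeasureTheory.setLIntegral_mono' measurableSet_Icc hb
    _ = ENNReal.ofReal (P * L) := by
        rw [MeasureTheory.setLIntegral_const, Real.volume_Icc]
        simp

end JoinedWithSpeed

theorem le_innerDist {ρ : ℂ → ℝ} {Y : Set ℂ} {m : ℝ} (hm : 0 ≤ m) (hρ : ∀ z ∈ Y, m ≤ ρ z) (x y : ℂ) :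
    ENNReal.ofReal (m * ‖y - x‖) ≤ innerDist ρ Y x y := by
  refine le_iInf₂ fun c hc => ?_
  obtain ⟨h1, h2, rfl, rfl⟩ := hc
  rw [ENNReal.ofReal_mul hm, ofReal_norm]
  calc ENNReal.ofReal m * ‖c 1 - c 0‖ₑ
      ≤ ENNReal.ofReal m * ∫⁻ s in Icc (0 : ℝ) 1, ‖derivWithin c (Icc 0 1) s‖ₑ := by
        gcongr
        exact enorm_sub_le_lintegral_derivWithin_Icc_of_contDiffOn_Icc h1 zero_le_one
    _ = ∫⁻ s in Icc (0 : ℝ) 1, ENNReal.ofReal m * ‖derivWithin c (Icc 0 1) s‖ₑ :=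
        (MeasureTheory.lintegral_const_mul' _ _ ENNReal.ofReal_ne_top).symm
    _ ≤ pathLength ρ c := by
        refine MeasureTheory.setLIntegral_mono' measurableSet_Icc fun s hs => ?_
        rw [← ofReal_norm, ← ENNReal.ofReal_mul hm]
        exact ENNReal.ofReal_le_ofReal
          (mul_le_mul_of_nonneg_right (hρ _ (h2 hs)) (norm_nonneg _))

theorem joinedWithSpeed_vertical {Y : Set ℂ} {x : ℂ} {t : ℝ} (ht : 0 ≤ t)
    (hY : ∀ s ∈ Icc (0 : ℝ) t, x + s * Complex.I ∈ Y) :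
    JoinedWithSpeed Y t x (x + t * Complex.I) := by
  have hd : ∀ s : ℝ, HasDerivAt (fun s : ℝ => x + (s * t : ℝ) * Complex.I) (t * Complex.I) s :=
    fun s => by
      have h := (((hasDerivAt_id s).mul_const t).ofReal_comp.mul_const Complex.I).const_add x
      simpa using h
  refine ⟨fun s => x + (s * t : ℝ) * Complex.I, ?_, fun s hs => ?_, by simp, by simp, fun s _ => ?_⟩
  · exact contDiff_const.add ((Complex.ofRealCLM.contDiff.comp
      (contDiff_id.mul contDiff_const)).mul contDiff_const)
  · exact hY _ ⟨mul_nonneg hs.1 ht, by nlinarith [hs.2]⟩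
  · rw [(hd s).deriv, norm_mul, Complex.norm_I, mul_one, Complex.norm_real, Real.norm_of_nonneg ht]

theorem joinedWithSpeed_arc {Y : Set ℂ} {c R α β : ℝ} (hR : 0 ≤ R) (hα : α ∈ Icc 0 Real.pi)
    (hβ : β ∈ Icc 0 Real.pi)
    (hY : ∀ θ ∈ Icc (0 : ℝ) Real.pi, (c : ℂ) + R * Complex.exp (θ * Complex.I) ∈ Y) :
    JoinedWithSpeed Y (R * Real.pi) (c + R * Complex.exp (α * Complex.I))
      (c + R * Complex.exp (β * Complex.I)) := by
  have hd : ∀ s : ℝ, HasDerivAt (fun s : ℝ => (c : ℂ) +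
      R * Complex.exp ((α + s * (β - α) : ℝ) * Complex.I))
      (R * (Complex.exp ((α + s * (β - α) : ℝ) * Complex.I) * ((β - α : ℝ) * Complex.I))) s :=
    fun s => by
      have h1 : HasDerivAt (fun s : ℝ => α + s * (β - α)) (β - α) s := by
        simpa using ((hasDerivAt_id s).mul_const (β - α)).const_add α
      exact ((h1.ofReal_comp.mul_const Complex.I).cexp.const_mul (R : ℂ)).const_add (c : ℂ)
  refine ⟨fun s => c + R * Complex.exp ((α + s * (β - α) : ℝ) * Complex.I), ?_, fun s hs => ?_,
    by simp, by simp, fun s _ => ?_⟩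
  · refine contDiff_const.add (contDiff_const.mul (ContDiff.comp Complex.contDiff_exp ?_))
    exact (Complex.ofRealCLM.contDiff.comp
      (contDiff_const.add (contDiff_id.mul contDiff_const))).mul contDiff_const
  · refine hY _ ⟨?_, ?_⟩
    · nlinarith [hα.1, hβ.1, hs.1, hs.2, mul_nonneg hs.1 hβ.1,
        mul_nonneg (sub_nonneg.2 hs.2) hα.1]
    · nlinarith [mul_nonneg hs.1 (sub_nonneg.2 hβ.2),
        mul_nonneg (sub_nonneg.2 hs.2) (sub_nonneg.2 hα.2)]
  · rw [(hd s).deriv, norm_mul, norm_mul, norm_mul, Complex.norm_exp_ofReal_mul_I, Complex.norm_I,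
      Complex.norm_real, Complex.norm_real, Real.norm_of_nonneg hR, one_mul, mul_one]
    refine mul_le_mul_of_nonneg_left ?_ hR
    rw [Real.norm_eq_abs, abs_le]
    constructor <;> linarith [hα.1, hα.2, hβ.1, hβ.2]

/-! ### Geometry of the pieces of vertices -/

section VertexGeometry

variable {n : ℕ} {a : Fin n → ℝ}

theorem norm_sub_clusterCenter_singleton (i : Fin n) : ‖(a i : ℂ) - clusterCenter a {i}‖ = 0 := by
  obtain ⟨j, hj, e⟩ := exists_clusterCenter_eq (a := a) (Finset.singleton_nonempty i)
  rw [e, Finset.mem_singleton.1 hj, sub_self, norm_zero]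

/-- A puncture with index in `S` is the center of a one-point cluster below `S`, excluded by the
second hypothesis; the others are outside the doubled disk of `S`. -/
theorem notMem_range_of_bounds (ha : Function.Injective a) {S : Finset (Fin n)}
    (hS : IsCluster a S) (hc : 1 < S.card) {z : ℂ}
    (h1 : invOuterRadius a S * ‖z - clusterCenter a S‖ ≤ 2)
    (h2 : ∀ T, IsCluster a T → T ⊂ S → 0 < invOuterRadius a T * ‖z - clusterCenter a T‖) :
    z ∉ Complex.ofReal '' range a := by
  rintro ⟨_, ⟨i, rfl⟩, rfl⟩
  by_cases hi : i ∈ S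
  · have h3 := h2 {i} (isCluster_singleton i) (by
      refine (Finset.singleton_subset_iff.2 hi).ssubset_of_ne ?_
      rintro rfl
      rw [Finset.card_singleton] at hc
      exact lt_irrefl _ hc)
    rw [norm_sub_clusterCenter_singleton, mul_zero] at h3
    exact lt_irrefl _ h3
  · have h3 := lt_norm_sub_center_of_disjoint ha hS.1 (Finset.singleton_nonempty i)
      (Finset.disjoint_singleton_right.2 hi) h1
    rw [norm_sub_clusterCenter_singleton, mul_zero] at h3
    linarith

/-- The punctures are avoided automatically, so for paths in the piece only the inequalities on
distances have to be checked. -/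
theorem mem_vertexPiece_iff (ha : Function.Injective a) {S : Finset (Fin n)}
    (hS : IsCluster a S) (hc : 1 < S.card) {z : ℂ} : z ∈ vertexPiece a S ↔
      0 ≤ z.im ∧ ‖z - clusterCenter a S‖ ≤ innerRadius a S ∧
        ∀ T, IsCluster a T → T ⊂ S → 1 ≤ invOuterRadius a T * ‖z - clusterCenter a T‖ := by
  refine ⟨fun h => ⟨h.1.1, h.2⟩, fun h => ⟨⟨h.1, ?_⟩, h.2⟩⟩
  exact notMem_range_of_bounds ha hS hc
    (by linarith [invOuterRadius_mul_norm_le_half ha hS h.2.1])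
    fun T hT hTS => by linarith [h.2.2 T hT hTS]

/-- Points near the piece of a vertex. -/
theorem bounds_of_mem_ball (ha : Function.Injective a) {S : Finset (Fin n)}
    (hS : IsCluster a S) (hc : 1 < S.card) {z w : ℂ} (hz : z ∈ vertexPiece a S)
    (hw : w ∈ ball z (1 / (256 * 129 ^ n) * innerRadius a S)) :
    ‖w - clusterCenter a S‖ ≤ 3 * innerRadius a S ∧
      invOuterRadius a S * ‖w - clusterCenter a S‖ ≤ 1 ∧
      ∀ T, IsCluster a T → T ⊂ S → 1 / 2 ≤ invOuterRadius a T * ‖w - clusterCenter a T‖ := by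
  have hR := innerRadius_pos ha hc
  have hB : (1 : ℝ) ≤ 129 ^ n := one_le_pow₀ (by norm_num)
  rw [mem_ball, dist_eq_norm, div_mul_eq_mul_div, one_mul, lt_div_iff₀ (by positivity)] at hw
  have hw' : ‖w - z‖ ≤ innerRadius a S := by nlinarith [norm_nonneg (w - z)]
  have htri : ∀ c : ℝ, ‖w - c‖ ≤ ‖w - z‖ + ‖z - c‖ := fun c => norm_sub_le_norm_sub_add_norm_sub _ _ _
  have htri' : ∀ c : ℝ, ‖z - c‖ ≤ ‖w - z‖ + ‖w - c‖ := fun c => by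
    rw [norm_sub_rev w z]
    exact norm_sub_le_norm_sub_add_norm_sub _ _ _
  -- The radius of the ball is chosen so that, by comparability of scales, it changes the scaled
  -- distance to a child by at most `128 * 129 ^ n / (256 * 129 ^ n) = 1 / 2`.
  have hchild : ∀ T, IsCluster a T → T ⊂ S → clusterParent a T = S →
      1 / 2 ≤ invOuterRadius a T * ‖w - clusterCenter a T‖ := by
    intro T hT hTS hp
    have hu : T ≠ Finset.univ := by
      rintro rfl
      exact hTS.2 (Finset.subset_univ _)
    have h1 := invOuterRadius_mul_innerRadius_parent_le ha hT hu
    rw [hp] at h1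
    have hκ := invOuterRadius_pos ha hT.1 hu
    have h2 := hz.2.2 T hT hTS
    have h3 := mul_le_mul_of_nonneg_left (htri' (clusterCenter a T)) hκ.le
    have h4 : invOuterRadius a T * ‖w - z‖ ≤ 1 / 2 := by
      by_contra! h
      have h5 := mul_lt_mul_of_pos_left hw hκ
      nlinarith
    rw [mul_add] at h3
    linarith
  refine ⟨by linarith [htri (clusterCenter a S), hz.2.1], ?_, fun T hT hTS => ?_⟩
  · have h1 := innerRadius_mul_invOuterRadius_le ha hS
    have h2 := invOuterRadius_nonneg ha hS.1
    have h3 : invOuterRadius a S * ‖w - clusterCenter a S‖ ≤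
        invOuterRadius a S * (2 * innerRadius a S) :=
      mul_le_mul_of_nonneg_left (by linarith [htri (clusterCenter a S), hz.2.1]) h2
    nlinarith
  · obtain ⟨i, hi⟩ := hT.1
    -- Any smaller cluster lies in some child `J`; a point too close to it would be much too close
    -- to `J`.
    obtain ⟨J, hJ, hiJ, hJS, hp⟩ := exists_child ha hS hc (hTS.1 hi)
    rcases hT.trichotomy ha hJ with h | h | h
    · rcases h.eq_or_ssubset with rfl | h
      · exact hchild T hT hTS hp
      · by_contra! hlt
        have := invOuterRadius_mul_lt_of_ssubset ha hJ hT.1 h (z := w) (by linarith)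
        linarith [hchild J hJ hJS hp]
    · rcases h.eq_or_ssubset with rfl | h
      · exact hchild J hT hTS hp
      · have hu : J ≠ Finset.univ := by
          rintro rfl
          exact hJS.2 (Finset.subset_univ _)
        have := (clusterParent_spec ha hJ hu).2.2 T hT h
        rw [hp] at this
        exact absurd this hTS.2
    · exact absurd hiJ (Finset.disjoint_left.1 h hi)

theorem mem_ball_self_of_card (ha : Function.Injective a) {S : Finset (Fin n)} (hc : 1 < S.card)
    (z : ℂ) : z ∈ ball z (1 / (256 * 129 ^ n) * innerRadius a S) :=
  mem_ball_self (mul_pos (by positivity) (innerRadius_pos ha hc))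

theorem log_modelFactor_of_mem_ball (ha : Function.Injective a) {S : Finset (Fin n)}
    (hS : IsCluster a S) (hc : 1 < S.card) {z w : ℂ} (hz : z ∈ vertexPiece a S)
    (hw : w ∈ ball z (1 / (256 * 129 ^ n) * innerRadius a S)) :
    Real.log (modelFactor a w) =
      localPotential a S w + (-Real.log (innerRadius a S) - Real.log Real.pi) := by
  obtain ⟨_, h1, h2⟩ := bounds_of_mem_ball ha hS hc hz hw
  rw [log_modelFactor, logFactor_eq_localPotential ha hS hc h1 h2]
  ring

theorem modelFactor_eq_of_mem_vertexPiece (ha : Function.Injective a) {S : Finset (Fin n)}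
    (hS : IsCluster a S) (hc : 1 < S.card) {z : ℂ} (hz : z ∈ vertexPiece a S) :
    modelFactor a z = Real.exp (localPotential a S z) / (Real.pi * innerRadius a S) := by
  obtain ⟨_, h1, h2⟩ := bounds_of_mem_ball ha hS hc hz (mem_ball_self_of_card ha hc z)
  rw [modelFactor, logFactor_eq_localPotential ha hS hc h1 h2, Real.exp_add, Real.exp_neg,
    Real.exp_log (innerRadius_pos ha hc)]
  ring

/-- The conformal factor on the piece of a vertex. -/
theorem modelFactor_bounds (ha : Function.Injective a) {S : Finset (Fin n)}
    (hS : IsCluster a S) (hc : 1 < S.card) {A : ℝ}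
    (hA : ∀ z : ℂ, ‖z - clusterCenter a S‖ ≤ 3 * innerRadius a S →
      ScaledBound (localPotential a S) A (innerRadius a S) z) {z : ℂ} (hz : z ∈ vertexPiece a S) :
    Real.exp (-A) / (Real.pi * innerRadius a S) ≤ modelFactor a z ∧
      modelFactor a z ≤ Real.exp A / (Real.pi * innerRadius a S) := by
  have hR := innerRadius_pos ha hc
  have hpi := Real.pi_pos
  have h := abs_le.1 (hA z (by linarith [hz.2.1])).abs_le
  rw [modelFactor_eq_of_mem_vertexPiece ha hS hc hz]
  constructor
  · gcongr
    exact h.1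
  · gcongr
    exact h.2

/-- The Laplacian of `log ρ` is at most `2 * A / R ^ 2` in absolute value, while `ρ` is at least
`exp (-A) / (π * R)`; the scale `R` cancels. -/
theorem abs_gaussCurvature_le (ha : Function.Injective a) {S : Finset (Fin n)}
    (hS : IsCluster a S) (hc : 1 < S.card) {A : ℝ}
    (hA : ∀ z : ℂ, ‖z - clusterCenter a S‖ ≤ 3 * innerRadius a S →
      ScaledBound (localPotential a S) A (innerRadius a S) z) {z : ℂ} (hz : z ∈ vertexPiece a S) :
    |gaussCurvature (modelFactor a) z| ≤ 2 * A * Real.pi ^ 2 * Real.exp A ^ 2 := by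
  have hR := innerRadius_pos ha hc
  have hpi := Real.pi_pos
  have hb := hA z (by linarith [hz.2.1])
  have hlap : |Laplacian.laplacian (fun w => Real.log (modelFactor a w)) z| ≤
      2 * (A / innerRadius a S ^ 2) := by
    have e : (fun w => Real.log (modelFactor a w)) =ᶠ[𝓝 z] localPotential a S +
        fun _ => -Real.log (innerRadius a S) - Real.log Real.pi := by
      filter_upwards [isOpen_ball.mem_nhds (mem_ball_self_of_card ha hc z)] with w hw
      exact log_modelFactor_of_mem_ball ha hS hc hz hw
    rw [(InnerProductSpace.laplacian_congr_nhds e).eq_of_nhds,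
      ContDiffAt.laplacian_add hb.contDiff.contDiffAt contDiffAt_const,
      InnerProductSpace.laplacian_const, Pi.zero_apply, add_zero,
      InnerProductSpace.laplacian_eq_iteratedFDeriv_complexPlane]
    have h2 := hb.bound 2 le_rfl
    have h3 := (iteratedFDeriv ℝ 2 (localPotential a S) z).le_opNorm ![1, 1]
    have h4 := (iteratedFDeriv ℝ 2 (localPotential a S) z).le_opNorm ![Complex.I, Complex.I]
    simp only [Fin.prod_univ_two, Matrix.cons_val_zero, Matrix.cons_val_one, norm_one,
      Complex.norm_I, mul_one] at h3 h4
    refine (abs_add_le _ _).trans ?_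
    rw [Real.norm_eq_abs] at h3 h4
    linarith
  have hρ := (modelFactor_bounds ha hS hc hA hz).1
  have hρ2 : (Real.exp (-A) / (Real.pi * innerRadius a S)) ^ 2 ≤ modelFactor a z ^ 2 :=
    pow_le_pow_left₀ (by positivity) hρ 2
  have hA0 := hb.nonneg
  rw [gaussCurvature, abs_div, abs_neg, abs_of_pos (pow_pos (modelFactor_pos z) 2)]
  calc |Laplacian.laplacian (fun w => Real.log (modelFactor a w)) z| / modelFactor a z ^ 2
      ≤ 2 * (A / innerRadius a S ^ 2) / (Real.exp (-A) / (Real.pi * innerRadius a S)) ^ 2 :=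
        div_le_div₀ (by positivity) hlap (by positivity) hρ2
    _ = 2 * A * Real.pi ^ 2 * Real.exp A ^ 2 := by
        rw [Real.exp_neg]
        field_simp

/-- The radius from `injRadiusGE_of_bounds` is proportional to `R * modelFactor a z`, which is
bounded below independently of `R`. -/
theorem injRadiusGE_modelFactor (ha : Function.Injective a) {S : Finset (Fin n)}
    (hS : IsCluster a S) (hc : 1 < S.card) {A : ℝ} (hA1 : 1 ≤ A)
    (hA : ∀ z : ℂ, ‖z - clusterCenter a S‖ ≤ 3 * innerRadius a S →
      ScaledBound (localPotential a S) A (innerRadius a S) z) {z : ℂ} (hz : z ∈ vertexPiece a S) :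
    InjRadiusGE (modelFactor a) (Complex.ofReal '' range a)ᶜ z
      (min (1 / (256 * 129 ^ n) / 3) (1 / (128 * A)) * (Real.exp (-A) / Real.pi)) := by
  have hR := innerRadius_pos ha hc
  have hpi := Real.pi_pos
  have hcd := (hA z (by linarith [hz.2.1])).contDiff
  have hf : fderiv ℝ (fun w => localPotential a S w +
      (-Real.log (innerRadius a S) - Real.log Real.pi)) = fderiv ℝ (localPotential a S) :=
    funext fun w => fderiv_add_const _
  have h := injRadiusGE_of_bounds (ρ := modelFactor a) (W := (Complex.ofReal '' range a)ᶜ)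
    (z := z) (A := A) (R := innerRadius a S) (δ := 1 / (256 * 129 ^ n))
    (V := fun w => localPotential a S w + (-Real.log (innerRadius a S) - Real.log Real.pi))
    hR (by positivity) hA1 (modelFactor_pos z) (hcd.add contDiff_const)
    (fun w hw => log_modelFactor_of_mem_ball ha hS hc hz hw)
    (fun w hw => by
      rw [hf]
      exact (hA w (bounds_of_mem_ball ha hS hc hz hw).1).norm_fderiv_le)
    (fun w hw => by
      rw [hf]
      exact (hA w (bounds_of_mem_ball ha hS hc hz hw).1).norm_fderiv_fderiv_le)
    (fun w hw => by
      obtain ⟨_, h1, h2⟩ := bounds_of_mem_ball ha hS hc hz hw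
      exact notMem_range_of_bounds ha hS hc (by linarith) fun T hT hTS => by
        linarith [h2 T hT hTS])
  refine h.mono (mul_le_mul_of_nonneg_left ?_ ?_)
  · have := (modelFactor_bounds ha hS hc hA hz).1
    rw [div_le_iff₀ (by positivity)] at this
    rw [div_le_iff₀ hpi]
    linarith
  · exact le_min (by positivity) (by positivity)

/-- Moving up in the half plane increases the distance to every real center, so a vertical segment
starting outside the disks of the smaller clusters stays outside. -/
theorem norm_sub_ofReal_le_of_im_le {z : ℂ} {c t : ℝ} (hz : 0 ≤ z.im) (ht : 0 ≤ t) :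
    ‖z - c‖ ≤ ‖z + t * Complex.I - c‖ := by
  have h : ∀ w : ℂ, ‖w‖ ^ 2 = w.re ^ 2 + w.im ^ 2 := fun w => by
    rw [← Complex.normSq_eq_norm_sq, Complex.normSq_apply]
    ring
  refine (sq_le_sq₀ (norm_nonneg _) (norm_nonneg _)).1 ?_
  rw [h, h]
  simp
  nlinarith

/-- Each point of the piece of a vertex can be joined to the outer circle. -/
theorem exists_joinedWithSpeed_arc (ha : Function.Injective a) {S : Finset (Fin n)}
    (hS : IsCluster a S) (hc : 1 < S.card) {z : ℂ} (hz : z ∈ vertexPiece a S) :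
    ∃ α ∈ Icc 0 Real.pi, JoinedWithSpeed (vertexPiece a S) (innerRadius a S) z
      (clusterCenter a S + innerRadius a S * Complex.exp (α * Complex.I)) := by
  have hR := innerRadius_pos ha hc
  rw [mem_vertexPiece_iff ha hS hc] at hz
  obtain ⟨h1, h2, h3⟩ := hz
  set R := innerRadius a S with hRdef
  set c := clusterCenter a S with hcdef
  have hsq : ∀ w : ℂ, ‖w‖ ^ 2 = w.re ^ 2 + w.im ^ 2 := fun w => by
    rw [← Complex.normSq_eq_norm_sq, Complex.normSq_apply]
    ring
  have hz2 : (z.re - c) ^ 2 + z.im ^ 2 ≤ R ^ 2 := by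
    have := hsq (z - c)
    simp only [Complex.sub_re, Complex.ofReal_re, Complex.sub_im, Complex.ofReal_im,
      sub_zero] at this
    rw [← this]
    exact pow_le_pow_left₀ (norm_nonneg _) h2 2
  have h0 : 0 ≤ R ^ 2 - (z.re - c) ^ 2 := by nlinarith
  -- The height of the outer circle above the real part of `z`.
  set y := Real.sqrt (R ^ 2 - (z.re - c) ^ 2) with hy
  have hy2 : y ^ 2 = R ^ 2 - (z.re - c) ^ 2 := Real.sq_sqrt h0
  have hzy : z.im ≤ y := Real.le_sqrt_of_sq_le (by linarith)
  have hyR : y ≤ R := Real.sqrt_le_iff.2 ⟨hR.le, by nlinarith⟩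
  have hq : ‖z + (y - z.im : ℝ) * Complex.I - c‖ = R := by
    refine (pow_left_inj₀ (norm_nonneg _) hR.le two_ne_zero).1 ?_
    rw [hsq]
    simp
    linarith
  have hqim : 0 ≤ (z + (y - z.im : ℝ) * Complex.I - c).im := by
    simp
    linarith
  refine ⟨Complex.arg (z + (y - z.im : ℝ) * Complex.I - c),
    ⟨Complex.arg_nonneg_iff.2 hqim, Complex.arg_le_pi _⟩, ?_⟩
  have e := Complex.norm_mul_exp_arg_mul_I (z + (y - z.im : ℝ) * Complex.I - c)
  rw [hq] at e
  rw [e, add_sub_cancel]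
  refine (joinedWithSpeed_vertical (by linarith) fun s hs => ?_).mono (by linarith : y - z.im ≤ R)
  have him : 0 ≤ (z + s * Complex.I).im := by
    simp
    linarith [hs.1]
  rw [mem_vertexPiece_iff ha hS hc]
  refine ⟨him, ?_, fun T hT hTS => (h3 T hT hTS).trans ?_⟩
  · rw [← hRdef, ← hq]
    have := norm_sub_ofReal_le_of_im_le (c := c) him (sub_nonneg.2 hs.2)
    convert this using 3
    push_cast
    ring
  · exact mul_le_mul_of_nonneg_left (norm_sub_ofReal_le_of_im_le h1 hs.1)
      (invOuterRadius_nonneg ha hT.1)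

theorem arc_mem_vertexPiece (ha : Function.Injective a) {S : Finset (Fin n)}
    (hS : IsCluster a S) (hc : 1 < S.card) {θ : ℝ} (hθ : θ ∈ Icc 0 Real.pi) :
    (clusterCenter a S : ℂ) + innerRadius a S * Complex.exp (θ * Complex.I) ∈ vertexPiece a S := by
  have hR := innerRadius_pos ha hc
  have hn : ‖(clusterCenter a S : ℂ) + innerRadius a S * Complex.exp (θ * Complex.I) -
      clusterCenter a S‖ = innerRadius a S := by
    rw [add_sub_cancel_left, norm_mul, Complex.norm_exp_ofReal_mul_I, Complex.norm_real, mul_one,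
      Real.norm_of_nonneg hR.le]
  rw [mem_vertexPiece_iff ha hS hc]
  refine ⟨?_, hn.le, fun T hT hTS => ?_⟩
  · rw [Complex.add_im, Complex.ofReal_im, zero_add, Complex.im_ofReal_mul,
      Complex.exp_ofReal_mul_I_im]
    exact mul_nonneg hR.le (Real.sin_nonneg_of_mem_Icc hθ)
  · by_contra! h
    have := norm_sub_center_lt_of_ssubset ha hT.1 hTS (by linarith)
    rw [hn] at this
    linarith

/-- The diameter of the piece of a vertex. -/
theorem exists_innerDist_vertexPiece_le : ∃ K : ℝ, 0 < K ∧ ∀ {n : ℕ} {a : Fin n → ℝ},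
    Function.Injective a → ∀ {S : Finset (Fin n)}, IsCluster a S → 1 < S.card → ∀ {A : ℝ},
    (∀ z : ℂ, ‖z - clusterCenter a S‖ ≤ 3 * innerRadius a S →
      ScaledBound (localPotential a S) A (innerRadius a S) z) →
    ∀ x ∈ vertexPiece a S, ∀ y ∈ vertexPiece a S,
      innerDist (modelFactor a) (vertexPiece a S) x y ≤ ENNReal.ofReal (K * Real.exp A) := by
  obtain ⟨K, hK, h⟩ := JoinedWithSpeed.exists_trans
  have hpi := Real.pi_pos
  -- The path goes up from `x`, along the outer arc, and down to `y`, with speeds `R`, `R * π` and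
  -- `R`; two concatenations cost factors `K`, and the conformal factor is at most `exp A / (π *
  -- R)`.
  refine ⟨K * (1 + K * (Real.pi + 1)) / Real.pi, by positivity, ?_⟩
  intro n a ha S hS hc A hA x hx y hy
  have hR := innerRadius_pos ha hc
  obtain ⟨α, hα, h1⟩ := exists_joinedWithSpeed_arc ha hS hc hx
  obtain ⟨β, hβ, h2⟩ := exists_joinedWithSpeed_arc ha hS hc hy
  have h3 := joinedWithSpeed_arc hR.le hα hβ fun θ hθ => arc_mem_vertexPiece ha hS hc hθ
  have h4 := h _ _ _ _ _ _ hR.le (by positivity) h1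
    (h _ _ _ _ _ _ (by positivity) hR.le h3 h2.symm)
  refine (h4.innerDist_le (fun z => (modelFactor_pos z).le)
    fun z hz => (modelFactor_bounds ha hS hc hA hz).2).trans (ENNReal.ofReal_le_ofReal (le_of_eq ?_))
  field_simp

/-- Different legs are attached to the piece of a vertex along distant arcs. -/
theorem innerRadius_le_norm_sub (ha : Function.Injective a) {S I J : Finset (Fin n)}
    (hS : IsCluster a S) (hI : IsCluster a I) (hJ : IsCluster a J) (hIJ : I ≠ J) {x y : ℂ}
    (hx : x ∈ vertexPiece a S) (hx' : x ∈ closedAnnulusPiece a I)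
    (hy : y ∈ vertexPiece a S) (hy' : y ∈ closedAnnulusPiece a J) :
    innerRadius a S ≤ 128 * 129 ^ n * ‖y - x‖ := by
  have hB : (1 : ℝ) ≤ 129 ^ n := one_le_pow₀ (by norm_num)
  -- An outer circle against the circle of a child: the latter lies within half the inner radius of
  -- the center of `S`, so the distance exceeds `R / 2`.
  have hmix : ∀ {T : Finset (Fin n)} {u v : ℂ}, IsCluster a T → T ≠ Finset.univ →
      clusterParent a T = S → ‖u - clusterCenter a S‖ = innerRadius a S →
      invOuterRadius a T * ‖v - clusterCenter a T‖ = 1 →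
      innerRadius a S ≤ 128 * 129 ^ n * ‖u - v‖ := by
    intro T u v hT hTu hp hu hv
    have hTS := (clusterParent_spec ha hT hTu).2.1
    rw [hp] at hTS
    have h1 := norm_sub_center_lt_of_ssubset ha hT.1 hTS (z := v) (by linarith)
    have h2 : ‖u - clusterCenter a S‖ ≤ ‖u - v‖ + ‖v - clusterCenter a S‖ :=
      norm_sub_le_norm_sub_add_norm_sub _ _ _
    nlinarith [norm_nonneg (u - v)]
  rcases boundary_of_mem_vertexPiece ha hS hI hx hx' with ⟨h1, h2⟩ | ⟨h1, h2, h3⟩ <;>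
  rcases boundary_of_mem_vertexPiece ha hS hJ hy hy' with ⟨g1, g2⟩ | ⟨g1, g2, g3⟩
  · exact absurd (h1.trans g1.symm) hIJ
  · rw [norm_sub_rev]
    exact hmix hJ g1 g2 (by rw [← h1, h2]) g3
  · exact hmix hI h1 h2 (by rw [← g1, g2]) h3
  -- Two children: `x` has scaled distance 1 from the center of `I`, while `y`, being on the circle
  -- of the disjoint `J`, has scaled distance more than 2. Hence `‖y - x‖` exceeds the outer radius
  -- of `I`, which is comparable to `R`.
  · have hIS := (clusterParent_spec ha hI h1)
    have hJS := (clusterParent_spec ha hJ g1)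
    have hd : Disjoint J I := by
      rcases hI.trichotomy ha hJ with h | h | h
      · have := hIS.2.2 J hJ (h.ssubset_of_ne hIJ)
        rw [h2, ← g2] at this
        exact absurd this hJS.2.1.2
      · have := hJS.2.2 I hI (h.ssubset_of_ne hIJ.symm)
        rw [g2, ← h2] at this
        exact absurd this hIS.2.1.2
      · exact h.symm
    have h4 := lt_norm_sub_center_of_disjoint ha hJ.1 hI.1 hd (z := y) (by linarith)
    have h5 : ‖y - clusterCenter a I‖ ≤ ‖y - x‖ + ‖x - clusterCenter a I‖ :=
      norm_sub_le_norm_sub_add_norm_sub _ _ _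
    have hκ := invOuterRadius_pos ha hI.1 h1
    have h6 := mul_le_mul_of_nonneg_left h5 hκ.le
    have h7 := invOuterRadius_mul_innerRadius_parent_le ha hI h1
    rw [h2] at h7
    rw [mul_add, h3] at h6
    by_contra! h
    have h8 := mul_lt_mul_of_pos_left h hκ
    nlinarith

theorem closure_annulusPiece_subset (I : Finset (Fin n)) {z : ℂ}
    (hz : z ∈ closure (annulusPiece a I)) (hz' : z ∈ puncturedHalfPlane a) :
    z ∈ closedAnnulusPiece a I := by
  have hcl : IsClosed ({z : ℂ | innerRadius a I ≤ ‖z - clusterCenter a I‖} ∩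
      {z : ℂ | invOuterRadius a I * ‖z - clusterCenter a I‖ ≤ 1}) :=
    (isClosed_le (by fun_prop) (by fun_prop)).inter (isClosed_le (by fun_prop) (by fun_prop))
  exact ⟨hz', hcl.closure_subset_iff.2 (fun w hw => ⟨hw.2.1.le, hw.2.2.le⟩) hz⟩

theorem le_innerDist_of_legs (ha : Function.Injective a) {S I J : Finset (Fin n)}
    (hS : IsCluster a S) (hc : 1 < S.card) {A : ℝ}
    (hA : ∀ z : ℂ, ‖z - clusterCenter a S‖ ≤ 3 * innerRadius a S →
      ScaledBound (localPotential a S) A (innerRadius a S) z)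
    (hI : IsCluster a I) (hJ : IsCluster a J) (hIJ : I ≠ J) {x y : ℂ}
    (hx : x ∈ vertexPiece a S) (hx' : x ∈ closure (annulusPiece a I))
    (hy : y ∈ vertexPiece a S) (hy' : y ∈ closure (annulusPiece a J)) :
    ENNReal.ofReal (Real.exp (-A) / (Real.pi * (128 * 129 ^ n))) ≤
      innerDist (modelFactor a) (vertexPiece a S) x y := by
  have hR := innerRadius_pos ha hc
  have hpi := Real.pi_pos
  have h1 := innerRadius_le_norm_sub ha hS hI hJ hIJ hx (closure_annulusPiece_subset I hx' hx.1)
    hy (closure_annulusPiece_subset J hy' hy.1)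
  refine le_trans (ENNReal.ofReal_le_ofReal ?_) (le_innerDist (by positivity)
    (fun z hz => (modelFactor_bounds ha hS hc hA hz).1) x y)
  rw [div_mul_eq_mul_div, div_le_div_iff₀ (by positivity) (by positivity)]
  calc Real.exp (-A) * (Real.pi * innerRadius a S)
      ≤ Real.exp (-A) * (Real.pi * (128 * 129 ^ n * ‖y - x‖)) := by gcongr
    _ = Real.exp (-A) * ‖y - x‖ * (Real.pi * (128 * 129 ^ n)) := by ring

end VertexGeometry

/-! ### The uniform constant and the assembly of the decomposition. -/

/-- The geometry of the pieces of vertices is controlled by the number of points. -/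
theorem exists_geometry_constant (n : ℕ) : ∃ C : ℝ, 0 < C ∧
    ∀ a : Fin n → ℝ, StrictMono a → ∀ S : Finset (Fin n), IsCluster a S → 1 < S.card →
      (∀ x ∈ vertexPiece a S, ∀ y ∈ vertexPiece a S,
        innerDist (modelFactor a) (vertexPiece a S) x y ≤ ENNReal.ofReal C) ∧
      (∀ z ∈ vertexPiece a S, |gaussCurvature (modelFactor a) z| ≤ C) ∧
      (∀ z ∈ vertexPiece a S,
        InjRadiusGE (modelFactor a) (Complex.ofReal '' range a)ᶜ z (1 / C)) ∧
      ∀ I J, IsCluster a I → IsCluster a J → I ≠ J →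
        ∀ x ∈ vertexPiece a S ∩ closure (annulusPiece a I),
        ∀ y ∈ vertexPiece a S ∩ closure (annulusPiece a J),
          ENNReal.ofReal (1 / C) ≤ innerDist (modelFactor a) (vertexPiece a S) x y := by
  obtain ⟨A, hA1, hA⟩ := exists_scaledBound_localPotential n
  obtain ⟨K, hK, hdiam⟩ := exists_innerDist_vertexPiece_le
  have hpi := Real.pi_pos
  set c1 := K * Real.exp A
  set c2 := 2 * A * Real.pi ^ 2 * Real.exp A ^ 2
  set c3 := min (1 / (256 * 129 ^ n) / 3) (1 / (128 * A)) * (Real.exp (-A) / Real.pi)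
  set c4 := Real.exp (-A) / (Real.pi * (128 * 129 ^ n))
  have h1 : 0 < c1 := by positivity
  have h2 : 0 < c2 := by positivity
  have h3 : 0 < c3 := mul_pos (lt_min (by positivity) (by positivity)) (by positivity)
  have h4 : 0 < c4 := by positivity
  -- The constant is a sum of the upper bounds and of the inverses of the lower bounds, so that its
  -- own inverse lies below each lower bound.
  have hinv : ∀ c, 0 < c → 1 / c ≤ c1 + c2 + 1 / c3 + 1 / c4 →
      1 / (c1 + c2 + 1 / c3 + 1 / c4) ≤ c := fun c hc h => by
    rw [one_div_le (by positivity) hc]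
    exact h
  have h3' : 0 < 1 / c3 := by positivity
  have h4' : 0 < 1 / c4 := by positivity
  refine ⟨c1 + c2 + 1 / c3 + 1 / c4, by positivity, fun a ha S hS hc => ⟨?_, ?_, ?_, ?_⟩⟩
  · exact fun x hx y hy => (hdiam ha.injective hS hc (hA a ha S hc) x hx y hy).trans
      (ENNReal.ofReal_le_ofReal (by linarith))
  · exact fun z hz => (abs_gaussCurvature_le ha.injective hS hc (hA a ha S hc) hz).trans
      (by linarith)
  · exact fun z hz => (injRadiusGE_modelFactor ha.injective hS hc hA1 (hA a ha S hc) hz).mono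
      (hinv c3 h3 (by linarith))
  · exact fun I J hI hJ hIJ x hx y hy => (ENNReal.ofReal_le_ofReal (hinv c4 h4 (by linarith))).trans
      (le_innerDist_of_legs ha.injective hS hc (hA a ha S hc) hI hJ hIJ hx.1 hx.2 hy.1 hy.2)

theorem tendsto_legChart_last {n : ℕ} {a : Fin n → ℝ} (hn : 2 ≤ n) (ha : StrictMono a) :
    Tendsto (legChart a (.inr (Fin.last n))) (comap Complex.re atTop) (Bornology.cobounded ℂ) := by
  rw [legChart, legSign_last]
  exact tendsto_stripMap_outer (legRadius_pos hn ha _)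

theorem tendsto_legChart_castSucc {n : ℕ} {a : Fin n → ℝ} (i : Fin n) :
    Tendsto (legChart a (.inr i.castSucc)) (comap Complex.re atTop) (𝓝 (a i : ℂ)) := by
  have hc : (clusterCenter a {i} : ℂ) = a i :=
    (sub_eq_zero.1 (norm_eq_zero.1 (norm_sub_clusterCenter_singleton i))).symm
  rw [legChart, legSign_castSucc, ← hc, legCluster_castSucc]
  exact tendsto_stripMap_inner _

end

theorem proposition4p1 (N : ℕ) (hN : 3 ≤ N) :
    ∃ C : ℝ, 0 < C ∧ ∀ D : MarkedDisk N,
      ∃ (M : ConformalModel D) (Γ : MetricRibbonTree N) (piece : Γ.Stratum → Set ℂ)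
        (F : Γ.Leg → ℂ → ℂ) (φ : ℂ → Γ.Space),
        -- the decomposition
        (⋃ ν, piece ν) = M.Θ ∧
        -- the pieces of the vertices have bounded geometry
        (∀ v : Γ.V, M.BoundedGeometry C (piece (.inl v))) ∧
        -- the arcs along which two different legs are attached to a vertex piece
        -- stay at a definite distance inside that piece
        (∀ (v : Γ.V) (ℓ ℓ' : Γ.Leg), ℓ ≠ ℓ' →
          ∀ x ∈ piece (.inl v) ∩ closure (piece (.inr ℓ)),
          ∀ y ∈ piece (.inl v) ∩ closure (piece (.inr ℓ')),
            ENNReal.ofReal (1 / C) ≤ innerDist M.ρ (piece (.inl v)) x y) ∧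
        -- the pieces of the legs are flat strips
        (∀ ℓ : Γ.Leg, M.IsStripIsometry (Γ.length ℓ) (piece (.inr ℓ)) (F ℓ)) ∧
        -- the strip of the i-th external leg leads to the i-th marked point
        (∀ i : Fin N, Filter.Tendsto (fun w => M.chart.symm (F (.inr i) w))
          (Filter.comap Complex.re Filter.atTop ⊓ Filter.principal (flatStrip ⊤))
          (nhds (D.pt i))) ∧
        -- the projection to the tree
        ContinuousOn φ M.Θ ∧
        (∀ ν : Γ.Stratum, φ '' piece ν = Γ.stratumSet ν) ∧
        (∀ (ℓ : Γ.Leg) (x : Γ.ClosedLeg ℓ), 0 < x.1 → (x.1 : EReal) < Γ.length ℓ →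
          ∀ y ∈ Set.Icc (0 : ℝ) 1, φ (F ℓ ⟨x.1, y⟩) = Γ.legPoint ℓ x) := by
  obtain ⟨n, rfl⟩ : ∃ n, N = n + 1 := ⟨N - 1, by omega⟩
  have hn : 2 ≤ n := by omega
  have : NeZero n := ⟨by omega⟩
  obtain ⟨C, hC, h⟩ := exists_geometry_constant n
  refine ⟨C, hC, fun D => ?_⟩
  obtain ⟨a, M, ha, hP, hρ, hpt, hlast⟩ := exists_conformalModel D
  have hΘ : M.Θ = puncturedHalfPlane a := by rw [ConformalModel.Θ, hP, puncturedHalfPlane]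
  refine ⟨M, clusterTree hn ha, treePiece hn ha, legChart a, treeProjection hn ha,
    ?_, ?_, ?_, ?_, ?_, ?_, ?_, ?_⟩
  · rw [hΘ]
    exact iUnion_treePiece hn ha
  · intro v
    obtain ⟨h1, h2, h3, _⟩ := h a ha v.1 v.2.1 v.2.2
    rw [ConformalModel.BoundedGeometry, hρ, ConformalModel.double, hP]
    exact ⟨h1, h2, h3⟩
  · intro v l l' hl x hx y hy
    rw [hρ]
    exact (h a ha v.1 v.2.1 v.2.2).2.2.2 _ _ (isCluster_legCluster l) (isCluster_legCluster l')
      (fun he => hl (legCluster_injective hn he)) x hx y hy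
  · exact isStripIsometry_legChart hn ha M hρ
  · intro i
    -- The limit already holds as the real part tends to infinity on the whole plane.
    refine Tendsto.mono_left ?_ inf_le_left
    induction i using Fin.lastCases with
    | last => exact hlast.comp (tendsto_legChart_last hn ha)
    | cast i => exact (hpt i).comp (tendsto_legChart_castSucc i)
  · rw [hΘ]
    exact continuousOn_treeProjection hn ha
  · exact treeProjection_image hn ha
  · intro l x h0 h1 y hy
    exact treeProjection_legChart hn ha ⟨h0, h1, hy.1, hy.2⟩
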